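/- Let $\mathbb K$ be a field and let $q\in\mathbb K^*$ be not a root of unity. The quantum spatial ageing algebra $\mathcal A$ is the $\mathbb K$-algebra generated by $E,K,K^{-1},X,Y$ subject to $KK^{-1}=K^{-1}K=1$ and $$EK=q^{-2}KE,\quad XK=q^{-1}KX,\quad YK=qKY,\quad EX=qXE,\quad EY=X+q^{-1}YE,\quad qYX=XY .$$ Put $\varphi=X+(q^{-1}-q)YE$, $Z=\varphi YK^{-1}$, $C=XYK$; let $\mathbb E\subset\mathcal A$ be the subalgebra generated by $X,E,Y$, and let $L=\mathbb K[K^{\pm1}]$. For a ring $D$ with automorphism $\tau$, $D[K^{\pm1};\tau]$ is the skew Laurent polynomial ring with $Kd=\tau(d)K$; let $\mathbb Y=\mathbb K[Y^{\pm1}][K^{\pm1};\tau]$ with $\tau(Y)=q^{-1}Y$. $(a,b,\dots)$ denotes the two-sided ideal generated by the listed elements (and by the images in $\mathcal A$ of the listed ideals of $\mathbb K[K^{\pm1}]$, $\mathbb K[Z]$, $\mathbb K[C]$). $\operatorname{Spec}$ is the set of prime two-sided ideals, ordered by inclusion, and $R_{s,\dots}$ is the left Ore localization of $R$ at the multiplicative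 set generated by $s,\dots$ (all sets occurring below are left denominator sets). For an ideal $I$, $I_{s,\dots}$ is its extension to the localization. **Theorem.** The prime ideals of $\mathcal A$ are, without repetition, $0$, $(X)$, $(\varphi)$, $(Y)$, $(E)$, $(Y,E)$ and the members of the three infinite families of maximal ideals $$(Y,E,\mathfrak p)\ \ (\mathfrak p\in\operatorname{Max}\mathbb K[K^{\pm1}]),\qquad (X,\mathfrak q)\ \ (\mathfrak q\in\operatorname{Max}\mathbb K[Z]\setminus\{(Z)\}),\qquad (\varphi,\mathfrak r)\ \ (\mathfrak r\in\operatorname{Max}\mathbb K[C]\setminus\{(C)\}).$$ The inclusions between them are exactly those in the reflexive transitive closure of $0\subset(X)$, $0\subset(\varphi)$, $(X)\subset(Y)$, $(X)\subset(E)$, $(\varphi)\subset(Y)$, $(\varphi)\subset(E)$, $(Y)\subset(Y,E)$, $(E)\subset(Y,E)$, $(Y,E)\subset(Y,E,\mathfrak p)$, $(X)\subset(X,\mathfrak q)$, $(\varphi)\subset(\varphi,\mathfrak r)$. Contraction of prime ideals along the natural maps from $\mathcal A$ is injective on the spectrum of each of the following six algebras, and identifies $$\operatorname{Spec}\mathcal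 A=\operatorname{Spec}L\sqcup\operatorname{Spec}U_E\sqcup\operatorname{Spec}\mathbb Y\sqcup\operatorname{Spec}\big((\mathcal A/(X))_Z\big)\sqcup\operatorname{Spec}\big(\mathcal A_X/(\varphi)_X\big)\sqcup\operatorname{Spec}\mathcal A_{X,\varphi},$$ where $U=\mathcal A/(X,Z,Y)$, $\mathcal A\to L$ sends $X,Y,E\mapsto0$, $K\mapsto K$, and $\mathbb Y\simeq(\mathcal A/(X,Z))_Y$ via $Y\mapsto Y$, $K\mapsto K$. With these identifications (all isomorphisms are isomorphisms of $\mathbb K$-algebras, and are the natural ones on the generators): 1. $\operatorname{Spec}L=\{(Y,E,\mathfrak p)\mid\mathfrak p\in\operatorname{Spec}\mathbb K[K^{\pm1}]\}$ and $\mathcal A/(Y,E,\mathfrak p)\simeq L/\mathfrak p$. 2. $\operatorname{Spec}U_E=\{(Y)\}$, $(Y)=(X,Y)=(X,Z,Y)$ and $\mathcal A/(Y)\simeq\mathbb K[E][K^{\pm1};\tau]$, $\tau(E)=q^2E$. 3. $\operatorname{Spec}\mathbb Y=\{(E)\}$, $(E)=(E,X)=(E,\varphi)$ and $\mathcal A/(E)\simeq\mathbb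 K[Y][K^{\pm1};\tau]$, $\tau(Y)=q^{-1}Y$. 4. $\operatorname{Spec}\big((\mathcal A/(X))_Z\big)=\{(X)\}\cup\{(X,\mathfrak q)\mid\mathfrak q\in\operatorname{Max}\mathbb K[Z]\setminus\{(Z)\}\}$. (a) $\mathcal A/(X)\simeq(\mathbb E/(X))[K^{\pm1};\tau]$ is a domain, where $\mathbb E/(X)\simeq\mathbb K\langle E,Y\mid EY=q^{-1}YE\rangle$, $\tau(E)=q^2E$, $\tau(Y)=q^{-1}Y$. (b) $\mathcal A/(X,\mathfrak q)\simeq\mathcal A_{\varphi,Y}/(X,\mathfrak q)_{\varphi,Y}\simeq L_{\mathfrak q}\otimes_{\mathbb K}\mathbb Y$ is a simple domain, where $L_{\mathfrak q}=\mathbb K[Z]/\mathfrak q$ is a finite field extension of $\mathbb K$. 5. $\operatorname{Spec}\big(\mathcal A_X/(\varphi)_X\big)=\{(\varphi)\}\cup\{(\varphi,\mathfrak r)\mid\mathfrak r\in\operatorname{Max}\mathbb K[C]\setminus\{(C)\}\}$ and $\mathcal A_X/(\varphi)_X\simeq\mathcal A_{X,Y}/(\varphi)_{X,Y}\simeq\mathbb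 K[C^{\pm1}]\otimes_{\mathbb K}\mathbb Y$. (a) $\mathcal A/(\varphi)\simeq(\mathbb E/(\varphi))[K^{\pm1};\tau]$ is a domain, where $\mathbb E/(\varphi)\simeq\mathbb K\langle E,Y\mid EY=qYE\rangle$, $\tau(E)=q^2E$, $\tau(Y)=q^{-1}Y$. (b) $\mathcal A/(\varphi,\mathfrak r)\simeq\mathcal A_{X,Y}/(\varphi,\mathfrak r)_{X,Y}\simeq L_{\mathfrak r}\otimes_{\mathbb K}\mathbb Y$ is a simple domain, where $L_{\mathfrak r}=\mathbb K[C]/\mathfrak r$ is a finite field extension of $\mathbb K$. 6. $\operatorname{Spec}\mathcal A_{X,\varphi}=\{0\}$. -/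

import Mathlib

namespace QAge

noncomputable section

/-! Prime ideals of noncommutative rings, contraction, localization -/

/-- A two-sided ideal `P` of a ring `R` is prime if `P ≠ R` and, for two-sided ideals `I`, `J`,
`I J ⊆ P` implies `I ⊆ P` or `J ⊆ P`. -/
def IsPrimeIdeal {R : Type*} [Ring R] (P : TwoSidedIdeal R) : Prop :=
  P ≠ ⊤ ∧ ∀ I J : TwoSidedIdeal R, (∀ a ∈ I, ∀ b ∈ J, a * b ∈ P) → I ≤ P ∨ J ≤ P

/-- The prime spectrum of a ring, a set of two-sided ideals. -/
def Spec (R : Type*) [Ring R] : Set (TwoSidedIdeal R) := {P | IsPrimeIdeal P}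

/-- The factor ring by a two-sided ideal. -/
abbrev Quo {R : Type*} [Ring R] (I : TwoSidedIdeal R) : Type _ := R ⧸ I.asIdeal

section General

variable (k : Type*) [Field k] {R B : Type*} [Ring R] [Algebra k R] [Ring B] [Algebra k B]

/-- The canonical epimorphism `R → R / I`. -/
abbrev quo (I : TwoSidedIdeal R) : R →ₐ[k] Quo I := Ideal.Quotient.mkₐ k I.asIdeal

/-- The canonical map `R → S⁻¹R`, `a ↦ a / 1`, for a left denominator set `S`. -/
def loc (S : Submonoid R) [OreLocalization.OreSet S] : R →ₐ[k] OreLocalization S R where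
  __ := (OreLocalization.numeratorRingHom : R →+* OreLocalization S R)
  commutes' _ := rfl

variable {k}

/-- The set of contractions to `R` of the prime ideals of `B`, for `f : R → B`. -/
def contr (f : R →ₐ[k] B) : Set (TwoSidedIdeal R) := TwoSidedIdeal.comap f '' Spec B

end General

/-! Skew Laurent polynomial algebras and the quantum plane -/

section SkewLaurent

variable {k : Type*} [Field k] {D : Type*} [Ring D] [Algebra k D]

/-- The action of `ℤ` on `D` by the powers of `σ`. -/
abbrev powAction (σ : D ≃ₐ[k] D) : MulSemiringAction (Multiplicative ℤ) D :=
  MulSemiringAction.compHom D (zpowersHom (D ≃ₐ[k] D) σ)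

/-- The skew Laurent polynomial algebra `D[t, t⁻¹; σ]`: a free left `D`-module on the powers of
`t`, with `t d = σ(d) t`. -/
def SkewLaurent (_σ : D ≃ₐ[k] D) : Type _ := SkewMonoidAlgebra D (Multiplicative ℤ)

instance (σ : D ≃ₐ[k] D) : Ring (SkewLaurent σ) :=
  @SkewMonoidAlgebra.instRing D (Multiplicative ℤ) _ _ (powAction σ)

/-- The inclusion `D → D[t, t⁻¹; σ]`, as a ring homomorphism. -/
def SkewLaurent.coefHom (σ : D ≃ₐ[k] D) : D →+* SkewLaurent σ :=
  @SkewMonoidAlgebra.singleOneRingHom D (Multiplicative ℤ) _ _ (powAction σ)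

instance (σ : D ≃ₐ[k] D) : Algebra k (SkewLaurent σ) :=
  @SkewMonoidAlgebra.instAlgebraOfSMulCommClass k (Multiplicative ℤ) _ _ D _ _ (powAction σ)
    (@SMulCommClass.mk _ _ _ (powAction σ).toSMul _
      fun n c d => map_smul (zpowersHom (D ≃ₐ[k] D) σ n) c d)

/-- The inclusion `D → D[t, t⁻¹; σ]`. -/
def SkewLaurent.coef (σ : D ≃ₐ[k] D) : D →ₐ[k] SkewLaurent σ :=
  { SkewLaurent.coefHom σ with commutes' := fun _ => rfl }

/-- The element `t` of `D[t, t⁻¹; σ]`. -/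
def SkewLaurent.t (σ : D ≃ₐ[k] D) : SkewLaurent σ :=
  (SkewMonoidAlgebra.single (Multiplicative.ofAdd 1) 1 : SkewMonoidAlgebra D (Multiplicative ℤ))

end SkewLaurent

section Scaling

variable {k : Type*} [Field k]

/-- The automorphism of `k[H]` with `H ↦ c H`. -/
def polyScale (c : kˣ) : Polynomial k ≃ₐ[k] Polynomial k :=
  AlgEquiv.ofAlgHom
    (Polynomial.aeval ((c : k) • Polynomial.X))
    (Polynomial.aeval (((c⁻¹ : kˣ) : k) • Polynomial.X))
    (by ext1; simp [smul_smul])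
    (by ext1; simp [smul_smul])

/-- The endomorphism of `k[H, H⁻¹]` with `H ↦ c H`, that is `Hⁿ ↦ cⁿ Hⁿ`. -/
def laurentScaleHom (c : kˣ) : LaurentPolynomial k →ₐ[k] LaurentPolynomial k :=
  AddMonoidAlgebra.lift k (LaurentPolynomial k) ℤ
    { toFun := fun n => ((c ^ n.toAdd : kˣ) : k) • LaurentPolynomial.T n.toAdd
      map_one' := by
        rw [toAdd_one, zpow_zero, Units.val_one, one_smul, LaurentPolynomial.T_zero]
      map_mul' := fun m n => by
        rw [toAdd_mul, zpow_add, LaurentPolynomial.T_add, smul_mul_smul_comm, Units.val_mul] }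

theorem laurentScaleHom_T (c : kˣ) (n : ℤ) :
    laurentScaleHom c (LaurentPolynomial.T n) =
      ((c ^ n : kˣ) : k) • (LaurentPolynomial.T n : LaurentPolynomial k) := by
  rw [laurentScaleHom, LaurentPolynomial.T, AddMonoidAlgebra.lift_single, one_smul]
  rfl

theorem laurentScaleHom_comp (c d : kˣ) (h : c * d = 1) :
    (laurentScaleHom c).comp (laurentScaleHom d) = AlgHom.id k (LaurentPolynomial k) := by
  have key : ∀ n : ℤ, laurentScaleHom c (laurentScaleHom d (LaurentPolynomial.T n)) =
      LaurentPolynomial.T n := by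
    intro n
    have h1 : d ^ n * c ^ n = 1 := by rw [← mul_zpow, mul_comm d c, h, one_zpow]
    rw [laurentScaleHom_T, map_smul, laurentScaleHom_T, smul_smul, ← Units.val_mul, h1,
      Units.val_one, one_smul]
  refine AddMonoidAlgebra.algHom_ext (φ₁ := (laurentScaleHom c).comp (laurentScaleHom d))
    (φ₂ := AlgHom.id k (LaurentPolynomial k)) (fun n => key n)
    (Subsingleton.elim _ _)

/-- The automorphism of `k[H, H⁻¹]` with `H ↦ c H`. -/
def laurentScale (c : kˣ) : LaurentPolynomial k ≃ₐ[k] LaurentPolynomial k :=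
  AlgEquiv.ofAlgHom (laurentScaleHom c) (laurentScaleHom c⁻¹)
    (laurentScaleHom_comp _ _ (by simp)) (laurentScaleHom_comp _ _ (by simp))

/-- The defining relation `E Y = c Y E` of the quantum plane on `E = ι 0`, `Y = ι 1`. -/
inductive PlaneRel (c : kˣ) : FreeAlgebra k (Fin 2) → FreeAlgebra k (Fin 2) → Prop
  | EY : PlaneRel c (FreeAlgebra.ι k 0 * FreeAlgebra.ι k 1)
      ((c : k) • (FreeAlgebra.ι k 1 * FreeAlgebra.ι k 0))

/-- The quantum plane `k⟨E, Y | E Y = c Y E⟩`. -/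
abbrev Plane (c : kˣ) : Type _ := RingQuot (PlaneRel c)

/-- The generator `E` of the quantum plane. -/
def planeE (c : kˣ) : Plane c := RingQuot.mkAlgHom k (PlaneRel c) (FreeAlgebra.ι k 0)

/-- The generator `Y` of the quantum plane. -/
def planeY (c : kˣ) : Plane c := RingQuot.mkAlgHom k (PlaneRel c) (FreeAlgebra.ι k 1)

/-- The algebra `𝕐 = k[Y, Y⁻¹][K, K⁻¹; τ]` with `τ(Y) = q⁻¹ Y`. -/
abbrev YY (q : kˣ) : Type _ := SkewLaurent (laurentScale q⁻¹)

/-- The element `Y` of `𝕐`. -/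
def yyY (q : kˣ) : YY q := SkewLaurent.coef (laurentScale q⁻¹) (LaurentPolynomial.T 1)

/-- The element `K` of `𝕐`. -/
def yyK (q : kˣ) : YY q := SkewLaurent.t (laurentScale q⁻¹)

end Scaling

/-! The quantum spatial ageing algebra -/

/-- The canonical generators. -/
inductive Gen
  | E | K | Kinv | X | Y

section Ageing

variable {k : Type*} [Field k] (q : kˣ)

open FreeAlgebra in
/-- The defining relations of the quantum spatial ageing algebra. -/
inductive Rel : FreeAlgebra k Gen → FreeAlgebra k Gen → Prop
  | K_Kinv : Rel (ι k Gen.K * ι k Gen.Kinv) 1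
  | Kinv_K : Rel (ι k Gen.Kinv * ι k Gen.K) 1
  | EK : Rel (ι k Gen.E * ι k Gen.K) (((q⁻¹ ^ 2 : kˣ) : k) • (ι k Gen.K * ι k Gen.E))
  | XK : Rel (ι k Gen.X * ι k Gen.K) (((q⁻¹ : kˣ) : k) • (ι k Gen.K * ι k Gen.X))
  | YK : Rel (ι k Gen.Y * ι k Gen.K) ((q : k) • (ι k Gen.K * ι k Gen.Y))
  | EX : Rel (ι k Gen.E * ι k Gen.X) ((q : k) • (ι k Gen.X * ι k Gen.E))
  | EY : Rel (ι k Gen.E * ι k Gen.Y)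
      (ι k Gen.X + ((q⁻¹ : kˣ) : k) • (ι k Gen.Y * ι k Gen.E))
  | YX : Rel ((q : k) • (ι k Gen.Y * ι k Gen.X)) (ι k Gen.X * ι k Gen.Y)

/-- The quantum spatial ageing algebra `𝒜`. -/
def Alg : Type _ := RingQuot (Rel q)

instance : Ring (Alg q) := inferInstanceAs (Ring (RingQuot (Rel q)))

instance : Algebra k (Alg q) := inferInstanceAs (Algebra k (RingQuot (Rel q)))

/-- The canonical epimorphism from the free algebra. -/
def mkAlg : FreeAlgebra k Gen →ₐ[k] Alg q := RingQuot.mkAlgHom k (Rel q)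

theorem mkAlg_rel {a b : FreeAlgebra k Gen} (h : Rel q a b) : mkAlg q a = mkAlg q b :=
  RingQuot.mkAlgHom_rel k h

/-- The image in `𝒜` of a canonical generator. -/
def gen (g : Gen) : Alg q := mkAlg q (FreeAlgebra.ι k g)

abbrev gE : Alg q := gen q Gen.E
abbrev gK : Alg q := gen q Gen.K
abbrev gKinv : Alg q := gen q Gen.Kinv
abbrev gX : Alg q := gen q Gen.X
abbrev gY : Alg q := gen q Gen.Y

theorem gK_mul_gKinv : gK q * gKinv q = 1 := by
  rw [gK, gKinv, gen, gen, ← map_mul, mkAlg_rel q Rel.K_Kinv, map_one]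

theorem gKinv_mul_gK : gKinv q * gK q = 1 := by
  rw [gK, gKinv, gen, gen, ← map_mul, mkAlg_rel q Rel.Kinv_K, map_one]

/-- `K` as a unit of `𝒜`. -/
def unitK : (Alg q)ˣ := ⟨gK q, gKinv q, gK_mul_gKinv q, gKinv_mul_gK q⟩

/-- The normal element `φ = X + (q⁻¹ - q) Y E`. -/
def phi : Alg q := gX q + (((q⁻¹ : kˣ) : k) - (q : k)) • (gY q * gE q)

/-- `Z = φ Y K⁻¹`. -/
def elZ : Alg q := phi q * gY q * gKinv q

/-- `C = X Y K`. -/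
def elC : Alg q := gX q * gY q * gK q

/-- The homomorphism `k[K, K⁻¹] → 𝒜`, `K ↦ K`. -/
def laurentK : LaurentPolynomial k →ₐ[k] Alg q :=
  AddMonoidAlgebra.lift k (Alg q) ℤ
    ((Units.coeHom (Alg q)).comp (zpowersHom (Alg q)ˣ (unitK q)))

/-- The subalgebra `𝔼` of `𝒜` generated by `X`, `E` and `Y`. -/
def EE : Subalgebra k (Alg q) := Algebra.adjoin k {gX q, gE q, gY q}

def eX : EE q := ⟨gX q, Algebra.subset_adjoin (by simp)⟩
def eE : EE q := ⟨gE q, Algebra.subset_adjoin (by simp)⟩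
def eY : EE q := ⟨gY q, Algebra.subset_adjoin (by simp)⟩

/-- The element `φ` of `𝔼`. -/
def ePhi : EE q := eX q + (((q⁻¹ : kˣ) : k) - (q : k)) • (eY q * eE q)

/-- The two-sided ideal of `𝒜` generated by a set. -/
abbrev idl (s : Set (Alg q)) : TwoSidedIdeal (Alg q) := TwoSidedIdeal.span s

/-- The ideal `(Y, E, 𝔭)` for an ideal `𝔭` of `k[K, K⁻¹]`. -/
def idlYEp (p : Ideal (LaurentPolynomial k)) : TwoSidedIdeal (Alg q) :=
  idl q ({gY q, gE q} ∪ laurentK q '' p)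

/-- The ideal `(X, 𝔪)` for an ideal `𝔪` of `k[Z]`. -/
def idlXm (m : Ideal (Polynomial k)) : TwoSidedIdeal (Alg q) :=
  idl q ({gX q} ∪ Polynomial.aeval (elZ q) '' (m : Set (Polynomial k)))

/-- The ideal `(φ, 𝔯)` for an ideal `𝔯` of `k[C]`. -/
def idlPhir (r : Ideal (Polynomial k)) : TwoSidedIdeal (Alg q) :=
  idl q ({phi q} ∪ Polynomial.aeval (elC q) '' (r : Set (Polynomial k)))

/-! The diagram -/

variable (k) in
/-- `Max(k[H]) \ {(H)}`. -/
abbrev MaxNZ : Type _ :=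
  {m : MaximalSpectrum (Polynomial k) // m.asIdeal ≠ Ideal.span {Polynomial.X}}

variable (k) in
/-- The vertices of the diagram of primes. -/
inductive Vertex
  | zero | X | phi | Y | E | YE
  | YEp (p : MaximalSpectrum (LaurentPolynomial k))
  | Xm (m : MaxNZ k)
  | phir (r : MaxNZ k)

/-- The prime ideal at a vertex. -/
def primeAt : Vertex k → TwoSidedIdeal (Alg q)
  | .zero => ⊥
  | .X => idl q {gX q}
  | .phi => idl q {phi q}
  | .Y => idl q {gY q}
  | .E => idl q {gE q}
  | .YE => idl q {gY q, gE q}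
  | .YEp p => idlYEp q p.asIdeal
  | .Xm m => idlXm q m.1.asIdeal
  | .phir r => idlPhir q r.1.asIdeal

/-- The lines of the diagram, from the lower to the upper vertex. -/
inductive Line : Vertex k → Vertex k → Prop
  | zero_X : Line .zero .X
  | zero_phi : Line .zero .phi
  | X_Y : Line .X .Y
  | X_E : Line .X .E
  | phi_Y : Line .phi .Y
  | phi_E : Line .phi .E
  | Y_YE : Line .Y .YE
  | E_YE : Line .E .YE
  | YE_YEp (p : MaximalSpectrum (LaurentPolynomial k)) : Line .YE (.YEp p)
  | X_Xm (m : MaxNZ k) : Line .X (.Xm m)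
  | phi_phir (r : MaxNZ k) : Line .phi (.phir r)

/-! The localizations and the homomorphisms from `𝒜` to them -/

/-- The denominator set of `𝒜_X`. -/
abbrev denX : Submonoid (Alg q) := Submonoid.powers (gX q)
/-- The denominator set of `𝒜_{X,φ}`. -/
abbrev denXPhi : Submonoid (Alg q) := Submonoid.closure {gX q, phi q}
/-- The denominator set of `𝒜_{X,Y}`. -/
abbrev denXY : Submonoid (Alg q) := Submonoid.closure {gX q, gY q}
/-- The denominator set of `𝒜_{φ,Y}`. -/
abbrev denPhiY : Submonoid (Alg q) := Submonoid.closure {phi q, gY q}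

/-- `𝒜/(X)`. -/
abbrev AX : Type _ := Quo (idl q {gX q})
/-- `𝒜/(X, Z)`. -/
abbrev AXZ : Type _ := Quo (idl q {gX q, elZ q})
/-- `U = 𝒜/(X, Z, Y)`. -/
abbrev AXZY : Type _ := Quo (idl q {gX q, elZ q, gY q})

/-- The denominator set of `(𝒜/(X))_Z`. -/
abbrev denZ : Submonoid (AX q) := Submonoid.powers (quo k (idl q {gX q}) (elZ q))
/-- The denominator set of `(𝒜/(X, Z))_Y`. -/
abbrev denY : Submonoid (AXZ q) := Submonoid.powers (quo k (idl q {gX q, elZ q}) (gY q))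
/-- The denominator set of `U_E`. -/
abbrev denE : Submonoid (AXZY q) := Submonoid.powers (quo k (idl q {gX q, elZ q, gY q}) (gE q))

/-- The images of the generators in `L = k[K, K⁻¹]`. -/
def genL : Gen → LaurentPolynomial k
  | .E => 0
  | .K => LaurentPolynomial.T 1
  | .Kinv => LaurentPolynomial.T (-1)
  | .X => 0
  | .Y => 0

/-- `𝒜 → L = k[K, K⁻¹]`, `K ↦ K`, `X, Y, E ↦ 0`. -/
def toL : Alg q →ₐ[k] LaurentPolynomial k :=
  RingQuot.liftAlgHom k (s := Rel q) ⟨FreeAlgebra.lift k genL, by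
    intro a b h
    induction h <;> simp only [map_mul, map_add, map_smul, map_one, FreeAlgebra.lift_ι_apply, genL,
      mul_zero, zero_mul, smul_zero, add_zero, ← LaurentPolynomial.T_add] <;> rfl⟩

open OreLocalization (OreSet)

/-- `𝒜 → U → U_E`. -/
def toUE [OreSet (denE q)] : Alg q →ₐ[k] OreLocalization (denE q) (AXZY q) :=
  (loc k (denE q)).comp (quo k _)

/-- `𝒜 → 𝒜/(X, Z) → (𝒜/(X, Z))_Y`. -/
def toAXZloc [OreSet (denY q)] : Alg q →ₐ[k] OreLocalization (denY q) (AXZ q) :=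
  (loc k (denY q)).comp (quo k _)

/-- `𝒜 → 𝒜/(X) → (𝒜/(X))_Z`. -/
def toAXloc [OreSet (denZ q)] : Alg q →ₐ[k] OreLocalization (denZ q) (AX q) :=
  (loc k (denZ q)).comp (quo k _)

/-- The extension `S⁻¹I` of a two-sided ideal `I` of `𝒜`. -/
abbrev ext (S : Submonoid (Alg q)) [OreSet S] (I : TwoSidedIdeal (Alg q)) :
    TwoSidedIdeal (OreLocalization S (Alg q)) := TwoSidedIdeal.map (loc k S) I

/-- `𝒜 → S⁻¹𝒜 → S⁻¹𝒜 / S⁻¹I`. -/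
def toLocQuo (S : Submonoid (Alg q)) [OreSet S] (I : TwoSidedIdeal (Alg q)) :
    Alg q →ₐ[k] Quo (ext q S I) :=
  (quo k _).comp (loc k S)

end Ageing

end

end QAge

open QAge
open OreLocalization (OreSet)
open scoped TensorProduct

namespace QAge

noncomputable section

open OreLocalization (OreSet)

/-! ### Factor rings, prime ideals, contraction and Ore localization -/

section General

variable {k : Type*} [Field k] {R B : Type*} [Ring R] [Algebra k R] [Ring B] [Algebra k B]

/-! Everything is read off from quantum tori. The elements C = XYK and Z = φYK⁻¹ commute with Y and
K and satisfy CZ = q²ZC. Conversely X = q⁻¹CY⁻¹K⁻¹ and φ = qZY⁻¹K, and E is recovered from φ - X =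
(q⁻¹ - q)YE. Hence any algebra W with two elements satisfying CZ = q²ZC yields a homomorphism
`torusHom` from 𝒜 to W ⊗ 𝕐, and neither element has to be invertible. If W is the quantum torus in C
and Z, this is an embedding of 𝒜 in a torus of rank four (`bigHom`). If one of C, Z is 0 and the
other is the variable of k[T, T⁻¹], the kernel is (φ) or (X) (`lau`). If that variable is
specialized to k[T]/𝔪 with 𝔪 ≠ (T), the map is onto with kernel (φ, 𝔪) or (X, 𝔪) (`fieldChart`). Two
tori of rank two (`axTorus`) have kernels (Y) and (E), and `toL` has kernel (Y, E).

All torus targets have a basis that is multiplicative up to scalars (`IsTwisted`). Such an algebra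
is a domain if its coefficient ring is one. Since q is not a root of unity, conjugation by monomials
separates the monomials, so a two-sided ideal contains the coefficients of its elements
(`IsTwisted.coeff_mem`); over a field the algebra is simple. Kernels are computed by comparing a
spanning set of monomials of the source with the monomial basis of the target, so only spanning has
to be proved in 𝒜.

For the classification (`IsPrimeIdeal.cases`) let P be prime; X and φ are normal. If neither lies in
P, both cancel modulo P. A nonzero P would extend to the whole simple torus of rank four, so it
would contain a power of XφY, hence a power of Y after cancelling; commuting with E lowers that
power until 1 ∈ P (`eq_top_of_cancel`). If X ∈ P and Z ∉ P, or φ ∈ P and X ∉ P, then P comes from a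
prime of k[T, T⁻¹] ⊗ 𝕐 (`contr_lau`), and these primes come from k[T, T⁻¹]. Otherwise X and φ lie in
P, hence so does YE, hence Y or E; what remains is the two tori of rank two and the commutative ring
k[K, K⁻¹].

The inclusions follow by testing which of X, φ, Y, E lie in which prime, together with the
maximality of the members of the three infinite families (`primeAt_le_iff`).

Symmetric cases are indexed by `Bool`: for `nrm`, `cen` and `chart`, `true` is the branch where X
vanishes and `false` the one where φ does; for `axGen`, `true` is E and `false` is Y. -/

theorem quo_surjective (I : TwoSidedIdeal R) : Function.Surjective (quo k I) :=
  Ideal.Quotient.mkₐ_surjective k I.asIdeal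

theorem quo_eq_zero_iff (I : TwoSidedIdeal R) {a : R} : quo k I a = 0 ↔ a ∈ I := by
  rw [← TwoSidedIdeal.mem_asIdeal]
  exact Ideal.Quotient.eq_zero_iff_mem

/-- The factorization of a homomorphism through a factor ring. -/
def quoLift (I : TwoSidedIdeal R) (f : R →ₐ[k] B) (h : ∀ a ∈ I, f a = 0) : Quo I →ₐ[k] B :=
  Ideal.Quotient.liftₐ I.asIdeal f fun a ha => h a (TwoSidedIdeal.mem_asIdeal.1 ha)

@[simp]
theorem quoLift_quo (I : TwoSidedIdeal R) (f : R →ₐ[k] B) (h : ∀ a ∈ I, f a = 0) (a : R) :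
    quoLift I f h (quo k I a) = f a := rfl

theorem quoLift_injective (I : TwoSidedIdeal R) (f : R →ₐ[k] B) (h : ∀ a, f a = 0 ↔ a ∈ I) :
    Function.Injective (quoLift I f fun a ha => (h a).2 ha) := by
  rw [injective_iff_map_eq_zero]
  intro x hx
  obtain ⟨a, rfl⟩ := quo_surjective (k := k) I x
  rw [quoLift_quo] at hx
  exact (quo_eq_zero_iff I).2 ((h a).1 hx)

theorem exists_quo_equiv (I : TwoSidedIdeal R) (f : R →ₐ[k] B) (hf : Function.Surjective f)
    (h : ∀ a, f a = 0 ↔ a ∈ I) : ∃ e : Quo I ≃ₐ[k] B, ∀ a, e (quo k I a) = f a :=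
  ⟨AlgEquiv.ofBijective (quoLift I f fun a ha => (h a).2 ha)
    ⟨quoLift_injective I f h, fun b => by
      obtain ⟨a, rfl⟩ := hf b
      exact ⟨quo k I a, rfl⟩⟩, fun _ => rfl⟩

theorem map_eq_zero_of_mem_span (f : R →ₐ[k] B) {s : Set R} (hs : ∀ x ∈ s, f x = 0) {a : R}
    (ha : a ∈ TwoSidedIdeal.span s) : f a = 0 := by
  have : TwoSidedIdeal.span s ≤ TwoSidedIdeal.ker f :=
    TwoSidedIdeal.span_le.2 fun x hx => (TwoSidedIdeal.mem_ker f).2 (hs x hx)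
  exact (TwoSidedIdeal.mem_ker f).1 (this ha)

theorem isDomain_quo [IsDomain B] (I : TwoSidedIdeal R) (f : R →ₐ[k] B)
    (h : ∀ a, f a = 0 ↔ a ∈ I) : IsDomain (Quo I) :=
  (quoLift_injective I f h).isDomain _

/-! Prime ideals -/

theorem one_notMem_of_ne_top {P : TwoSidedIdeal R} (h : P ≠ ⊤) : (1 : R) ∉ P := fun h1 =>
  h (eq_top_iff.2 fun x _ => by simpa using P.mul_mem_left x 1 h1)

theorem eq_top_of_one_mem {P : TwoSidedIdeal R} (h1 : (1 : R) ∈ P) : P = ⊤ :=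
  by_contra fun h => one_notMem_of_ne_top h h1

theorem IsPrimeIdeal.one_notMem {P : TwoSidedIdeal R} (hP : IsPrimeIdeal P) : (1 : R) ∉ P :=
  one_notMem_of_ne_top hP.1

/-- The two-sided ideal of all `x` with `x R b ⊆ P`. -/
def annMod (P : TwoSidedIdeal R) (b : R) : TwoSidedIdeal R :=
  TwoSidedIdeal.mk' {x | ∀ r, x * r * b ∈ P} (by simp [P.zero_mem])
    (fun hx hy r => by rw [add_mul, add_mul]; exact P.add_mem (hx r) (hy r))
    (fun hx r => by rw [neg_mul, neg_mul]; exact P.neg_mem (hx r))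
    (fun hx r => by rw [mul_assoc, mul_assoc, ← mul_assoc _ r]; exact P.mul_mem_left _ _ (hx r))
    (fun {x y} hx r => by rw [mul_assoc x y r]; exact hx (y * r))

/-- This is the elementwise form of primeness. The elements x with xRb ⊆ P form a two-sided ideal
(`annMod`), which therefore contains (a); an induction over (b) then gives (a)(b) ⊆ P. -/
theorem IsPrimeIdeal.mem_or_mem {P : TwoSidedIdeal R} (hP : IsPrimeIdeal P) {a b : R}
    (h : ∀ r, a * r * b ∈ P) : a ∈ P ∨ b ∈ P := by
  have h1 : ∀ x ∈ TwoSidedIdeal.span {a}, ∀ r, x * r * b ∈ P := by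
    have : TwoSidedIdeal.span {a} ≤ annMod P b := TwoSidedIdeal.span_le.2 (by
      rintro _ rfl
      simpa [annMod] using h)
    intro x hx
    simpa [annMod] using this hx
  have h2 : ∀ x ∈ TwoSidedIdeal.span {a}, ∀ y ∈ TwoSidedIdeal.span {b}, x * y ∈ P := by
    intro x hx y hy
    induction hy using TwoSidedIdeal.span_induction generalizing x with
    | mem y hy => obtain rfl := hy; simpa using h1 x hx 1
    | zero => simp [P.zero_mem]
    | add y z _ _ hy hz => rw [mul_add]; exact P.add_mem (hy x hx) (hz x hx)
    | neg y _ hy => rw [mul_neg]; exact P.neg_mem (hy x hx)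
    | left_absorb r y _ hy =>
      rw [← mul_assoc]
      exact hy _ (TwoSidedIdeal.mul_mem_right _ _ _ hx)
    | right_absorb r y _ hy => rw [← mul_assoc]; exact P.mul_mem_right _ _ (hy x hx)
  rcases hP.2 _ _ h2 with h3 | h3
  · exact Or.inl (h3 (TwoSidedIdeal.subset_span rfl))
  · exact Or.inr (h3 (TwoSidedIdeal.subset_span rfl))

/-- An element `a` with `a R ⊆ R a + P` and `a ∉ P` is left regular modulo a prime `P`. -/
theorem IsPrimeIdeal.mem_of_normal_mul_mem {P : TwoSidedIdeal R} (hP : IsPrimeIdeal P) {a b : R}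
    (ha : a ∉ P) (hn : ∀ r, ∃ r', a * r - r' * a ∈ P) (h : a * b ∈ P) : b ∈ P := by
  refine (hP.mem_or_mem fun r => ?_).resolve_left ha
  obtain ⟨r', hr'⟩ := hn r
  have h2 : a * r * b = (a * r - r' * a) * b + r' * (a * b) := by noncomm_ring
  rw [h2]
  exact P.add_mem (P.mul_mem_right _ _ hr') (P.mul_mem_left _ _ h)

/-- Every prime of 𝒜 in the final list is recognized as a prime in this way, as the kernel of a map
to a domain. -/
theorem isPrimeIdeal_of_ker [IsDomain B] {P : TwoSidedIdeal R} (f : R →+* B)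
    (h : ∀ a, f a = 0 ↔ a ∈ P) : IsPrimeIdeal P := by
  constructor
  · rintro rfl
    have h1 := (h 1).2 trivial
    rw [map_one] at h1
    exact one_ne_zero h1
  · intro I J hIJ
    by_contra! hn
    obtain ⟨a, ha, haP⟩ := SetLike.not_le_iff_exists.1 hn.1
    refine hn.2 fun b hb => (h b).1 ?_
    have h1 := (h _).2 (hIJ a ha b hb)
    rw [map_mul] at h1
    exact (mul_eq_zero.1 h1).resolve_left fun h2 => haP ((h a).1 h2)

theorem spec_eq_singleton [IsDomain B] [IsSimpleRing B] : Spec B = {⊥} := by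
  ext P
  simp only [Spec, Set.mem_ofPred_eq, Set.mem_singleton_iff]
  constructor
  · intro h
    exact (eq_bot_or_eq_top P).resolve_right h.1
  · rintro rfl
    exact isPrimeIdeal_of_ker (RingHom.id B) fun a => by simp [TwoSidedIdeal.mem_bot]

theorem mem_spec_iff_of_comm {S : Type*} [CommRing S] (P : TwoSidedIdeal S) :
    P ∈ Spec S ↔ P.asIdeal.IsPrime := by
  constructor
  · intro h
    refine ⟨fun h1 => h.one_notMem (TwoSidedIdeal.mem_asIdeal.1 (h1 ▸ Submodule.mem_top)), ?_⟩
    intro a b hab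
    simp only [TwoSidedIdeal.mem_asIdeal] at hab ⊢
    refine h.mem_or_mem fun r => ?_
    rw [mul_right_comm]
    exact P.mul_mem_right _ _ hab
  · intro h
    have : IsDomain (Quo P) := Ideal.Quotient.isDomain P.asIdeal
    exact isPrimeIdeal_of_ker (Ideal.Quotient.mk P.asIdeal) fun a => by
      rw [← TwoSidedIdeal.mem_asIdeal]
      exact Ideal.Quotient.eq_zero_iff_mem

theorem isPrimeIdeal_comap_equiv {B' : Type*} [Ring B'] [Algebra k B'] (e : B ≃ₐ[k] B')
    {P : TwoSidedIdeal B'} (h : IsPrimeIdeal P) : IsPrimeIdeal (TwoSidedIdeal.comap e P) := by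
  constructor
  · intro h1
    refine h.one_notMem ?_
    have : (1 : B) ∈ TwoSidedIdeal.comap e P := h1 ▸ trivial
    simpa [TwoSidedIdeal.mem_comap] using this
  · intro I J hIJ
    have key : ∀ L : TwoSidedIdeal B, TwoSidedIdeal.comap e.symm L ≤ P →
        L ≤ TwoSidedIdeal.comap e P := by
      intro L hL x hx
      rw [TwoSidedIdeal.mem_comap]
      exact hL (by rw [TwoSidedIdeal.mem_comap, AlgEquiv.symm_apply_apply]; exact hx)
    refine (h.2 (TwoSidedIdeal.comap e.symm I) (TwoSidedIdeal.comap e.symm J) ?_).imp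
      (key I) (key J)
    intro a ha b hb
    rw [TwoSidedIdeal.mem_comap] at ha hb
    have := hIJ _ ha _ hb
    rw [TwoSidedIdeal.mem_comap, map_mul] at this
    simpa using this

theorem contr_subset_of_equiv {B' : Type*} [Ring B'] [Algebra k B'] {f : R →ₐ[k] B}
    {g : R →ₐ[k] B'} (e : B ≃ₐ[k] B') (h : ∀ a, e (f a) = g a) : contr g ⊆ contr f := by
  rintro _ ⟨Q, hQ, rfl⟩
  refine ⟨TwoSidedIdeal.comap e Q, isPrimeIdeal_comap_equiv e hQ, ?_⟩
  ext a
  simp [TwoSidedIdeal.mem_comap, h]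

theorem contr_eq_of_equiv {B' : Type*} [Ring B'] [Algebra k B'] {f : R →ₐ[k] B}
    {g : R →ₐ[k] B'} (e : B ≃ₐ[k] B') (h : ∀ a, e (f a) = g a) : contr f = contr g :=
  (contr_subset_of_equiv e.symm fun a => by rw [← h, AlgEquiv.symm_apply_apply]).antisymm
    (contr_subset_of_equiv e h)

theorem contr_eq_singleton [IsDomain B] [IsSimpleRing B] (f : R →ₐ[k] B) (I : TwoSidedIdeal R)
    (h : ∀ a, f a = 0 ↔ a ∈ I) : contr f = {I} := by
  rw [contr, spec_eq_singleton, Set.image_singleton]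
  congr 1
  ext a
  rw [TwoSidedIdeal.mem_comap, TwoSidedIdeal.mem_bot, h]

/-! Localization -/

/-- The homomorphism `f` inverts `S`, and every element of the target is a left fraction with
denominator in `S`. -/
def Clears (f : R →ₐ[k] B) (S : Submonoid R) : Prop :=
  (∀ s ∈ S, IsUnit (f s)) ∧ ∀ t : B, ∃ s ∈ S, ∃ a, f s * t = f a

theorem Clears.mono {f : R →ₐ[k] B} {S S' : Submonoid R} (h : Clears f S) (hS : S ≤ S')
    (hu : ∀ s ∈ S', IsUnit (f s)) : Clears f S' :=
  ⟨hu, fun t => let ⟨s, hs, a, ha⟩ := h.2 t; ⟨s, hS hs, a, ha⟩⟩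

theorem clears_of_surjective {f : R →ₐ[k] B} (hf : Function.Surjective f) (S : Submonoid R)
    (hu : ∀ s ∈ S, IsUnit (f s)) : Clears f S :=
  ⟨hu, fun t => ⟨1, S.one_mem, by
    obtain ⟨a, rfl⟩ := hf t
    exact ⟨a, by rw [map_one, one_mul]⟩⟩⟩

theorem Clears.of_equiv {B' : Type*} [Ring B'] [Algebra k B'] {f : R →ₐ[k] B} {g : R →ₐ[k] B'}
    {S : Submonoid R} (hg : Clears g S) (e : B ≃ₐ[k] B') (h : ∀ a, e (f a) = g a) :
    Clears f S := by
  constructor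
  · intro s hs
    have := (hg.1 s hs).map e.symm
    rwa [← h, AlgEquiv.symm_apply_apply] at this
  · intro t
    obtain ⟨s, hs, a, ha⟩ := hg.2 (e t)
    exact ⟨s, hs, a, e.injective (by rw [map_mul, h, h, ha])⟩

theorem Clears.quoLift {I : TwoSidedIdeal R} {f : R →ₐ[k] B} {S : Submonoid R}
    {T : Submonoid (Quo I)} (hf : Clears f S) (h : ∀ a ∈ I, f a = 0)
    (hT : T = S.map (quo k I)) : Clears (quoLift I f h) T := by
  subst hT
  constructor
  · rintro _ ⟨s, hs, rfl⟩
    exact hf.1 s hs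
  · intro t
    obtain ⟨s, hs, a, ha⟩ := hf.2 t
    exact ⟨_, ⟨s, hs, rfl⟩, quo k I a, ha⟩

/-- An ideal of the target is determined by its contraction: t lies in it exactly when the numerator
f(s)t does, because f(s) is a unit. -/
theorem Clears.injective_comap {f : R →ₐ[k] B} {S : Submonoid R} (h : Clears f S) :
    Function.Injective (TwoSidedIdeal.comap f) := by
  have key : ∀ P Q : TwoSidedIdeal B, TwoSidedIdeal.comap f P = TwoSidedIdeal.comap f Q →
      P ≤ Q := by
    intro P Q hPQ t ht
    obtain ⟨s, hs, a, ha⟩ := h.2 t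
    have h1 : a ∈ TwoSidedIdeal.comap f P := by
      rw [TwoSidedIdeal.mem_comap, ← ha]
      exact P.mul_mem_left _ _ ht
    rw [hPQ, TwoSidedIdeal.mem_comap, ← ha] at h1
    obtain ⟨u, hu⟩ := h.1 s hs
    have := Q.mul_mem_left (↑u⁻¹) _ h1
    rwa [← hu, Units.inv_mul_cancel_left] at this
  exact fun P Q hPQ => le_antisymm (key P Q hPQ) (key Q P hPQ.symm)

section Loc

variable (S : Submonoid R) [OreSet S]

theorem loc_isUnit {s : R} (hs : s ∈ S) : IsUnit (loc k S s) :=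
  OreLocalization.numerator_isUnit (⟨s, hs⟩ : S)

theorem loc_surj (x : OreLocalization S R) : ∃ s ∈ S, ∃ a, loc k S s * x = loc k S a := by
  induction x with
  | _ r s =>
    refine ⟨s, s.2, r, ?_⟩
    change (s : R) /ₒ (1 : S) * (r /ₒ s) = r /ₒ (1 : S)
    exact OreLocalization.mul_cancel

theorem clears_loc : Clears (loc k S) S := ⟨fun _ hs => loc_isUnit S hs, loc_surj S⟩

theorem loc_eq_zero_iff {a : R} : loc k S a = 0 ↔ ∃ s ∈ S, s * a = 0 := by
  constructor
  · intro h
    have h1 : a /ₒ (1 : S) = (0 : R) /ₒ (1 : S) := by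
      rw [← OreLocalization.zero_def]
      exact h
    rw [OreLocalization.oreDiv_eq_iff] at h1
    obtain ⟨u, v, h2, h3⟩ := h1
    have h4 : v = (u : R) := by simpa using h3.symm
    refine ⟨u, u.2, ?_⟩
    rw [smul_zero, h4] at h2
    exact h2.symm
  · rintro ⟨s, hs, h⟩
    have h1 := congrArg (loc k S) h
    rw [map_mul, map_zero] at h1
    exact ((loc_isUnit (k := k) S hs).mul_right_eq_zero).1 h1

/-- The extension of a homomorphism inverting `S` to the localization. -/
theorem exists_locLift (f : R →ₐ[k] B) (hf : ∀ s ∈ S, IsUnit (f s)) :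
    ∃ g : OreLocalization S R →ₐ[k] B, ∀ a, g (loc k S a) = f a := by
  let fS : S →* Bˣ := IsUnit.liftRight ((f : R →* B).comp S.subtype) fun s => hf s s.2
  have h : ∀ a, OreLocalization.universalHom (f : R →+* B) fS (fun s => rfl) (loc k S a) = f a :=
    fun a => OreLocalization.universalHom_commutes (f : R →+* B) fS _
  exact ⟨{ OreLocalization.universalHom (f : R →+* B) fS (fun s => rfl) with
    commutes' := fun c => by
      have := h (algebraMap k R c)
      rw [AlgHom.commutes, AlgHom.commutes] at this
      exact this }, h⟩

theorem surjective_of_clears {f : R →ₐ[k] B} (hf : Clears f S)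
    {g : OreLocalization S R →ₐ[k] B} (hg : ∀ a, g (loc k S a) = f a) :
    Function.Surjective g := by
  intro t
  obtain ⟨s, hs, a, ha⟩ := hf.2 t
  obtain ⟨u, hu⟩ := loc_isUnit (k := k) S hs
  refine ⟨↑u⁻¹ * loc k S a, (hf.1 s hs).mul_left_cancel ?_⟩
  rw [ha, ← hg s, ← hu, ← map_mul, Units.mul_inv_cancel_left, hg]

/-- The kernel is only required to be S-torsion. This generality is needed for (𝒜/(X, Z))_Y, where
the localization map is not injective: it kills E. -/
theorem exists_loc_equiv {f : R →ₐ[k] B} (hf : Clears f S)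
    (h : ∀ a, f a = 0 → ∃ s ∈ S, s * a = 0) :
    ∃ e : OreLocalization S R ≃ₐ[k] B, ∀ a, e (loc k S a) = f a := by
  obtain ⟨g, hg⟩ := exists_locLift S f hf.1
  refine ⟨AlgEquiv.ofBijective g ⟨?_, surjective_of_clears S hf hg⟩, hg⟩
  rw [injective_iff_map_eq_zero]
  intro x hx
  obtain ⟨s, hs, a, ha⟩ := loc_surj (k := k) S x
  have h1 := congrArg g ha
  rw [map_mul, hx, mul_zero, hg] at h1
  have h2 := (loc_eq_zero_iff (k := k) S).2 (h a h1.symm)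
  rw [h2] at ha
  exact ((loc_isUnit (k := k) S hs).mul_right_eq_zero).1 ha

theorem exists_quo_loc_equiv {f : R →ₐ[k] B} (hf : Clears f S) (I : TwoSidedIdeal R)
    (h : ∀ a, f a = 0 ↔ a ∈ I) :
    ∃ e : Quo (TwoSidedIdeal.map (loc k S) I) ≃ₐ[k] B,
      ∀ a, e (quo k _ (loc k S a)) = f a := by
  obtain ⟨g, hg⟩ := exists_locLift S f hf.1
  obtain ⟨e, he⟩ := exists_quo_equiv (TwoSidedIdeal.map (loc k S) I) g
    (surjective_of_clears S hf hg) (by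
      intro x
      constructor
      · intro hx
        obtain ⟨s, hs, a, ha⟩ := loc_surj (k := k) S x
        have h1 := congrArg g ha
        rw [map_mul, hx, mul_zero, hg] at h1
        have h2 : loc k S a ∈ TwoSidedIdeal.map (loc k S) I :=
          TwoSidedIdeal.subset_span ⟨a, (h a).1 h1.symm, rfl⟩
        obtain ⟨u, hu⟩ := loc_isUnit (k := k) S hs
        have := TwoSidedIdeal.mul_mem_left _ (↑u⁻¹) _ h2
        rwa [← ha, ← hu, Units.inv_mul_cancel_left] at this
      · refine map_eq_zero_of_mem_span g ?_
        rintro _ ⟨a, ha, rfl⟩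
        rw [hg]
        exact (h a).2 ha)
  exact ⟨e, fun a => by rw [he, hg]⟩

end Loc

/-- The extension of a two-sided ideal along a homomorphism that becomes surjective after
inverting one element on either side. -/
theorem exists_extension (g : R →ₐ[k] B) (w : R)
    (hl : ∀ t, ∃ n : ℕ, ∃ a, g w ^ n * t = g a) (hr : ∀ t, ∃ n : ℕ, ∃ a, t * g w ^ n = g a)
    (hw : IsUnit (g w)) (P : TwoSidedIdeal R) :
    ∃ J : TwoSidedIdeal B, ∀ t, t ∈ J ↔ ∃ n m : ℕ, ∃ a ∈ P, g w ^ n * t * g w ^ m = g a := by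
  obtain ⟨u, hu⟩ := hw
  refine ⟨TwoSidedIdeal.mk' {t | ∃ n m : ℕ, ∃ a ∈ P, g w ^ n * t * g w ^ m = g a}
    ⟨0, 0, 0, P.zero_mem, by simp⟩ ?_ ?_ ?_ ?_,
    fun t => TwoSidedIdeal.mem_mk' _ _ _ _ _ _ _⟩
  · rintro x y ⟨n, m, a, ha, h⟩ ⟨n', m', a', ha', h'⟩
    refine ⟨n' + n, m + m', w ^ n' * a * w ^ m' + w ^ n * a' * w ^ m,
      P.add_mem (P.mul_mem_right _ _ (P.mul_mem_left _ _ ha))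
        (P.mul_mem_right _ _ (P.mul_mem_left _ _ ha')), ?_⟩
    rw [map_add, map_mul, map_mul, map_mul, map_mul, ← h, ← h', mul_add, add_mul]
    simp only [map_pow]
    congr 1
    · rw [pow_add, pow_add]
      simp only [mul_assoc]
    · rw [add_comm n', add_comm m, pow_add, pow_add]
      simp only [mul_assoc]
  · rintro x ⟨n, m, a, ha, h⟩
    exact ⟨n, m, -a, P.neg_mem ha, by rw [map_neg, ← h, mul_neg, neg_mul]⟩
  · rintro x y ⟨n, m, a, ha, h⟩
    -- Write w for the inverted image. Since xy = (xw⁻ⁿ)(wⁿy), the denominator to clear is that of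
    -- xw⁻ⁿ, not that of x.
    obtain ⟨p, b, hb⟩ := hl (x * ↑(u⁻¹ ^ n))
    refine ⟨p, m, b * a, P.mul_mem_left _ _ ha, ?_⟩
    rw [map_mul, ← hb, ← h, ← hu, Units.val_pow_eq_pow_val]
    have : (↑u⁻¹ : B) ^ n * (u : B) ^ n = 1 := by
      rw [← Units.val_pow_eq_pow_val, ← Units.val_pow_eq_pow_val, ← Units.val_mul, inv_pow,
        inv_mul_cancel, Units.val_one]
    calc _ = (u : B) ^ p * x * 1 * y * (u : B) ^ m := by
          rw [mul_one]
          simp only [mul_assoc]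
      _ = _ := by rw [← this]; simp only [mul_assoc]
  · rintro x y ⟨n, m, a, ha, h⟩
    obtain ⟨p, b, hb⟩ := hr (↑(u⁻¹ ^ m) * y)
    refine ⟨n, p, a * b, P.mul_mem_right _ _ ha, ?_⟩
    rw [map_mul, ← hb, ← h, ← hu, Units.val_pow_eq_pow_val]
    have : (u : B) ^ m * (↑u⁻¹ : B) ^ m = 1 := by
      rw [← Units.val_pow_eq_pow_val, ← Units.val_pow_eq_pow_val, ← Units.val_mul, inv_pow,
        mul_inv_cancel, Units.val_one]
    calc _ = (u : B) ^ n * x * 1 * y * (u : B) ^ p := by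
          rw [mul_one]
          simp only [mul_assoc]
      _ = _ := by rw [← this]; simp only [mul_assoc]

end General

/-! Linear algebra -/

/-- Linear independence is supplied by the target, so on the source a spanning family suffices. This
replaces a PBW theorem in the computation of kernels. -/
theorem linearMap_injective_of_span {K V W ι κ : Type*} [Field K] [AddCommGroup V] [Module K V]
    [AddCommGroup W] [Module K W] (f : V →ₗ[K] W) (v : ι → V)
    (hv : Submodule.span K (Set.range v) = ⊤) (b : Module.Basis κ K W) (σ : ι → κ)
    (hσ : Function.Injective σ) (h : ∀ i, ∃ u : K, u ≠ 0 ∧ f (v i) = u • b (σ i)) :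
    Function.Injective f := by
  choose u hu hf using h
  have hli : LinearIndependent K (fun i => f (v i)) := by
    have h1 := (b.linearIndependent.comp σ hσ).units_smul (fun i => Units.mk0 (u i) (hu i))
    convert h1 using 1
    ext i
    rw [hf]
    rfl
  rw [← LinearMap.ker_eq_bot, LinearMap.ker_eq_bot']
  intro x hx
  have hx1 : x ∈ Submodule.span K (Set.range v) := hv ▸ Submodule.mem_top
  obtain ⟨c, rfl⟩ := (Finsupp.mem_span_range_iff_exists_finsupp).1 hx1
  rw [map_finsuppSum] at hx
  simp only [map_smul] at hx
  have hc : c = 0 := (linearIndependent_iff.1 hli) c hx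
  simp [hc]

/-- Injectivity from a triangular system of values. -/
theorem linearMap_injective_of_triangular {K V W ι : Type*} [Field K] [AddCommGroup V]
    [Module K V] [AddCommGroup W] [Module K W] (f : V →ₗ[K] W) (v : ι → V)
    (hv : Submodule.span K (Set.range v) = ⊤) (l : ι → W →ₗ[K] K) (d : ι → ℕ)
    (h0 : ∀ i, l i (f (v i)) ≠ 0) (h : ∀ i j, d j ≤ d i → j ≠ i → l i (f (v j)) = 0) :
    Function.Injective f := by
  rw [← LinearMap.ker_eq_bot, LinearMap.ker_eq_bot']
  intro x hx
  have hx1 : x ∈ Submodule.span K (Set.range v) := hv ▸ Submodule.mem_top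
  obtain ⟨c, rfl⟩ := (Finsupp.mem_span_range_iff_exists_finsupp).1 hx1
  rw [map_finsuppSum] at hx
  by_cases hc : c.support.Nonempty
  · obtain ⟨i, hi, hmax⟩ := c.support.exists_max_image d hc
    have h1 := congrArg (l i) hx
    rw [map_zero, map_finsuppSum, Finsupp.sum, Finset.sum_eq_single i] at h1
    · rw [map_smul, map_smul, smul_eq_mul, mul_eq_zero] at h1
      exact absurd h1 (not_or.2 ⟨Finsupp.mem_support_iff.1 hi, h0 i⟩)
    · intro j hj hji
      rw [map_smul, map_smul, h i j (hmax j hj) hji, smul_zero]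
    · exact fun h2 => absurd hi h2
  · rw [Finset.not_nonempty_iff_eq_empty, Finsupp.support_eq_empty] at hc
    simp [hc]

/-- A subspace containing `1` and stable under left multiplication by generators is everything. -/
theorem submodule_eq_top_of_mul_mem {K R : Type*} [Field K] [Ring R] [Algebra K R] (s : Set R)
    (hs : Algebra.adjoin K s = ⊤) (V : Submodule K R) (h1 : (1 : R) ∈ V)
    (h : ∀ g ∈ s, ∀ x ∈ V, g * x ∈ V) : V = ⊤ := by
  have key : ∀ r ∈ Algebra.adjoin K s, ∀ x ∈ V, r * x ∈ V := by
    intro r hr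
    induction hr using Algebra.adjoin_induction with
    | mem g hg => exact h g hg
    | algebraMap c => intro x hx; rw [← Algebra.smul_def]; exact V.smul_mem _ hx
    | add a b _ _ ha hb => intro x hx; rw [add_mul]; exact V.add_mem (ha x hx) (hb x hx)
    | mul a b _ _ ha hb => intro x hx; rw [mul_assoc]; exact ha _ (hb x hx)
  rw [eq_top_iff]
  intro r _
  have := key r (hs ▸ Algebra.mem_top) 1 h1
  rwa [mul_one] at this

end

end QAge

namespace QAge

noncomputable section

open scoped TensorProduct

/-! Bases of skew Laurent polynomial algebras -/

theorem zpow_apply_of_apply_eq_smul {k D : Type*} [Field k] [Ring D] [Algebra k D]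
    (σ : D ≃ₐ[k] D) (c : kˣ) {x : D} (h : σ x = (c : k) • x) (n : ℤ) :
    (σ ^ n) x = ((c ^ n : kˣ) : k) • x := by
  have hinv : σ⁻¹ x = ((c⁻¹ : kˣ) : k) • x := by
    apply σ.injective
    rw [map_smul, h, smul_smul, ← Units.val_mul, inv_mul_cancel, Units.val_one, one_smul]
    exact AlgEquiv.apply_symm_apply σ x
  induction n with
  | zero => simp
  | succ n ih =>
    rw [zpow_add_one, zpow_add_one, AlgEquiv.mul_apply, h, map_smul, ih, smul_smul, mul_comm,
      ← Units.val_mul]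
  | pred n ih =>
    rw [zpow_sub_one, zpow_sub_one, AlgEquiv.mul_apply, hinv, map_smul, ih, smul_smul, mul_comm,
      ← Units.val_mul]

namespace SkewLaurent

variable {k : Type*} [Field k] {D : Type*} [Ring D] [Algebra k D] (σ : D ≃ₐ[k] D)

/-- The integer powers of `t`. -/
def tz (n : ℤ) : SkewLaurent σ :=
  (SkewMonoidAlgebra.single (Multiplicative.ofAdd n) 1 : SkewMonoidAlgebra D (Multiplicative ℤ))

theorem coef_mul_tz (a : D) (n : ℤ) : coef σ a * tz σ n =
    (SkewMonoidAlgebra.single (Multiplicative.ofAdd n) a :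
      SkewMonoidAlgebra D (Multiplicative ℤ)) := by
  let := powAction σ
  refine (SkewMonoidAlgebra.single_mul_single (a₁ := (1 : Multiplicative ℤ)) (b₁ := a)
    (a₂ := Multiplicative.ofAdd n) (b₂ := (1 : D))).trans ?_
  rw [smul_one, mul_one, one_mul]

theorem tz_mul_coef (a : D) (n : ℤ) : tz σ n * coef σ a = coef σ ((σ ^ n) a) * tz σ n := by
  let := powAction σ
  rw [coef_mul_tz]
  refine (SkewMonoidAlgebra.single_mul_single (a₁ := Multiplicative.ofAdd n) (b₁ := (1 : D))
    (a₂ := (1 : Multiplicative ℤ)) (b₂ := a)).trans ?_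
  rw [mul_one, one_mul]
  rfl

theorem tz_mul_tz (m n : ℤ) : tz σ m * tz σ n = tz σ (m + n) := by
  let := powAction σ
  refine (SkewMonoidAlgebra.single_mul_single (a₁ := Multiplicative.ofAdd m) (b₁ := (1 : D))
    (a₂ := Multiplicative.ofAdd n) (b₂ := (1 : D))).trans ?_
  rw [smul_one, mul_one]
  rfl

theorem tz_zero : tz σ 0 = 1 := rfl

theorem tz_one : tz σ 1 = t σ := rfl

/-- The basis `dᵢ tⁿ` of `D[t, t⁻¹; σ]` for a basis `dᵢ` of `D`. -/
def basis {ι : Type*} (d : Module.Basis ι k D) : Module.Basis (ι × ℤ) k (SkewLaurent σ) :=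
  ((Finsupp.basis fun _ : Multiplicative ℤ => d).reindex
    { toFun := fun x => (x.2, x.1.toAdd)
      invFun := fun x => ⟨Multiplicative.ofAdd x.2, x.1⟩
      left_inv := fun _ => rfl
      right_inv := fun _ => rfl }).map
    (letI := powAction σ
     { toFun := fun x => (⟨x⟩ : SkewMonoidAlgebra D (Multiplicative ℤ))
       invFun := fun x => SkewMonoidAlgebra.coeff x
       left_inv := fun _ => rfl
       right_inv := fun _ => rfl
       map_add' := fun _ _ => SkewMonoidAlgebra.ofCoeff_add
       map_smul' := fun c x => SkewMonoidAlgebra.ofCoeff_smul c x } :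
      (Multiplicative ℤ →₀ D) ≃ₗ[k] SkewLaurent σ)

theorem basis_apply {ι : Type*} (d : Module.Basis ι k D) (i : ι × ℤ) :
    basis σ d i = coef σ (d i.1) * tz σ i.2 := by
  rw [coef_mul_tz, basis, Module.Basis.map_apply, Module.Basis.reindex_apply, Finsupp.coe_basis]
  rfl

end SkewLaurent

end

end QAge

namespace QAge

noncomputable section

open scoped TensorProduct

/-! Twisted group algebras -/

/-- The `y l` are simultaneous eigenvectors for conjugation by units. Conjugating the sum by u and
subtracting χ(j) times the sum removes the j-th term and multiplies the i-th by χ(i) - χ(j) ≠ 0;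
repeat until only the i-th term is left. -/
theorem mem_of_sum_smul_mem {k S ι : Type*} [Field k] [Ring S] [Algebra k S]
    (I : TwoSidedIdeal S) (y : ι → S)
    (hsep : ∀ i j, i ≠ j → ∃ u : S, IsUnit u ∧ ∃ χ : ι → k,
      (∀ l, u * y l = χ l • (y l * u)) ∧ χ i ≠ χ j)
    (s : Finset ι) (c : ι → k) (h : ∑ l ∈ s, c l • y l ∈ I) {i : ι} (hi : i ∈ s) :
    c i • y i ∈ I := by
  classical
  induction hn : s.card generalizing s c with
  | zero => simp_all
  | succ n ih =>
    by_cases hs : ∃ j ∈ s, j ≠ i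
    · obtain ⟨j, hj, hji⟩ := hs
      obtain ⟨u, ⟨v, hv⟩, χ, hχ, hij⟩ := hsep i j hji.symm
      have h1 : ∑ l ∈ s, (χ l * c l) • y l ∈ I := by
        have h2 := I.mul_mem_right _ (↑v⁻¹) (I.mul_mem_left u _ h)
        convert h2 using 1
        rw [Finset.mul_sum, Finset.sum_mul]
        refine Finset.sum_congr rfl fun l _ => ?_
        rw [mul_smul_comm, hχ, ← hv, smul_mul_assoc, smul_mul_assoc, Units.mul_inv_cancel_right,
          smul_smul, mul_comm]
      have h3 : χ j • ∑ l ∈ s, c l • y l ∈ I := by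
        rw [Algebra.smul_def]
        exact I.mul_mem_left _ _ h
      have h4 := I.sub_mem h1 h3
      rw [Finset.smul_sum, ← Finset.sum_sub_distrib] at h4
      have h5 : ∑ l ∈ s.erase j, ((χ l - χ j) * c l) • y l ∈ I := by
        convert h4 using 1
        rw [← Finset.add_sum_erase s _ hj, smul_smul, sub_self, zero_add]
        refine Finset.sum_congr rfl fun l _ => ?_
        rw [smul_smul, ← sub_smul, sub_mul]
      have h6 := ih (s.erase j) _ h5 (Finset.mem_erase.2 ⟨hji.symm, hi⟩)
        (by rw [Finset.card_erase_of_mem hj, hn]; rfl)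
      have h7 := I.mul_mem_left (algebraMap k S (χ i - χ j)⁻¹) _ h6
      rwa [← Algebra.smul_def, smul_smul, ← mul_assoc, inv_mul_cancel₀ (sub_ne_zero.2 hij),
        one_mul] at h7
    · push Not at hs
      have : s = {i} := Finset.eq_singleton_iff_unique_mem.2 ⟨hi, hs⟩
      rwa [this, Finset.sum_singleton] at h

/-- The basis `b` of the `A`-algebra `S` is multiplicative up to the scalars `ω`. -/
structure IsTwisted {k A S G : Type*} [Field k] [CommRing A] [Ring S] [Algebra A S] [Algebra k S]
    [AddCommGroup G] (b : Module.Basis G A S) (ω : G → G → k) : Prop where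
  ne_zero : ∀ i j, ω i j ≠ 0
  one : b 0 = 1
  mul : ∀ i j, b i * b j = ω i j • b (i + j)

namespace IsTwisted

variable {k A S G : Type*} [Field k] [CommRing A] [Ring S] [Algebra A S] [Algebra k S]
  [AddCommGroup G] {b : Module.Basis G A S} {ω : G → G → k}

theorem isUnit (h : IsTwisted b ω) (i : G) : IsUnit (b i) := by
  have h1 : b i * ((ω i (-i))⁻¹ • b (-i)) = 1 := by
    rw [mul_smul_comm, h.mul, smul_smul, inv_mul_cancel₀ (h.ne_zero _ _), one_smul,
      add_neg_cancel, h.one]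
  have h2 : ((ω (-i) i)⁻¹ • b (-i)) * b i = 1 := by
    rw [smul_mul_assoc, h.mul, smul_smul, inv_mul_cancel₀ (h.ne_zero _ _), one_smul,
      neg_add_cancel, h.one]
  exact isUnit_iff_exists_and_exists.2 ⟨⟨_, h1⟩, ⟨_, h2⟩⟩

variable [Algebra k A] [IsScalarTower k A S]

/-- By `UniqueSums` some sum i + j of indices in the two supports is attained only once. The
coefficient of the product there is ω i j times a product of nonzero coefficients. -/
theorem isDomain (h : IsTwisted b ω) [IsDomain A] [UniqueSums G] : IsDomain S := by
  have hnt : Nontrivial S := b.repr.toEquiv.nontrivial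
  have : NoZeroDivisors S := by
    constructor
    intro x y hxy
    by_contra! hne
    have hx : (b.repr x).support.Nonempty := by
      rw [Finsupp.support_nonempty_iff]
      simpa using hne.1
    have hy : (b.repr y).support.Nonempty := by
      rw [Finsupp.support_nonempty_iff]
      simpa using hne.2
    obtain ⟨i, hi, j, hj, hu⟩ := UniqueSums.uniqueAdd_of_nonempty hx hy
    have h1 : x * y = ∑ i' ∈ (b.repr x).support, ∑ j' ∈ (b.repr y).support,
        (ω i' j' • (b.repr x i' * b.repr y j')) • b (i' + j') := by
      conv_lhs => rw [← b.linearCombination_repr x, ← b.linearCombination_repr y]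
      rw [Finsupp.linearCombination_apply, Finsupp.linearCombination_apply, Finsupp.sum,
        Finsupp.sum, Finset.sum_mul_sum]
      refine Finset.sum_congr rfl fun i' _ => Finset.sum_congr rfl fun j' _ => ?_
      rw [smul_mul_smul_comm, h.mul, smul_assoc, smul_comm]
    have h2 : b.repr (x * y) (i + j) = ω i j • (b.repr x i * b.repr y j) := by
      rw [h1, map_sum, Finsupp.finsetSum_apply, Finset.sum_eq_single i, map_sum,
        Finsupp.finsetSum_apply, Finset.sum_eq_single j]
      · rw [map_smul, Finsupp.smul_apply, b.repr_self, Finsupp.single_eq_same, smul_eq_mul,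
          mul_one]
      · intro j' hj' hne
        rw [map_smul, Finsupp.smul_apply, b.repr_self, Finsupp.single_eq_of_ne, smul_zero]
        intro h3
        exact hne (add_left_cancel h3).symm
      · exact fun h3 => absurd hj h3
      · intro i' hi' hne
        rw [map_sum, Finsupp.finsetSum_apply]
        refine Finset.sum_eq_zero fun j' hj' => ?_
        rw [map_smul, Finsupp.smul_apply, b.repr_self, Finsupp.single_eq_of_ne, smul_zero]
        intro h3
        exact hne (hu hi' hj' h3.symm).1
      · exact fun h3 => absurd hi h3
    rw [hxy, map_zero, Finsupp.zero_apply] at h2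
    rcases smul_eq_zero.1 h2.symm with h3 | h3
    · exact h.ne_zero _ _ h3
    · exact mul_ne_zero (Finsupp.mem_support_iff.1 hi) (Finsupp.mem_support_iff.1 hj) h3
  exact NoZeroDivisors.to_isDomain S

/-- Conjugation by `b g` multiplies `b l` by ω(g, l)/ω(l, g). The hypothesis `hsep` says that these
scalars separate the indices, so each term of x lies in I, and its factor `b i` is a unit. -/
theorem coeff_mem (h : IsTwisted b ω)
    (hsep : ∀ i j, i ≠ j → ∃ g, ω g i * ω j g ≠ ω g j * ω i g)
    (I : TwoSidedIdeal S) {x : S} (hx : x ∈ I) (i : G) : algebraMap A S (b.repr x i) ∈ I := by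
  by_cases hi : i ∈ (b.repr x).support
  · have h1 : b.repr x i • b i ∈ I := by
      -- The eigenvectors are the whole terms, with scalar 1, since the coefficients lie in A and
      -- not in k.
      have h2 := mem_of_sum_smul_mem (k := k) I (fun l => b.repr x l • b l) (by
        intro i j hij
        obtain ⟨g, hg⟩ := hsep i j hij
        refine ⟨b g, h.isUnit g, fun l => ω g l * (ω l g)⁻¹, fun l => ?_, fun h3 => hg ?_⟩
        · rw [mul_smul_comm, smul_mul_assoc, h.mul, h.mul, add_comm l g,
            ← algebraMap_smul A (ω g l), ← algebraMap_smul A (ω l g),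
            ← algebraMap_smul A (ω g l * (ω l g)⁻¹), smul_comm _ (algebraMap k A _),
            smul_comm (b.repr x l) (algebraMap k A (ω l g)),
            smul_smul (algebraMap k A _) (algebraMap k A _), ← map_mul,
            inv_mul_cancel_right₀ (h.ne_zero _ _)]
        · have h4 := h.ne_zero i g
          have h5 := h.ne_zero j g
          field_simp at h3
          rw [h3, mul_comm])
        (b.repr x).support (fun _ => 1) (by
          simp only [one_smul]
          convert hx using 1
          exact b.linearCombination_repr x) hi
      rwa [one_smul] at h2
    obtain ⟨u, hu⟩ := h.isUnit i
    have h2 := I.mul_mem_right _ (↑u⁻¹) h1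
    rwa [← hu, smul_mul_assoc, Units.mul_inv, ← Algebra.algebraMap_eq_smul_one] at h2
  · rw [Finsupp.notMem_support_iff.1 hi, map_zero]
    exact I.zero_mem

theorem isSimpleRing (h : IsTwisted b ω) (hA : IsField A)
    (hsep : ∀ i j, i ≠ j → ∃ g, ω g i * ω j g ≠ ω g j * ω i g) : IsSimpleRing S := by
  have : Nontrivial A := hA.nontrivial
  have hnt : Nontrivial S := b.repr.toEquiv.nontrivial
  refine ⟨⟨fun I => ?_⟩⟩
  by_cases hI : I = ⊥
  · exact Or.inl hI
  · right
    have h1 : ∃ x ∈ I, x ≠ 0 := by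
      by_contra! h2
      exact hI (eq_bot_iff.2 fun x hx => (TwoSidedIdeal.mem_bot _).2 (h2 x hx))
    obtain ⟨x, hx, hx0⟩ := h1
    have h2 : ∃ i, b.repr x i ≠ 0 := by
      by_contra! h3
      exact hx0 (b.repr.map_eq_zero_iff.1 (Finsupp.ext h3))
    obtain ⟨i, hi⟩ := h2
    obtain ⟨c, hc⟩ := hA.mul_inv_cancel hi
    have h3 := I.mul_mem_right _ (algebraMap A S c) (h.coeff_mem hsep I hx i)
    rw [← map_mul, hc, map_one] at h3
    exact eq_top_of_one_mem h3

section Tensor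

open scoped TensorProduct

variable {k A S S' G G' : Type*} [Field k] [CommRing A] [Ring S] [Algebra k S] [Algebra k A]
  [Ring S'] [Algebra k S'] [AddCommGroup G] [AddCommGroup G'] {b : Module.Basis G k S}
  {b' : Module.Basis G' k S'} {ω : G → G → k} {ω' : G' → G' → k}

theorem baseChange (h : IsTwisted b ω) : IsTwisted (b.baseChange A) ω where
  ne_zero := h.ne_zero
  one := by
    rw [Module.Basis.baseChange_apply, h.one]
    rfl
  mul i j := by
    rw [Module.Basis.baseChange_apply, Module.Basis.baseChange_apply,
      Module.Basis.baseChange_apply, Algebra.TensorProduct.tmul_mul_tmul, h.mul,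
      one_mul, TensorProduct.tmul_smul]

theorem tensorProduct (h' : IsTwisted b' ω') (h : IsTwisted b ω) :
    IsTwisted (b'.tensorProduct b) (fun i j => ω' i.1 j.1 * ω i.2 j.2) where
  ne_zero _ _ := mul_ne_zero (h'.ne_zero _ _) (h.ne_zero _ _)
  one := by
    rw [Module.Basis.tensorProduct_apply']
    exact congrArg₂ _ h'.one h.one
  mul i j := by
    rw [Module.Basis.tensorProduct_apply', Module.Basis.tensorProduct_apply',
      Module.Basis.tensorProduct_apply', Algebra.TensorProduct.tmul_mul_tmul,
      h.mul, h'.mul, TensorProduct.smul_tmul_smul]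
    rfl

end Tensor

end IsTwisted

/-! The algebra `𝕐` and its scalar extensions -/

section YY

variable {k : Type*} [Field k] (q : kˣ)

/-- The integer powers of a unit of `k`, as elements of `k`. -/
def qpow (n : ℤ) : k := ((q ^ n : kˣ) : k)

theorem qpow_zero : qpow q 0 = 1 := by simp [qpow]

theorem qpow_add (m n : ℤ) : qpow q (m + n) = qpow q m * qpow q n := by simp [qpow, zpow_add]

theorem qpow_ne_zero (n : ℤ) : qpow q n ≠ 0 := Units.ne_zero _

theorem qpow_injective {q : kˣ} (hq : ∀ n : ℕ, 0 < n → q ^ n ≠ 1) :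
    Function.Injective (qpow q) := by
  have key : ∀ m n : ℤ, m < n → qpow q m ≠ qpow q n := by
    intro m n hmn h
    have h1 : q ^ m = q ^ n := Units.ext h
    obtain ⟨d, hd⟩ := Int.le.dest hmn.le
    refine hq d (by omega) ?_
    rw [← hd, zpow_add, zpow_natCast] at h1
    exact (mul_eq_left.1 h1.symm)
  intro m n h
  by_contra hne
  rcases lt_or_gt_of_ne hne with h1 | h1
  · exact key m n h1 h
  · exact key n m h1 h.symm

/-- The basis `Yᵇ Kᶜ` of `𝕐`. -/
def yyBasis : Module.Basis (ℤ × ℤ) k (YY q) :=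
  SkewLaurent.basis _ (AddMonoidAlgebra.basis ℤ k)

theorem yyBasis_apply (i : ℤ × ℤ) : yyBasis q i =
    SkewLaurent.coef (laurentScale q⁻¹) (LaurentPolynomial.T i.1) * SkewLaurent.tz _ i.2 := by
  rw [yyBasis, SkewLaurent.basis_apply]
  rfl

/-- The twist of the basis of `𝕐`. -/
def yyTwist (i j : ℤ × ℤ) : k := qpow q (-(i.2 * j.1))

theorem yy_isTwisted : IsTwisted (yyBasis q) (yyTwist q) where
  ne_zero _ _ := qpow_ne_zero _ _
  one := by
    rw [yyBasis_apply]
    simp [SkewLaurent.tz_zero]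
  mul i j := by
    have h := SkewLaurent.tz_mul_coef (laurentScale q⁻¹) (LaurentPolynomial.T j.1) i.2
    rw [zpow_apply_of_apply_eq_smul (laurentScale q⁻¹) (q⁻¹ ^ j.1)
      (laurentScaleHom_T q⁻¹ j.1)] at h
    rw [yyBasis_apply, yyBasis_apply, yyBasis_apply, mul_assoc,
      ← mul_assoc (SkewLaurent.tz _ i.2), h, map_smul, smul_mul_assoc,
      smul_mul_assoc, mul_smul_comm, mul_assoc (SkewLaurent.coef _ (LaurentPolynomial.T j.1)),
      SkewLaurent.tz_mul_tz, ← mul_assoc, ← map_mul, ← LaurentPolynomial.T_add]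
    congr 1
    rw [yyTwist, qpow, ← zpow_mul, inv_zpow', mul_comm]

/-- Two monomials of 𝕐 commute up to q raised to the standard symplectic form of their exponents.
Testing against Y and against K recovers both exponents, since q has infinite order. -/
theorem yy_sep {q : kˣ} (hq : ∀ n : ℕ, 0 < n → q ^ n ≠ 1) (i j : ℤ × ℤ) (hij : i ≠ j) :
    ∃ g, yyTwist q g i * yyTwist q j g ≠ yyTwist q g j * yyTwist q i g := by
  by_contra! h
  have h1 := h (1, 0)
  have h2 := h (0, 1)
  simp only [yyTwist, ← qpow_add] at h1 h2
  have h3 := qpow_injective hq h1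
  have h4 := qpow_injective hq h2
  apply hij
  ext <;> simp at h3 h4 <;> omega

theorem yyY_eq : yyY q = yyBasis q (1, 0) := by
  rw [yyBasis_apply, SkewLaurent.tz_zero, mul_one]; rfl

theorem yyK_eq : yyK q = yyBasis q (0, 1) := by
  rw [yyBasis_apply, LaurentPolynomial.T_zero, map_one, one_mul]; rfl

variable (A : Type*) [CommRing A] [Algebra k A]

theorem tensor_isTwisted : IsTwisted ((yyBasis q).baseChange A) (yyTwist q) :=
  (yy_isTwisted q).baseChange

theorem isDomain_tensor [IsDomain A] : IsDomain (A ⊗[k] YY q) := (tensor_isTwisted q A).isDomain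

instance isDomain_yy : IsDomain (YY q) := (yy_isTwisted q).isDomain

theorem isSimpleRing_yy {q : kˣ} (hq : ∀ n : ℕ, 0 < n → q ^ n ≠ 1) : IsSimpleRing (YY q) :=
  (yy_isTwisted q).isSimpleRing (Field.toIsField k) (yy_sep hq)

theorem isSimpleRing_tensor {q : kˣ} (hq : ∀ n : ℕ, 0 < n → q ^ n ≠ 1) (hA : IsField A) :
    IsSimpleRing (A ⊗[k] YY q) :=
  (tensor_isTwisted q A).isSimpleRing hA (yy_sep hq)

/-- The twist of the basis of a tensor product of two algebras `𝕐`. -/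
def yyTwist₂ (p : kˣ) (i j : (ℤ × ℤ) × (ℤ × ℤ)) : k := yyTwist p i.1 j.1 * yyTwist q i.2 j.2

theorem tensor₂_isTwisted (p : kˣ) :
    IsTwisted ((yyBasis p).tensorProduct (yyBasis q)) (yyTwist₂ q p) :=
  (yy_isTwisted p).tensorProduct (yy_isTwisted q)

instance isDomain_tensor₂ (p : kˣ) : IsDomain (YY p ⊗[k] YY q) :=
  (tensor₂_isTwisted q p).isDomain

theorem isSimpleRing_tensor₂ {q p : kˣ} (hq : ∀ n : ℕ, 0 < n → q ^ n ≠ 1)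
    (hp : ∀ n : ℕ, 0 < n → p ^ n ≠ 1) : IsSimpleRing (YY p ⊗[k] YY q) := by
  refine (tensor₂_isTwisted q p).isSimpleRing (Field.toIsField k) fun i j hij => ?_
  by_cases h1 : i.1 = j.1
  · obtain ⟨g, hg⟩ := yy_sep hq i.2 j.2 fun h2 => hij (Prod.ext h1 h2)
    refine ⟨(0, g), ?_⟩
    simpa [yyTwist₂, yyTwist, qpow_zero] using hg
  · obtain ⟨g, hg⟩ := yy_sep hp i.1 j.1 h1
    refine ⟨(g, 0), ?_⟩
    simpa [yyTwist₂, yyTwist, qpow_zero] using hg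

end YY

end

end QAge

namespace QAge

noncomputable section

open scoped TensorProduct

/-! Elements commuting up to scalars -/

section Commutation

variable {k R : Type*} [Field k] [Ring R] [Algebra k R]

theorem mul_pow_of_mul_eq_smul {u v : R} {c : k} (h : u * v = c • (v * u)) (n : ℕ) :
    u * v ^ n = c ^ n • (v ^ n * u) := by
  induction n with
  | zero => simp
  | succ n ih =>
    rw [pow_succ, ← mul_assoc, ih, smul_mul_assoc, mul_assoc, h, mul_smul_comm, smul_smul,
      pow_succ, mul_assoc]

theorem pow_mul_of_mul_eq_smul {u v : R} {c : k} (h : u * v = c • (v * u)) (n : ℕ) :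
    u ^ n * v = c ^ n • (v * u ^ n) := by
  induction n with
  | zero => simp
  | succ n ih =>
    rw [pow_succ', mul_assoc, ih, mul_smul_comm, ← mul_assoc, h, smul_mul_assoc, smul_smul,
      pow_succ, mul_assoc]

theorem mul_eq_inv_smul {u v : R} {c : k} (hc : c ≠ 0) (h : u * v = c • (v * u)) :
    v * u = c⁻¹ • (u * v) := by
  rw [h, smul_smul, inv_mul_cancel₀ hc, one_smul]

theorem inv_mul_eq_smul {u u' v : R} {c : k} (hc : c ≠ 0) (h : u * v = c • (v * u))
    (h1 : u * u' = 1) (h2 : u' * u = 1) : u' * v = c⁻¹ • (v * u') := by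
  have h3 : u' * (u * v) * u' = v * u' := by rw [← mul_assoc, h2, one_mul]
  rw [h, mul_smul_comm, smul_mul_assoc, mul_assoc, mul_assoc v, h1, mul_one] at h3
  rw [← h3, smul_smul, inv_mul_cancel₀ hc, one_smul]

end Commutation

/-! The defining relations -/

section Relations

variable {k : Type*} [Field k] (q : kˣ)

theorem gE_mul_gK : gE q * gK q = ((q : k) ^ 2)⁻¹ • (gK q * gE q) := by
  have h := mkAlg_rel q Rel.EK
  simpa [gen] using h

theorem gX_mul_gK : gX q * gK q = (q : k)⁻¹ • (gK q * gX q) := by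
  have h := mkAlg_rel q Rel.XK
  simpa [gen] using h

theorem gY_mul_gK : gY q * gK q = (q : k) • (gK q * gY q) := by
  have h := mkAlg_rel q Rel.YK
  simpa [gen] using h

theorem gE_mul_gX : gE q * gX q = (q : k) • (gX q * gE q) := by
  have h := mkAlg_rel q Rel.EX
  simpa [gen] using h

theorem gE_mul_gY : gE q * gY q = gX q + (q : k)⁻¹ • (gY q * gE q) := by
  have h := mkAlg_rel q Rel.EY
  simpa [gen] using h

theorem gX_mul_gY : gX q * gY q = (q : k) • (gY q * gX q) := by
  have h := mkAlg_rel q Rel.YX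
  simpa [gen] using h.symm

theorem gK_mul_gE : gK q * gE q = (q : k) ^ 2 • (gE q * gK q) := by
  rw [gE_mul_gK, smul_smul, mul_inv_cancel₀ (by simp), one_smul]

theorem gK_mul_gX : gK q * gX q = (q : k) • (gX q * gK q) := by
  rw [gX_mul_gK, smul_smul, mul_inv_cancel₀ (by simp), one_smul]

theorem gK_mul_gY : gK q * gY q = (q : k)⁻¹ • (gY q * gK q) := by
  rw [gY_mul_gK, smul_smul, inv_mul_cancel₀ (by simp), one_smul]

theorem gKinv_mul_gE : gKinv q * gE q = ((q : k) ^ 2)⁻¹ • (gE q * gKinv q) :=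
  inv_mul_eq_smul (by simp) (gK_mul_gE q) (gK_mul_gKinv q) (gKinv_mul_gK q)

theorem gKinv_mul_gX : gKinv q * gX q = (q : k)⁻¹ • (gX q * gKinv q) :=
  inv_mul_eq_smul (by simp) (gK_mul_gX q) (gK_mul_gKinv q) (gKinv_mul_gK q)

theorem gKinv_mul_gY : gKinv q * gY q = (q : k) • (gY q * gKinv q) := by
  simpa using inv_mul_eq_smul (by simp) (gK_mul_gY q) (gK_mul_gKinv q) (gKinv_mul_gK q)

theorem gY_mul_gX : gY q * gX q = (q : k)⁻¹ • (gX q * gY q) := by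
  rw [gX_mul_gY, smul_smul, inv_mul_cancel₀ (by simp), one_smul]

theorem gX_mul_gE : gX q * gE q = (q : k)⁻¹ • (gE q * gX q) := by
  rw [gE_mul_gX, smul_smul, inv_mul_cancel₀ (by simp), one_smul]

theorem phi_eq : phi q = gX q + ((q : k)⁻¹ - q) • (gY q * gE q) := by
  rw [phi, Units.val_inv_eq_inv_val]

/-- The relation for EY says X = EY - q⁻¹YE, and likewise φ = EY - qYE. Thus φ is the companion of X
under exchanging q and q⁻¹ in this skew commutator, and both q-commute with every generator. -/
theorem gE_mul_phi : gE q * phi q = (q : k)⁻¹ • (phi q * gE q) := by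
  have hq : (q : k) ≠ 0 := q.ne_zero
  rw [phi_eq, mul_add, mul_smul_comm, ← mul_assoc, gE_mul_gY, gE_mul_gX, add_mul, add_mul,
    smul_mul_assoc, smul_mul_assoc]
  match_scalars <;> field_simp <;> ring

theorem gY_mul_phi : gY q * phi q = (q : k) • (phi q * gY q) := by
  have hq : (q : k) ≠ 0 := q.ne_zero
  rw [phi_eq, add_mul, smul_mul_assoc, mul_assoc, gE_mul_gY, gX_mul_gY, mul_add, mul_add,
    mul_smul_comm, mul_smul_comm]
  match_scalars <;> field_simp <;> ring

theorem gX_mul_phi : gX q * phi q = phi q * gX q := by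
  have hq : (q : k) ≠ 0 := q.ne_zero
  rw [phi_eq, add_mul, mul_add, mul_smul_comm, smul_mul_assoc, mul_assoc, gE_mul_gX, ← mul_assoc,
    gX_mul_gY, mul_smul_comm, smul_mul_assoc, mul_assoc]

theorem gK_mul_phi : gK q * phi q = (q : k) • (phi q * gK q) := by
  have hq : (q : k) ≠ 0 := q.ne_zero
  rw [phi_eq, add_mul, mul_add, mul_smul_comm, smul_mul_assoc, mul_assoc, gE_mul_gK, ← mul_assoc,
    gK_mul_gX, gK_mul_gY, mul_smul_comm, smul_mul_assoc, ← mul_assoc, gY_mul_gK]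
  simp only [mul_assoc, smul_mul_assoc]
  match_scalars <;> field_simp

theorem gKinv_mul_phi : gKinv q * phi q = (q : k)⁻¹ • (phi q * gKinv q) :=
  inv_mul_eq_smul (by simp) (gK_mul_phi q) (gK_mul_gKinv q) (gKinv_mul_gK q)

theorem adjoin_gen : Algebra.adjoin k (Set.range (gen q)) = ⊤ := by
  have h := congrArg (Subalgebra.map (mkAlg q)) (FreeAlgebra.adjoin_range_ι k Gen)
  rw [AlgHom.map_adjoin, Algebra.map_top, ← Set.range_comp] at h
  refine h.trans ?_
  rw [AlgHom.range_eq_top]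
  exact RingQuot.mkAlgHom_surjective k (Rel q)

/-- Images of the generators satisfying the defining relations. -/
structure Rels {B : Type*} [Ring B] [Algebra k B] (g : Gen → B) : Prop where
  K_Kinv : g .K * g .Kinv = 1
  Kinv_K : g .Kinv * g .K = 1
  EK : g .E * g .K = ((q : k) ^ 2)⁻¹ • (g .K * g .E)
  XK : g .X * g .K = (q : k)⁻¹ • (g .K * g .X)
  YK : g .Y * g .K = (q : k) • (g .K * g .Y)
  EX : g .E * g .X = (q : k) • (g .X * g .E)
  EY : g .E * g .Y = g .X + (q : k)⁻¹ • (g .Y * g .E)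
  YX : (q : k) • (g .Y * g .X) = g .X * g .Y

variable {B : Type*} [Ring B] [Algebra k B]

theorem exists_lift {g : Gen → B} (h : Rels q g) : ∃ f : Alg q →ₐ[k] B, ∀ x, f (gen q x) = g x := by
  refine ⟨RingQuot.liftAlgHom k (s := Rel q) ⟨FreeAlgebra.lift k g, ?_⟩, fun x => ?_⟩
  · intro a b hab
    induction hab with
    | K_Kinv => simpa using h.K_Kinv
    | Kinv_K => simpa using h.Kinv_K
    | EK => simpa using h.EK
    | XK => simpa using h.XK
    | YK => simpa using h.YK
    | EX => simpa using h.EX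
    | EY => simpa using h.EY
    | YX => simpa using h.YX
  · refine (RingQuot.liftAlgHom_mkAlgHom_apply k (FreeAlgebra.lift k g) _ _).trans ?_
    rw [FreeAlgebra.lift_ι_apply]

variable {q} in
theorem algHom_ext_gen {f g : Alg q →ₐ[k] B} (h : ∀ x, f (gen q x) = g (gen q x)) : f = g := by
  refine AlgHom.ext_of_adjoin_eq_top (adjoin_gen q) ?_
  rintro _ ⟨x, rfl⟩
  exact h x

/-- The integer powers of `K`. -/
def Kz (n : ℤ) : Alg q := ((unitK q ^ n : (Alg q)ˣ) : Alg q)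

theorem gK_mul_Kz (n : ℤ) : gK q * Kz q n = Kz q (n + 1) := by
  rw [Kz, Kz, add_comm, zpow_one_add, Units.val_mul]; rfl

theorem gKinv_mul_Kz (n : ℤ) : gKinv q * Kz q n = Kz q (n - 1) := by
  rw [Kz, Kz, sub_eq_neg_add, zpow_add, zpow_neg_one, Units.val_mul]; rfl

theorem Kz_zero : Kz q 0 = 1 := by simp [Kz]

theorem laurentK_T (n : ℤ) : laurentK q (LaurentPolynomial.T n) = Kz q n := by
  rw [laurentK, LaurentPolynomial.T, AddMonoidAlgebra.lift_single, one_smul]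
  rfl

theorem gE_mul_gY_pow (n : ℕ) : gE q * gY q ^ (n + 1) =
    (∑ i ∈ Finset.range (n + 1), (((q : k) ^ 2)⁻¹) ^ i) • (gX q * gY q ^ n) +
      ((q : k)⁻¹) ^ (n + 1) • (gY q ^ (n + 1) * gE q) := by
  induction n with
  | zero => simp [gE_mul_gY]
  | succ n ih =>
    have h := pow_mul_of_mul_eq_smul (gY_mul_gX q) (n + 1)
    rw [pow_succ _ (n + 1), ← mul_assoc, ih, add_mul, smul_mul_assoc, smul_mul_assoc, mul_assoc,
      mul_assoc, gE_mul_gY, mul_add, h, Finset.sum_range_succ _ (n + 1), mul_smul_comm,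
      ← mul_assoc (gY q ^ (n + 1)), ← pow_succ, ← pow_succ]
    have h2 : (((q : k) ^ 2)⁻¹) ^ (n + 1) = ((q : k)⁻¹) ^ (n + 1) * ((q : k)⁻¹) ^ (n + 1) := by
      rw [← inv_pow, ← pow_mul, ← pow_add]
      congr 1
      ring
    rw [h2, pow_succ _ (n + 1)]
    module

/-- This sum is the coefficient of XYⁿ in EYⁿ⁺¹. If it vanished, then q^(2(n + 1)) would be 1. Its
invertibility allows powers of Y in an ideal to be lowered. -/
theorem sum_geom_ne_zero {q : kˣ} (hq : ∀ n : ℕ, 0 < n → q ^ n ≠ 1) (n : ℕ) :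
    ∑ i ∈ Finset.range (n + 1), (((q : k) ^ 2)⁻¹) ^ i ≠ 0 := by
  intro h
  have h1 := geom_sum_mul (((q : k) ^ 2)⁻¹) (n + 1)
  rw [h, zero_mul] at h1
  have h2 : ((q : k) ^ (2 * (n + 1))) = 1 := by
    have h3 := (sub_eq_zero.1 h1.symm)
    rw [inv_pow, inv_eq_one, ← pow_mul] at h3
    exact h3
  exact hq (2 * (n + 1)) (by omega) (Units.ext (by simpa using h2))

end Relations

end

end QAge

namespace QAge

noncomputable section

open scoped TensorProduct

/-! ### Spanning sets of monomials -/

section Span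

variable {k : Type*} [Field k] (q : kˣ)

/-- The monomials `Xᵃ Yᵇ Eᶜ Kⁱ`. -/
def mono (j : ℕ × ℕ × ℕ × ℤ) : Alg q :=
  gX q ^ j.1 * (gY q ^ j.2.1 * (gE q ^ j.2.2.1 * Kz q j.2.2.2))

theorem mul_span_le {R ι : Type*} [Ring R] [Algebra k R] (v : ι → R) (g : R)
    (h : ∀ i, g * v i ∈ Submodule.span k (Set.range v)) :
    ∀ x ∈ Submodule.span k (Set.range v), g * x ∈ Submodule.span k (Set.range v) := by
  have h1 : Submodule.span k (Set.range v) ≤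
      (Submodule.span k (Set.range v)).comap (LinearMap.mulLeft k g) :=
    Submodule.span_le.2 (by rintro _ ⟨i, rfl⟩; exact h i)
  exact fun x hx => h1 hx

/-- Only E against Yᵇ produces an extra term, namely XYᵇ⁻¹, which is already in normal form. This is
the spanning half of a PBW theorem; the other half is implicit in the triangularity behind
`bigHom_injective`. -/
theorem span_mono : Submodule.span k (Set.range (mono q)) = ⊤ := by
  have hm : ∀ (s : k) (a b c : ℕ) (i : ℤ), s • (gX q ^ a * (gY q ^ b * (gE q ^ c * Kz q i))) ∈
      Submodule.span k (Set.range (mono q)) := fun s a b c i =>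
    Submodule.smul_mem _ _ (Submodule.subset_span ⟨(a, b, c, i), rfl⟩)
  refine submodule_eq_top_of_mul_mem _ (adjoin_gen q) _ ?_ ?_
  · simpa [Kz_zero] using hm 1 0 0 0 0
  · rintro _ ⟨x, rfl⟩
    refine mul_span_le _ _ ?_
    rintro ⟨a, b, c, i⟩
    have hK : ∀ (κ : Alg q) (x y z : k) (j : ℤ), κ * gX q = x • (gX q * κ) →
        κ * gY q = y • (gY q * κ) → κ * gE q = z • (gE q * κ) → κ * Kz q i = Kz q j →
        κ * mono q (a, b, c, i) ∈ Submodule.span k (Set.range (mono q)) := by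
      intro κ x y z j h1 h2 h3 h4
      have h5 := mul_pow_of_mul_eq_smul h1 a
      have h6 := mul_pow_of_mul_eq_smul h2 b
      have h7 := mul_pow_of_mul_eq_smul h3 c
      rw [mono, ← mul_assoc, h5, smul_mul_assoc, mul_assoc, ← mul_assoc κ, h6, smul_mul_assoc,
        mul_assoc (_ ^ b), ← mul_assoc κ, h7, smul_mul_assoc, mul_assoc (_ ^ c), h4,
        mul_smul_comm, mul_smul_comm, mul_smul_comm, smul_smul, smul_smul]
      exact hm _ _ _ _ _
    cases x with
    | X =>
      change gX q * mono q (a, b, c, i) ∈ _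
      rw [mono, ← mul_assoc, ← pow_succ']
      simpa using hm 1 (a + 1) b c i
    | Y =>
      change gY q * mono q (a, b, c, i) ∈ _
      rw [mono, ← mul_assoc, mul_pow_of_mul_eq_smul (gY_mul_gX q), smul_mul_assoc, mul_assoc,
        ← mul_assoc (gY q), ← pow_succ']
      exact hm _ a (b + 1) c i
    | E =>
      change gE q * mono q (a, b, c, i) ∈ _
      rw [mono, ← mul_assoc, mul_pow_of_mul_eq_smul (gE_mul_gX q), smul_mul_assoc, mul_assoc]
      refine Submodule.smul_mem _ _ ?_
      cases b with
      | zero =>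
        rw [pow_zero, one_mul, ← mul_assoc (gE q), ← pow_succ']
        simpa using hm 1 a 0 (c + 1) i
      | succ b =>
        rw [← mul_assoc (gE q), gE_mul_gY_pow, add_mul, mul_add, smul_mul_assoc, smul_mul_assoc,
          mul_assoc, mul_smul_comm, mul_smul_comm, ← mul_assoc (_ ^ a), ← pow_succ,
          mul_assoc (_ ^ (b + 1)), ← mul_assoc (gE q), ← pow_succ']
        exact Submodule.add_mem _ (hm _ (a + 1) b c i) (hm _ a (b + 1) (c + 1) i)
    | K => exact hK _ _ _ _ _ (gK_mul_gX q) (gK_mul_gY q) (gK_mul_gE q) (gK_mul_Kz q i)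
    | Kinv =>
      exact hK _ _ _ _ _ (gKinv_mul_gX q) (gKinv_mul_gY q) (gKinv_mul_gE q) (gKinv_mul_Kz q i)

variable {q} {B : Type*} [Ring B] [Algebra k B]

theorem adjoin_map_gen (f : Alg q →ₐ[k] B) (hf : Function.Surjective f) :
    Algebra.adjoin k (Set.range fun x => f (gen q x)) = ⊤ := by
  have h := congrArg (Subalgebra.map f) (adjoin_gen q)
  rw [AlgHom.map_adjoin, ← Set.range_comp, Algebra.map_top,
    (AlgHom.range_eq_top f).2 hf] at h
  exact h

/-- The monomials `Yᵇ Eᶜ Kⁱ`. -/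
def monoYE (q : kˣ) (j : (ℕ × ℕ) × ℤ) : Alg q := gY q ^ j.1.1 * (gE q ^ j.1.2 * Kz q j.2)

/-- It is meant for quotients where X vanishes (s = 0) or φ vanishes (s = q - q⁻¹). There E and Y
commute up to the scalar s + q⁻¹, so X disappears from the normal form. -/
theorem span_monoYE (f : Alg q →ₐ[k] B) (hf : Function.Surjective f) (s : k)
    (h : f (gX q) = s • (f (gY q) * f (gE q))) :
    Submodule.span k (Set.range fun j => f (monoYE q j)) = ⊤ := by
  have hm : ∀ (s : k) (b c : ℕ) (i : ℤ), s • (f (gY q) ^ b * (f (gE q) ^ c * f (Kz q i))) ∈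
      Submodule.span k (Set.range fun j => f (monoYE q j)) := fun s b c i =>
    Submodule.smul_mem _ _ (Submodule.subset_span ⟨((b, c), i), by simp [monoYE]⟩)
  have hmono : ∀ b c i, f (monoYE q ((b, c), i)) =
      f (gY q) ^ b * (f (gE q) ^ c * f (Kz q i)) := fun b c i => by simp [monoYE]
  have hE : ∀ x ∈ Submodule.span k (Set.range fun j => f (monoYE q j)),
      f (gE q) * x ∈ Submodule.span k (Set.range fun j => f (monoYE q j)) := by
    refine mul_span_le _ _ ?_
    rintro ⟨⟨b, c⟩, i⟩
    have h1 : f (gE q) * f (gY q) = (s + (q : k)⁻¹) • (f (gY q) * f (gE q)) := by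
      have h2 := congrArg f (gE_mul_gY q)
      rw [map_mul, map_add, map_smul, map_mul, h] at h2
      rw [h2, add_smul]
    rw [hmono, ← mul_assoc, mul_pow_of_mul_eq_smul h1, smul_mul_assoc, mul_assoc, ← mul_assoc (f (gE q)),
      ← pow_succ']
    exact hm _ b (c + 1) i
  have hY : ∀ x ∈ Submodule.span k (Set.range fun j => f (monoYE q j)),
      f (gY q) * x ∈ Submodule.span k (Set.range fun j => f (monoYE q j)) := by
    refine mul_span_le _ _ ?_
    rintro ⟨⟨b, c⟩, i⟩
    rw [hmono, ← mul_assoc, ← pow_succ']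
    simpa using hm 1 (b + 1) c i
  refine submodule_eq_top_of_mul_mem _ (adjoin_map_gen f hf) _ ?_ ?_
  · simpa [Kz_zero] using hm 1 0 0 0
  · rintro _ ⟨x, rfl⟩
    have hK : ∀ (κ : Alg q) (y z : k) (d : ℤ), (∀ i, κ * Kz q i = Kz q (i + d)) →
        κ * gY q = y • (gY q * κ) → κ * gE q = z • (gE q * κ) →
        ∀ x ∈ Submodule.span k (Set.range fun j => f (monoYE q j)),
          f κ * x ∈ Submodule.span k (Set.range fun j => f (monoYE q j)) := by
      intro κ y z d h4 h2 h3
      refine mul_span_le _ _ ?_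
      rintro ⟨⟨b, c⟩, i⟩
      have h6 := mul_pow_of_mul_eq_smul h2 b
      have h7 := mul_pow_of_mul_eq_smul h3 c
      rw [← map_mul, monoYE, ← mul_assoc κ, h6, smul_mul_assoc,
        mul_assoc (_ ^ b), ← mul_assoc κ, h7, smul_mul_assoc, mul_assoc (_ ^ c), h4,
        mul_smul_comm, smul_smul, map_smul]
      simp only [map_mul, map_pow]
      exact hm _ _ _ _
    cases x with
    | X =>
      intro x hx
      change f (gX q) * x ∈ _
      rw [h, smul_mul_assoc, mul_assoc]
      exact Submodule.smul_mem _ _ (hY _ (hE _ hx))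
    | Y => exact hY
    | E => exact hE
    | K => exact hK _ _ _ 1 (gK_mul_Kz q) (gK_mul_gY q) (gK_mul_gE q)
    | Kinv => exact hK _ _ _ (-1) (gKinv_mul_Kz q) (gKinv_mul_gY q) (gKinv_mul_gE q)

end Span

/-! Homomorphisms to quantum tori -/

section Torus

variable {k : Type*} [Field k]

theorem tmul_basis_mul {S W G : Type*} [Ring S] [Algebra k S] [Ring W] [Algebra k W]
    [AddCommGroup G] {b : Module.Basis G k S} {ω : G → G → k} (h : IsTwisted b ω) (w w' : W)
    (i j : G) : (w ⊗ₜ[k] b i) * (w' ⊗ₜ[k] b j) = ω i j • ((w * w') ⊗ₜ[k] b (i + j)) := by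
  rw [Algebra.TensorProduct.tmul_mul_tmul, h.mul, TensorProduct.tmul_smul]

variable (q : kˣ) {W : Type*} [Ring W] [Algebra k W]

/-- The element `w Yᵇ Kᶜ` of `W ⊗ 𝕐`. -/
def tm (w : W) (b c : ℤ) : W ⊗[k] YY q := w ⊗ₜ[k] yyBasis q (b, c)

theorem tm_mul_tm (w w' : W) (b c b' c' : ℤ) :
    tm q w b c * tm q w' b' c' = (q : k) ^ (-(c * b')) • tm q (w * w') (b + b') (c + c') := by
  refine (tmul_basis_mul (yy_isTwisted q) w w' (b, c) (b', c')).trans ?_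
  rw [yyTwist, qpow, Units.val_zpow_eq_zpow_val]
  rfl

theorem tm_one : tm q (1 : W) 0 0 = 1 := by
  rw [tm, ← Prod.zero_eq_mk, (yy_isTwisted q).one]; rfl

theorem tm_zero (b c : ℤ) : tm q (0 : W) b c = 0 := TensorProduct.zero_tmul _ _

theorem smul_tm (s : k) (w : W) (b c : ℤ) : tm q (s • w) b c = s • tm q w b c :=
  (TensorProduct.smul_tmul' _ _ _).symm

theorem isUnit_tm {w : W} (hw : IsUnit w) (b c : ℤ) : IsUnit (tm q w b c) := by
  obtain ⟨u, rfl⟩ := hw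
  have hq : (q : k) ≠ 0 := q.ne_zero
  refine isUnit_iff_exists_and_exists.2
    ⟨⟨(q : k) ^ (-(c * b)) • tm q (↑u⁻¹ : W) (-b) (-c), ?_⟩,
      ⟨(q : k) ^ (-(c * b)) • tm q (↑u⁻¹ : W) (-b) (-c), ?_⟩⟩
  · rw [mul_smul_comm, tm_mul_tm, smul_smul, ← zpow_add₀ hq, Units.mul_inv, add_neg_cancel,
      add_neg_cancel, tm_one]
    simp
  · rw [smul_mul_assoc, tm_mul_tm, smul_smul, ← zpow_add₀ hq, Units.inv_mul, neg_add_cancel,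
      neg_add_cancel, tm_one]
    simp

/-- The images of the generators in `W ⊗ 𝕐` determined by the images `C`, `Z` of the elements `C`
and `Z`. -/
def torusGen (C Z : W) : Gen → W ⊗[k] YY q
  -- Solve φ = X + (q⁻¹ - q)YE for E, with φ = qZY⁻¹K and X = q⁻¹CY⁻¹K⁻¹.
  | .E => ((q : k)⁻¹ - q)⁻¹ • ((q : k) • tm q Z (-2) 1 - (q : k)⁻¹ • tm q C (-2) (-1))
  | .K => tm q 1 0 1
  | .Kinv => tm q 1 0 (-1)
  | .X => (q : k)⁻¹ • tm q C (-1) (-1)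
  | .Y => tm q 1 1 0

variable {q}

theorem inv_sub_self_ne_zero (hq : ∀ n : ℕ, 0 < n → q ^ n ≠ 1) : (q : k)⁻¹ - q ≠ 0 := by
  intro h
  refine hq 2 two_pos (Units.ext ?_)
  have h1 := mul_inv_cancel₀ q.ne_zero
  rw [sub_eq_zero.1 h] at h1
  simpa [pow_two] using h1

/-- The single relation between C and Z suffices because Y and K are already units of 𝕐. It holds
trivially when C or Z is 0, which gives the quotients by φ and by X. -/
theorem torusGen_rels (hq : ∀ n : ℕ, 0 < n → q ^ n ≠ 1) {C Z : W}
    (h : C * Z = (q : k) ^ 2 • (Z * C)) : Rels q (torusGen q C Z) := by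
  have hq0 : (q : k) ≠ 0 := q.ne_zero
  have hl := inv_sub_self_ne_zero hq
  have hl' : 1 - (q : k) ^ 2 ≠ 0 := by
    intro h2
    apply hl
    field_simp
    rw [h2, mul_zero]
  constructor
  · simp [torusGen, tm_mul_tm, tm_one]
  · simp [torusGen, tm_mul_tm, tm_one]
  · simp only [torusGen, smul_mul_assoc, sub_mul, mul_sub, mul_smul_comm, tm_mul_tm, one_mul,
      mul_one]
    norm_num
    match_scalars <;> field_simp
  · simp only [torusGen, smul_mul_assoc, mul_smul_comm, tm_mul_tm, one_mul, mul_one]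
    norm_num
  · simp only [torusGen, tm_mul_tm, mul_one]
    norm_num
  · simp only [torusGen, smul_mul_assoc, sub_mul, mul_sub, mul_smul_comm, tm_mul_tm, h, smul_tm]
    norm_num
    match_scalars <;> field_simp
  · simp only [torusGen, smul_mul_assoc, sub_mul, mul_sub, mul_smul_comm, tm_mul_tm, one_mul,
      mul_one]
    norm_num
    match_scalars <;> field_simp <;> ring
  · simp only [torusGen, smul_mul_assoc, mul_smul_comm, tm_mul_tm, one_mul, mul_one]
    norm_num

end Torus

end

end QAge

namespace QAge

noncomputable section

open scoped TensorProduct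

section TorusHom

variable {k : Type*} [Field k] {q : kˣ} (hq : ∀ n : ℕ, 0 < n → q ^ n ≠ 1)
  {W : Type*} [Ring W] [Algebra k W] {C Z : W} (h : C * Z = (q : k) ^ 2 • (Z * C))

/-- The homomorphism from `𝒜` to `W ⊗ 𝕐` with `X Y K ↦ C` and `φ Y K⁻¹ ↦ Z`. -/
def torusHom : Alg q →ₐ[k] W ⊗[k] YY q := Classical.choose (exists_lift q (torusGen_rels hq h))

theorem torusHom_gen (x : Gen) : torusHom hq h (gen q x) = torusGen q C Z x :=
  Classical.choose_spec (exists_lift q (torusGen_rels hq h)) x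

theorem torusHom_gY : torusHom hq h (gY q) = tm q 1 1 0 := torusHom_gen hq h _

theorem torusHom_gK : torusHom hq h (gK q) = tm q 1 0 1 := torusHom_gen hq h _

theorem torusHom_gX : torusHom hq h (gX q) = (q : k)⁻¹ • tm q C (-1) (-1) := torusHom_gen hq h _

theorem torusHom_gE : torusHom hq h (gE q) =
    ((q : k)⁻¹ - q)⁻¹ • ((q : k) • tm q Z (-2) 1 - (q : k)⁻¹ • tm q C (-2) (-1)) :=
  torusHom_gen hq h _

theorem torusHom_phi : torusHom hq h (phi q) = (q : k) • tm q Z (-1) 1 := by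
  have hl := inv_sub_self_ne_zero hq
  rw [phi_eq, map_add, map_smul, map_mul, torusHom_gX, torusHom_gY, torusHom_gE, mul_smul_comm,
    smul_smul, mul_inv_cancel₀ hl, one_smul, mul_sub, mul_smul_comm, mul_smul_comm, tm_mul_tm,
    tm_mul_tm]
  norm_num

theorem torusHom_gKinv : torusHom hq h (gKinv q) = tm q 1 0 (-1) := torusHom_gen hq h _

theorem torusHom_elZ : torusHom hq h (elZ q) = Z ⊗ₜ[k] 1 := by
  rw [elZ, map_mul, map_mul, torusHom_phi, torusHom_gY, torusHom_gKinv, smul_mul_assoc,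
    smul_mul_assoc, tm_mul_tm, smul_mul_assoc, tm_mul_tm, smul_smul, smul_smul]
  have : (1 : YY q) = yyBasis q (0, 0) := (yy_isTwisted q).one.symm
  rw [this]
  norm_num [tm]

theorem torusHom_elC : torusHom hq h (elC q) = C ⊗ₜ[k] 1 := by
  rw [elC, map_mul, map_mul, torusHom_gX, torusHom_gY, torusHom_gK, smul_mul_assoc,
    smul_mul_assoc, tm_mul_tm, smul_mul_assoc, tm_mul_tm, smul_smul, smul_smul]
  have : (1 : YY q) = yyBasis q (0, 0) := (yy_isTwisted q).one.symm
  rw [this]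
  norm_num [tm]

theorem torusHom_Kz (n : ℤ) : torusHom hq h (Kz q n) = tm q 1 0 n := by
  induction n with
  | zero => rw [Kz_zero, map_one, tm_one]
  | succ n ih =>
    rw [← gK_mul_Kz, map_mul, ih, torusHom_gK, tm_mul_tm, add_comm (n : ℤ)]
    simp
  | pred n ih =>
    rw [← gKinv_mul_Kz, map_mul, ih, torusHom_gKinv, tm_mul_tm, sub_eq_neg_add]
    simp

variable (q) in
theorem tm_pow (w : W) (b c : ℤ) (n : ℕ) :
    ∃ s : k, s ≠ 0 ∧ tm q w b c ^ n = s • tm q (w ^ n) (n * b) (n * c) := by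
  induction n with
  | zero => exact ⟨1, one_ne_zero, by simp [tm_one]⟩
  | succ n ih =>
    obtain ⟨s, hs, h⟩ := ih
    refine ⟨s * (q : k) ^ (-(n * c * b)), mul_ne_zero hs (zpow_ne_zero _ q.ne_zero), ?_⟩
    rw [pow_succ, h, smul_mul_assoc, tm_mul_tm, smul_smul, ← pow_succ]
    congr 2
    · push_cast; ring
    · push_cast; ring

end TorusHom

/-! The four-dimensional quantum torus -/

section Four

variable {k : Type*} [Field k] {q : kˣ} (hq : ∀ n : ℕ, 0 < n → q ^ n ≠ 1)

theorem yyY_mul_yyK (q : kˣ) : yyY (q ^ 2) * yyK (q ^ 2) =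
    (q : k) ^ 2 • (yyK (q ^ 2) * yyY (q ^ 2)) := by
  rw [yyY_eq, yyK_eq, (yy_isTwisted _).mul, (yy_isTwisted _).mul, smul_smul]
  congr 1
  have hq : (q : k) ≠ 0 := q.ne_zero
  simp [yyTwist, qpow]

/-- The embedding of `𝒜` in a quantum torus of rank four. -/
def bigHom : Alg q →ₐ[k] YY (q ^ 2) ⊗[k] YY q := torusHom hq (yyY_mul_yyK q)

/-- The monomial basis of the quantum torus of rank four. -/
def bigBasis (q : kˣ) : Module.Basis ((ℤ × ℤ) × (ℤ × ℤ)) k (YY (q ^ 2) ⊗[k] YY q) :=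
  (yyBasis (q ^ 2)).tensorProduct (yyBasis q)

theorem big_isTwisted (q : kˣ) : IsTwisted (bigBasis q) (yyTwist₂ q (q ^ 2)) :=
  tensor₂_isTwisted q (q ^ 2)

theorem tm_yyBasis (i : ℤ × ℤ) (b c : ℤ) :
    tm q (yyBasis (q ^ 2) i) b c = bigBasis q (i, (b, c)) :=
  (Module.Basis.tensorProduct_apply' (yyBasis (q ^ 2)) (yyBasis q) (i, (b, c))).symm

theorem tm_one_eq (b c : ℤ) : tm q (1 : YY (q ^ 2)) b c = bigBasis q (0, (b, c)) := by
  rw [← tm_yyBasis, (yy_isTwisted _).one]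

/-- The span of the monomials of degree less than `n` in the second variable. -/
def lowDeg (q : kˣ) (n : ℤ) : Submodule k (YY (q ^ 2) ⊗[k] YY q) :=
  Submodule.span k (bigBasis q '' {j | j.1.2 < n})

theorem bigBasis_mem_lowDeg {j : (ℤ × ℤ) × (ℤ × ℤ)} {n : ℤ} (h : j.1.2 < n) :
    bigBasis q j ∈ lowDeg q n := Submodule.subset_span ⟨j, h, rfl⟩

/-- Degrees are integers strictly below m and n, so those of the products are at most m + n - 2;
hence the bound p + 1 and not p. -/
theorem lowDeg_mul {m n p : ℤ} (hp : m + n ≤ p + 1) {x y : YY (q ^ 2) ⊗[k] YY q}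
    (hx : x ∈ lowDeg q m) (hy : y ∈ lowDeg q n) : x * y ∈ lowDeg q p := by
  have h : lowDeg q m * lowDeg q n ≤ lowDeg q p := by
    rw [lowDeg, lowDeg, Submodule.span_mul_span, Submodule.span_le]
    rintro _ ⟨_, ⟨i, hi, rfl⟩, _, ⟨j, hj, rfl⟩, rfl⟩
    change bigBasis q i * bigBasis q j ∈ lowDeg q p
    rw [(big_isTwisted q).mul]
    refine Submodule.smul_mem _ _ (bigBasis_mem_lowDeg ?_)
    have h1 : i.1.2 < m := hi
    have h2 : j.1.2 < n := hj
    change i.1.2 + j.1.2 < p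
    omega
  exact h (Submodule.mul_mem_mul hx hy)

theorem repr_lowDeg {n : ℤ} {x : YY (q ^ 2) ⊗[k] YY q} (hx : x ∈ lowDeg q n)
    {j : (ℤ × ℤ) × (ℤ × ℤ)} (hj : n ≤ j.1.2) : (bigBasis q).repr x j = 0 := by
  have h : lowDeg q n ≤ LinearMap.ker ((bigBasis q).coord j) := by
    rw [lowDeg, Submodule.span_le]
    rintro _ ⟨i, hi, rfl⟩
    change (bigBasis q).repr (bigBasis q i) j = 0
    rw [Module.Basis.repr_self, Finsupp.single_eq_of_ne]
    rintro rfl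
    exact absurd hi (not_lt.2 hj)
  exact h hx

/-- The element `x` has leading monomial `i` with respect to the second variable. -/
def HasLead (x : YY (q ^ 2) ⊗[k] YY q) (i : (ℤ × ℤ) × (ℤ × ℤ)) : Prop :=
  ∃ s : k, s ≠ 0 ∧ ∃ f ∈ lowDeg q i.1.2, x = s • bigBasis q i + f

/-- A leading monomial of degree d lies in `lowDeg q (d + 1)`, so each of the three cross terms lies
strictly below the product of the leading ones. -/
theorem HasLead.mul {x y : YY (q ^ 2) ⊗[k] YY q} {i j : (ℤ × ℤ) × (ℤ × ℤ)}
    (hx : HasLead x i) (hy : HasLead y j) : HasLead (x * y) (i + j) := by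
  obtain ⟨s, hs, f, hf, rfl⟩ := hx
  obtain ⟨t, ht, g, hg, rfl⟩ := hy
  refine ⟨s * t * yyTwist₂ q (q ^ 2) i j,
    mul_ne_zero (mul_ne_zero hs ht) ((big_isTwisted q).ne_zero _ _),
    s • bigBasis q i * g + f * (t • bigBasis q j) + f * g, ?_, ?_⟩
  · have h1 : s • bigBasis q i ∈ lowDeg q (i.1.2 + 1) :=
      Submodule.smul_mem _ _ (bigBasis_mem_lowDeg (by omega))
    have h2 : t • bigBasis q j ∈ lowDeg q (j.1.2 + 1) :=
      Submodule.smul_mem _ _ (bigBasis_mem_lowDeg (by omega))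
    have h3 : (i + j).1.2 = i.1.2 + j.1.2 := rfl
    exact Submodule.add_mem _ (Submodule.add_mem _ (lowDeg_mul (by omega) h1 hg)
      (lowDeg_mul (by omega) hf h2)) (lowDeg_mul (by omega) hf hg)
  · rw [add_mul, mul_add, mul_add, smul_mul_smul_comm, (big_isTwisted q).mul, smul_smul]
    abel

theorem HasLead.of_smul (i : (ℤ × ℤ) × (ℤ × ℤ)) {s : k} (hs : s ≠ 0) :
    HasLead (s • bigBasis q i) i := ⟨s, hs, 0, Submodule.zero_mem _, (add_zero _).symm⟩

theorem HasLead.basis (i : (ℤ × ℤ) × (ℤ × ℤ)) : HasLead (bigBasis q i) i :=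
  ⟨1, one_ne_zero, 0, Submodule.zero_mem _, by rw [one_smul, add_zero]⟩

theorem HasLead.pow {x : YY (q ^ 2) ⊗[k] YY q} {i : (ℤ × ℤ) × (ℤ × ℤ)}
    (hx : HasLead x i) (n : ℕ) : HasLead (x ^ n) (n • i) := by
  induction n with
  | zero =>
    rw [pow_zero, zero_smul, ← (big_isTwisted q).one]
    exact HasLead.basis 0
  | succ n ih =>
    rw [pow_succ, succ_nsmul]
    exact ih.mul hx

/-- The exponent of the leading monomial of `Xᵃ Yᵇ Eᶜ Kⁱ`. -/
def leadExp (j : ℕ × ℕ × ℕ × ℤ) : (ℤ × ℤ) × (ℤ × ℤ) :=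
  ((j.1, j.2.2.1), (-j.1 + j.2.1 - 2 * j.2.2.1, -j.1 + j.2.2.1 + j.2.2.2))

theorem leadExp_injective : Function.Injective leadExp := by
  rintro ⟨a, b, c, i⟩ ⟨a', b', c', i'⟩ h
  simp only [leadExp, Prod.mk.injEq] at h
  obtain ⟨⟨h1, h2⟩, h3, h4⟩ := h
  simp only [Prod.mk.injEq]
  omega

theorem bigHom_gX : bigHom hq (gX q) = (q : k)⁻¹ • bigBasis q ((1, 0), (-1, -1)) := by
  rw [bigHom, torusHom_gX, yyY_eq, tm_yyBasis]

theorem bigHom_phi : bigHom hq (phi q) = (q : k) • bigBasis q ((0, 1), (-1, 1)) := by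
  rw [bigHom, torusHom_phi, yyK_eq, tm_yyBasis]

theorem bigHom_gY : bigHom hq (gY q) = bigBasis q (0, (1, 0)) := by
  rw [bigHom, torusHom_gY, tm_one_eq]

theorem bigHom_Kz (n : ℤ) : bigHom hq (Kz q n) = bigBasis q (0, (0, n)) := by
  rw [bigHom, torusHom_Kz, tm_one_eq]

theorem hasLead_gE : HasLead (bigHom hq (gE q)) ((0, 1), (-2, 1)) := by
  refine ⟨((q : k)⁻¹ - q)⁻¹ * q, mul_ne_zero (inv_ne_zero (inv_sub_self_ne_zero hq)) q.ne_zero,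
    -(((q : k)⁻¹ - q)⁻¹ * (q : k)⁻¹) • bigBasis q ((1, 0), (-2, -1)), ?_, ?_⟩
  · exact Submodule.smul_mem _ _ (bigBasis_mem_lowDeg zero_lt_one)
  · rw [bigHom, torusHom_gE, yyK_eq, yyY_eq, tm_yyBasis, tm_yyBasis]
    module

theorem hasLead_gX : HasLead (bigHom hq (gX q)) ((1, 0), (-1, -1)) :=
  bigHom_gX hq ▸ HasLead.of_smul _ (inv_ne_zero q.ne_zero)

theorem hasLead_gY : HasLead (bigHom hq (gY q)) (0, (1, 0)) :=
  bigHom_gY hq ▸ HasLead.basis _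

theorem hasLead_Kz (n : ℤ) : HasLead (bigHom hq (Kz q n)) (0, (0, n)) :=
  bigHom_Kz hq n ▸ HasLead.basis _

theorem hasLead_mono (j : ℕ × ℕ × ℕ × ℤ) : HasLead (bigHom hq (mono q j)) (leadExp j) := by
  have h := ((hasLead_gX hq).pow j.1).mul (((hasLead_gY hq).pow j.2.1).mul
    (((hasLead_gE hq).pow j.2.2.1).mul (hasLead_Kz hq j.2.2.2)))
  simp only [mono, map_mul, map_pow]
  convert h using 1
  ext <;> simp [leadExp] <;> ring

/-- The image of E is a combination of a Z-term and a C-term, and only the first has positive degree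
in Z. So the monomials XᵃYᵇEᶜKⁱ have distinct leading terms of degree c, and the system is
triangular with respect to c. -/
theorem bigHom_injective : Function.Injective (bigHom hq) := by
  refine linearMap_injective_of_triangular (bigHom hq).toLinearMap (mono q) (span_mono q)
    (fun j => (bigBasis q).coord (leadExp j)) (fun j => j.2.2.1) ?_ ?_
  · intro i
    obtain ⟨s, hs, f, hf, h⟩ := hasLead_mono hq i
    change (bigBasis q).repr (bigHom hq (mono q i)) (leadExp i) ≠ 0
    rw [h, map_add, map_smul, Finsupp.add_apply, repr_lowDeg hf le_rfl, Module.Basis.repr_self,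
      add_zero, Finsupp.smul_apply, Finsupp.single_eq_same, smul_eq_mul, mul_one]
    exact hs
  · intro i j hij hne
    obtain ⟨s, hs, f, hf, h⟩ := hasLead_mono hq j
    change (bigBasis q).repr (bigHom hq (mono q j)) (leadExp i) = 0
    rw [h, map_add, map_smul, Finsupp.add_apply, repr_lowDeg hf (by simpa [leadExp] using hij),
      Module.Basis.repr_self, add_zero, Finsupp.smul_apply, Finsupp.single_eq_of_ne, smul_zero]
    exact fun h2 => hne (leadExp_injective h2).symm


end Four

end

end QAge

namespace QAge

noncomputable section

open scoped TensorProduct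
open OreLocalization (OreSet)

/-! Normal elements and denominator sets -/

section Normal

variable {k : Type*} [Field k] {q : kˣ} {B : Type*} [Ring B] [Algebra k B]

/-- Commuting up to scalars with the generators suffices for the normality relation, since that
relation is stable under sums and products. The map f allows the argument in quotients of 𝒜. -/
theorem exists_mul_eq_of_gen (f : Alg q →ₐ[k] B) (s : B)
    (h : ∀ x, ∃ c : k, s * f (gen q x) = c • (f (gen q x) * s)) (r : Alg q) :
    ∃ r', s * f r = f r' * s := by
  have hr : r ∈ Algebra.adjoin k (Set.range (gen q)) := adjoin_gen q ▸ Algebra.mem_top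
  induction hr using Algebra.adjoin_induction with
  | mem x hx =>
    obtain ⟨x, rfl⟩ := hx
    obtain ⟨c, hc⟩ := h x
    exact ⟨c • gen q x, by rw [hc, map_smul, smul_mul_assoc]⟩
  | algebraMap c => exact ⟨algebraMap k _ c, by rw [AlgHom.commutes, Algebra.commutes]⟩
  | add x y _ _ hx hy =>
    obtain ⟨x', hx'⟩ := hx
    obtain ⟨y', hy'⟩ := hy
    exact ⟨x' + y', by rw [map_add, map_add, mul_add, add_mul, hx', hy']⟩
  | mul x y _ _ hx hy =>
    obtain ⟨x', hx'⟩ := hx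
    obtain ⟨y', hy'⟩ := hy
    exact ⟨x' * y', by rw [map_mul, map_mul, ← mul_assoc, hx', mul_assoc, hy', mul_assoc]⟩

theorem gX_normal (r : Alg q) : ∃ r', gX q * r = r' * gX q := by
  refine exists_mul_eq_of_gen (AlgHom.id k _) (gX q) (fun x => ?_) r
  cases x with
  | X => exact ⟨1, (one_smul _ _).symm⟩
  | Y => exact ⟨_, gX_mul_gY q⟩
  | E => exact ⟨_, gX_mul_gE q⟩
  | K => exact ⟨_, gX_mul_gK q⟩
  | Kinv => exact ⟨_, mul_eq_inv_smul (by simp) (gKinv_mul_gX q)⟩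

theorem phi_normal (r : Alg q) : ∃ r', phi q * r = r' * phi q := by
  refine exists_mul_eq_of_gen (AlgHom.id k _) (phi q) (fun x => ?_) r
  cases x with
  | X => exact ⟨1, ((one_smul _ _).trans (gX_mul_phi q)).symm⟩
  | Y => exact ⟨_, mul_eq_inv_smul (by simp) (gY_mul_phi q)⟩
  | E => exact ⟨_, mul_eq_inv_smul (by simp) (gE_mul_phi q)⟩
  | K => exact ⟨_, mul_eq_inv_smul (by simp) (gK_mul_phi q)⟩
  | Kinv => exact ⟨_, mul_eq_inv_smul (by simp) (gKinv_mul_phi q)⟩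

/-- Y does not commute with E up to a scalar, but the correction term in EYⁿ⁺¹ is a multiple of XYⁿ.
One additional power of Y on the left therefore leaves Yⁿ on the right. -/
theorem gY_pow_ore (r : Alg q) (n : ℕ) : ∃ m r', gY q ^ m * r = r' * gY q ^ n := by
  have hr : r ∈ Algebra.adjoin k (Set.range (gen q)) := adjoin_gen q ▸ Algebra.mem_top
  have hc : ∀ (x : Alg q) (c : k), gY q * x = c • (x * gY q) →
      ∃ m r', gY q ^ m * x = r' * gY q ^ n := fun x c h =>
    ⟨n, c ^ n • x, by rw [pow_mul_of_mul_eq_smul h, smul_mul_assoc]⟩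
  induction hr using Algebra.adjoin_induction generalizing n with
  | mem x hx =>
    obtain ⟨x, rfl⟩ := hx
    cases x with
    | X => exact hc _ _ (gY_mul_gX q)
    | Y => exact hc _ 1 (one_smul _ _).symm
    | K => exact hc _ _ (gY_mul_gK q)
    | Kinv => exact hc _ _ (mul_eq_inv_smul (by simp) (gKinv_mul_gY q))
    | E =>
      have h := gE_mul_gY_pow q n
      -- This is `gE_mul_gY_pow` solved for Yⁿ⁺¹E, with Yⁿ factored out on the right.
      refine ⟨n + 1, (((q : k)⁻¹) ^ (n + 1))⁻¹ • (gE q * gY q -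
        (∑ i ∈ Finset.range (n + 1), (((q : k) ^ 2)⁻¹) ^ i) • gX q), ?_⟩
      rw [smul_mul_assoc, sub_mul, smul_mul_assoc, mul_assoc, ← pow_succ', h, add_sub_cancel_left,
        smul_smul, inv_mul_cancel₀ (by simp), one_smul]
  | algebraMap c => exact ⟨n, algebraMap k _ c, (Algebra.commutes _ _).symm⟩
  | add x y _ _ hx hy =>
    obtain ⟨m, x', hx'⟩ := hx n fun y c h => ⟨n, c ^ n • y, by
      rw [pow_mul_of_mul_eq_smul h, smul_mul_assoc]⟩
    obtain ⟨p, y', hy'⟩ := hy n fun y c h => ⟨n, c ^ n • y, by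
      rw [pow_mul_of_mul_eq_smul h, smul_mul_assoc]⟩
    refine ⟨m + p, gY q ^ p * x' + gY q ^ m * y', ?_⟩
    rw [mul_add, add_mul, mul_assoc, mul_assoc, ← hx', ← hy', ← mul_assoc, ← mul_assoc, ← pow_add,
      ← pow_add, add_comm m p]
  | mul x y _ _ hx hy =>
    obtain ⟨m, y', hy'⟩ := hy n fun y c h => ⟨n, c ^ n • y, by
      rw [pow_mul_of_mul_eq_smul h, smul_mul_assoc]⟩
    obtain ⟨p, x', hx'⟩ := hx m fun y c h => ⟨m, c ^ m • y, by
      rw [pow_mul_of_mul_eq_smul h, smul_mul_assoc]⟩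
    exact ⟨p, x' * y', by rw [← mul_assoc, hx', mul_assoc, hy', mul_assoc]⟩

theorem nonempty_oreSet_of_normal {R : Type*} [Ring R] [NoZeroDivisors R] (S : Submonoid R)
    (h : ∀ s ∈ S, ∀ r, ∃ r', s * r = r' * s) : Nonempty (OreSet S) := by
  refine OreLocalization.nonempty_oreSet_iff_of_noZeroDivisors.2 fun r s => ?_
  obtain ⟨r', hr'⟩ := h s s.2 r
  exact ⟨r', s, hr'⟩

/-- The left Ore condition composes along products of denominators, so it need only be checked on
generators of the monoid. -/
theorem nonempty_oreSet_closure {R : Type*} [Ring R] [NoZeroDivisors R] (T : Set R)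
    (h : ∀ t ∈ T, ∀ r, ∃ s ∈ Submonoid.closure T, ∃ r', s * r = r' * t) :
    Nonempty (OreSet (Submonoid.closure T)) := by
  refine OreLocalization.nonempty_oreSet_iff_of_noZeroDivisors.2 ?_
  rintro r ⟨s, hs⟩
  suffices ∃ s' ∈ Submonoid.closure T, ∃ r', s' * r = r' * s by
    obtain ⟨s', hs', r', h'⟩ := this
    exact ⟨r', ⟨s', hs'⟩, h'⟩
  induction hs using Submonoid.closure_induction generalizing r with
  | mem t ht => exact h t ht r
  | one => exact ⟨1, one_mem _, r, by rw [one_mul, mul_one]⟩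
  | mul x y _ _ hx hy =>
    obtain ⟨s, hs, r', h1⟩ := hy r
    obtain ⟨s', hs', r'', h2⟩ := hx r'
    exact ⟨s' * s, mul_mem hs' hs, r'', by rw [mul_assoc, h1, ← mul_assoc, h2, mul_assoc]⟩

end Normal

section Domain

variable {k : Type*} [Field k] {q : kˣ} (hq : ∀ n : ℕ, 0 < n → q ^ n ≠ 1)
include hq

theorem isDomain_alg : IsDomain (Alg q) := (bigHom_injective hq).isDomain (bigHom hq)

theorem oreSet_denX : Nonempty (OreSet (denX q)) := by
  have := isDomain_alg hq
  rw [denX, Submonoid.powers_eq_closure]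
  refine nonempty_oreSet_closure _ ?_
  rintro _ rfl r
  exact ⟨_, Submonoid.subset_closure rfl, gX_normal r⟩

theorem oreSet_denXPhi : Nonempty (OreSet (denXPhi q)) := by
  have := isDomain_alg hq
  refine nonempty_oreSet_closure _ ?_
  rintro _ (rfl | rfl) r
  · exact ⟨_, Submonoid.subset_closure (Or.inl rfl), gX_normal r⟩
  · exact ⟨_, Submonoid.subset_closure (Or.inr rfl), phi_normal r⟩

theorem oreSet_denXY : Nonempty (OreSet (denXY q)) := by
  have := isDomain_alg hq
  refine nonempty_oreSet_closure _ ?_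
  rintro _ (rfl | rfl) r
  · exact ⟨_, Submonoid.subset_closure (Or.inl rfl), gX_normal r⟩
  · obtain ⟨m, r', h⟩ := gY_pow_ore r 1
    have hY : gY q ∈ denXY q := Submonoid.subset_closure (Or.inr rfl)
    exact ⟨gY q ^ m, pow_mem hY m, r', by rw [h, pow_one]⟩

theorem oreSet_denPhiY : Nonempty (OreSet (denPhiY q)) := by
  have := isDomain_alg hq
  refine nonempty_oreSet_closure _ ?_
  rintro _ (rfl | rfl) r
  · exact ⟨_, Submonoid.subset_closure (Or.inl rfl), phi_normal r⟩
  · obtain ⟨m, r', h⟩ := gY_pow_ore r 1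
    have hY : gY q ∈ denPhiY q := Submonoid.subset_closure (Or.inr rfl)
    exact ⟨gY q ^ m, pow_mem hY m, r', by rw [h, pow_one]⟩

end Domain

/-! Elements acting as scaled basis vectors -/

section Scaled

variable {k S G : Type*} [Field k] [Ring S] [Algebra k S] [AddCommGroup G]
  {b : Module.Basis G k S} {ω : G → G → k}

/-- The element `x` is a nonzero multiple of the basis vector `b i`. -/
def IsScaled (b : Module.Basis G k S) (x : S) (i : G) : Prop := ∃ s : k, s ≠ 0 ∧ x = s • b i

theorem IsScaled.mul (h : IsTwisted b ω) {x y : S} {i j : G} (hx : IsScaled b x i)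
    (hy : IsScaled b y j) : IsScaled b (x * y) (i + j) := by
  obtain ⟨s, hs, rfl⟩ := hx
  obtain ⟨t, ht, rfl⟩ := hy
  exact ⟨s * t * ω i j, mul_ne_zero (mul_ne_zero hs ht) (h.ne_zero _ _), by
    rw [smul_mul_smul_comm, h.mul, smul_smul]⟩

omit [AddCommGroup G] in
theorem IsScaled.basis (i : G) : IsScaled b (b i) i := ⟨1, one_ne_zero, (one_smul _ _).symm⟩

theorem IsScaled.pow (h : IsTwisted b ω) {x : S} {i : G} (hx : IsScaled b x i) (n : ℕ) :
    IsScaled b (x ^ n) (n • i) := by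
  induction n with
  | zero => exact ⟨1, one_ne_zero, by rw [pow_zero, zero_smul, h.one, one_smul]⟩
  | succ n ih =>
    rw [pow_succ, succ_nsmul]
    exact ih.mul h hx

theorem IsScaled.isUnit (h : IsTwisted b ω) {x : S} {i : G} (hx : IsScaled b x i) : IsUnit x := by
  obtain ⟨s, hs, rfl⟩ := hx
  rw [Algebra.smul_def]
  exact ((IsUnit.mk0 s hs).map (algebraMap k S)).mul (h.isUnit i)

variable {R : Type*} [Ring R] [Algebra k R]

/-- Denominators can be cleared by powers of `w` if this holds for the basis vectors. -/
theorem exists_pow_mul_eq (f : R →ₐ[k] S) (w : R) (h : IsTwisted b ω) {i₀ : G}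
    (hw : IsScaled b (f w) i₀) {P : G → Prop} (hP : ∀ i, P i → ∃ a, IsScaled b (f a) i)
    (hn : ∀ i, ∃ n : ℕ, P (n • i₀ + i)) (t : S) : ∃ n : ℕ, ∃ a, f w ^ n * t = f a := by
  have ht : t ∈ Submodule.span k (Set.range b) := b.span_eq ▸ Submodule.mem_top
  induction ht using Submodule.span_induction with
  | zero => exact ⟨0, 0, by simp⟩
  | add x y _ _ hx hy =>
    obtain ⟨n, a, ha⟩ := hx
    obtain ⟨m, c, hc⟩ := hy
    refine ⟨m + n, w ^ m * a + w ^ n * c, ?_⟩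
    rw [map_add, map_mul, map_mul, map_pow, map_pow, ← ha, ← hc, mul_add, ← mul_assoc, ← mul_assoc,
      ← pow_add, ← pow_add, add_comm n m]
  | smul c x _ hx =>
    obtain ⟨n, a, ha⟩ := hx
    exact ⟨n, c • a, by rw [mul_smul_comm, ha, map_smul]⟩
  | mem x hx =>
    obtain ⟨i, rfl⟩ := hx
    obtain ⟨n, hn⟩ := hn i
    obtain ⟨a, s, hs, ha⟩ := hP _ hn
    obtain ⟨t, ht, h1⟩ := (hw.pow h n).mul h (IsScaled.basis (b := b) i)
    exact ⟨n, (t * s⁻¹) • a, by rw [h1, map_smul, ha, smul_smul, inv_mul_cancel_right₀ hs]⟩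

theorem exists_mul_pow_eq (f : R →ₐ[k] S) (w : R) (h : IsTwisted b ω) {i₀ : G}
    (hw : IsScaled b (f w) i₀) {P : G → Prop} (hP : ∀ i, P i → ∃ a, IsScaled b (f a) i)
    (hn : ∀ i, ∃ n : ℕ, P (n • i₀ + i)) (t : S) : ∃ n : ℕ, ∃ a, t * f w ^ n = f a := by
  have ht : t ∈ Submodule.span k (Set.range b) := b.span_eq ▸ Submodule.mem_top
  induction ht using Submodule.span_induction with
  | zero => exact ⟨0, 0, by simp⟩
  | add x y _ _ hx hy =>
    obtain ⟨n, a, ha⟩ := hx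
    obtain ⟨m, c, hc⟩ := hy
    refine ⟨n + m, a * w ^ m + c * w ^ n, ?_⟩
    rw [map_add, map_mul, map_mul, map_pow, map_pow, ← ha, ← hc, add_mul, mul_assoc, mul_assoc,
      ← pow_add, ← pow_add, add_comm m n]
  | smul c x _ hx =>
    obtain ⟨n, a, ha⟩ := hx
    exact ⟨n, c • a, by rw [smul_mul_assoc, ha, map_smul]⟩
  | mem x hx =>
    obtain ⟨i, rfl⟩ := hx
    obtain ⟨n, hn⟩ := hn i
    obtain ⟨a, s, hs, ha⟩ := hP _ hn
    obtain ⟨t, ht, h1⟩ := (IsScaled.basis (b := b) i).mul h (hw.pow h n)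
    refine ⟨n, (t * s⁻¹) • a, ?_⟩
    rw [h1, map_smul, ha, smul_smul, inv_mul_cancel_right₀ hs, add_comm]

end Scaled

/-! ### Simplicity of 𝒜 after inverting X and φ -/

section Simplicity

variable {k : Type*} [Field k] {q : kˣ} (hq : ∀ n : ℕ, 0 < n → q ^ n ≠ 1)
include hq

theorem isScaled_gX : IsScaled (bigBasis q) (bigHom hq (gX q)) ((1, 0), (-1, -1)) :=
  ⟨_, inv_ne_zero q.ne_zero, bigHom_gX hq⟩

theorem isScaled_phi : IsScaled (bigBasis q) (bigHom hq (phi q)) ((0, 1), (-1, 1)) :=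
  ⟨_, q.ne_zero, bigHom_phi hq⟩

theorem isScaled_gY : IsScaled (bigBasis q) (bigHom hq (gY q)) (0, (1, 0)) :=
  bigHom_gY hq ▸ IsScaled.basis _

theorem isScaled_Kz (n : ℤ) : IsScaled (bigBasis q) (bigHom hq (Kz q n)) (0, (0, n)) :=
  bigHom_Kz hq n ▸ IsScaled.basis _

theorem isScaled_prod : IsScaled (bigBasis q) (bigHom hq (gX q * phi q * gY q))
    ((1, 1), (-1, 0)) := by
  have h := ((isScaled_gX hq).mul (big_isTwisted q) (isScaled_phi hq)).mul (big_isTwisted q)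
    (isScaled_gY hq)
  rw [map_mul, map_mul]
  exact h

/-- The element XᵃφᵇYⁿ maps to a multiple of CᵃZᵇYⁿ⁻ᵃ⁻ᵇKᵇ⁻ᵃ. Hence the exponents of C and Z must be
nonnegative and the exponent of Y may drop to -(a + b); K is free. -/
theorem exists_isScaled (i : (ℤ × ℤ) × (ℤ × ℤ))
    (hi : 0 ≤ i.1.1 ∧ 0 ≤ i.1.2 ∧ 0 ≤ i.2.1 + i.1.1 + i.1.2) :
    ∃ a, IsScaled (bigBasis q) (bigHom hq a) i := by
  obtain ⟨⟨a, b⟩, c, d⟩ := i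
  obtain ⟨h1, h2, h3⟩ := hi
  simp only at h1 h2 h3
  obtain ⟨n, hn⟩ := Int.eq_ofNat_of_zero_le h3
  lift a to ℕ using h1
  lift b to ℕ using h2
  have ht := big_isTwisted q
  have h := (((isScaled_gX hq).pow ht a).mul ht ((isScaled_phi hq).pow ht b)).mul ht
    (((isScaled_gY hq).pow ht n).mul ht (isScaled_Kz hq (d + a - b)))
  refine ⟨gX q ^ a * phi q ^ b * (gY q ^ n * Kz q (d + a - b)), ?_⟩
  simp only [map_mul, map_pow]
  convert h using 1
  ext <;> simp <;> omega

omit hq in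
-- This explains the denominator w = XφY: multiplication by its image raises each of the three
-- quantities required to be nonnegative by exactly one.
theorem exists_shift (i : (ℤ × ℤ) × (ℤ × ℤ)) : ∃ n : ℕ,
    0 ≤ (n • (((1, 1), (-1, 0)) : (ℤ × ℤ) × (ℤ × ℤ)) + i).1.1 ∧
    0 ≤ (n • (((1, 1), (-1, 0)) : (ℤ × ℤ) × (ℤ × ℤ)) + i).1.2 ∧
    0 ≤ (n • (((1, 1), (-1, 0)) : (ℤ × ℤ) × (ℤ × ℤ)) + i).2.1 +
      (n • (((1, 1), (-1, 0)) : (ℤ × ℤ) × (ℤ × ℤ)) + i).1.1 +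
      (n • (((1, 1), (-1, 0)) : (ℤ × ℤ) × (ℤ × ℤ)) + i).1.2 := by
  refine ⟨i.1.1.natAbs + i.1.2.natAbs + i.2.1.natAbs, ?_⟩
  simp [-Nat.cast_natAbs]
  omega

/-- A nonzero J extends to a nonzero ideal of the simple torus of rank four, so 1 lies in the
extension and a power of w = XφY lies in J. Cancelling X and φ leaves a power of Y, and commuting it
with E lowers the power down to 1. -/
theorem eq_top_of_cancel (J : TwoSidedIdeal (Alg q)) (hX : ∀ b, gX q * b ∈ J → b ∈ J)
    (hphi : ∀ b, phi q * b ∈ J → b ∈ J) (hJ : J ≠ ⊥) : J = ⊤ := by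
  set w := gX q * phi q * gY q with hw
  have hsimple : IsSimpleRing (YY (q ^ 2) ⊗[k] YY q) := isSimpleRing_tensor₂ hq fun n hn h =>
    hq (2 * n) (by omega) (by rw [pow_mul, h])
  obtain ⟨J', hJ'⟩ := exists_extension (bigHom hq) w
    (exists_pow_mul_eq (bigHom hq) w (big_isTwisted q) (isScaled_prod hq) (exists_isScaled hq)
      exists_shift)
    (exists_mul_pow_eq (bigHom hq) w (big_isTwisted q) (isScaled_prod hq) (exists_isScaled hq)
      exists_shift) ((isScaled_prod hq).isUnit (big_isTwisted q)) J
  have hbot : J' ≠ ⊥ := by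
    rintro rfl
    refine hJ (eq_bot_iff.2 fun x hx => ?_)
    have h1 : bigHom hq x ∈ (⊥ : TwoSidedIdeal (YY (q ^ 2) ⊗[k] YY q)) :=
      (hJ' _).2 ⟨0, 0, x, hx, by simp⟩
    rw [TwoSidedIdeal.mem_bot] at h1 ⊢
    exact bigHom_injective hq (h1.trans (map_zero _).symm)
  have htop : J' = ⊤ := (eq_bot_or_eq_top J').resolve_left hbot
  obtain ⟨n, m, a, ha, h1⟩ := (hJ' 1).1 (htop ▸ trivial)
  -- The extension contains 1, which means that the image of wⁿ⁺ᵐ is the image of an element of J;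
  -- the embedding is injective.
  have h2 : w ^ (n + m) ∈ J := by
    rw [mul_one, ← pow_add, ← map_pow] at h1
    rwa [bigHom_injective hq h1]
  -- The prefix Yᶜ is needed for the induction: it is carried past X and φ up to a scalar, and each
  -- cancelled factor w adds one Y to it.
  have h3 : ∀ p c : ℕ, gY q ^ c * w ^ p ∈ J → gY q ^ (c + p) ∈ J := by
    intro p
    induction p with
    | zero => intro c h; simpa using h
    | succ p ih =>
      intro c h
      have h4 := pow_mul_of_mul_eq_smul (gY_mul_gX q) c
      have h5 := pow_mul_of_mul_eq_smul (gY_mul_phi q) c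
      have h8 : gY q ^ c * w = ((q : k)⁻¹ ^ c * (q : k) ^ c) • (gX q * (phi q * gY q ^ (c + 1))) := by
        rw [hw, ← mul_assoc, ← mul_assoc, h4, smul_mul_assoc, mul_assoc (gX q), h5, mul_smul_comm,
          smul_smul, smul_mul_assoc, mul_assoc, mul_assoc, pow_succ]
      rw [pow_succ', ← mul_assoc, h8, smul_mul_assoc, mul_assoc, mul_assoc, Algebra.smul_def] at h
      have h6 := J.mul_mem_left (algebraMap k _ (((q : k)⁻¹ ^ c * (q : k) ^ c)⁻¹)) _ h
      rw [← mul_assoc, ← map_mul, inv_mul_cancel₀ (by simp), map_one, one_mul] at h6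
      have h7 := ih (c + 1) (hphi _ (hX _ h6))
      rwa [add_assoc, add_comm 1 p] at h7
  -- Both EYᶜ⁺¹ and Yᶜ⁺¹E lie in J. Their combination in `gE_mul_gY_pow` leaves a nonzero multiple
  -- of XYᶜ, from which X is cancelled.
  have h4 : ∀ c : ℕ, gY q ^ c ∈ J → (1 : Alg q) ∈ J := by
    intro c
    induction c with
    | zero => intro h; simpa using h
    | succ c ih =>
      intro h
      have h5 := gE_mul_gY_pow q c
      have h6 := J.sub_mem (J.mul_mem_left (gE q) _ h)
        (J.mul_mem_left (algebraMap k _ (((q : k)⁻¹) ^ (c + 1))) _ (J.mul_mem_right _ (gE q) h))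
      rw [h5, ← Algebra.smul_def, add_sub_cancel_right] at h6
      have h7 := J.mul_mem_left (algebraMap k _
        (∑ i ∈ Finset.range (c + 1), (((q : k) ^ 2)⁻¹) ^ i)⁻¹) _ h6
      rw [← Algebra.smul_def, smul_smul, inv_mul_cancel₀ (sum_geom_ne_zero hq c), one_smul] at h7
      exact ih (hX _ h7)
  refine eq_top_of_one_mem (h4 (n + m) ?_)
  simpa using h3 (n + m) 0 (by simpa using h2)

theorem IsPrimeIdeal.eq_bot {P : TwoSidedIdeal (Alg q)} (hP : IsPrimeIdeal P)
    (hX : gX q ∉ P) (hphi : phi q ∉ P) : P = ⊥ := by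
  by_contra h
  refine hP.1 (eq_top_of_cancel hq P (fun b hb => ?_) (fun b hb => ?_) h)
  · refine hP.mem_of_normal_mul_mem hX (fun r => ?_) hb
    obtain ⟨r', h'⟩ := gX_normal r
    exact ⟨r', by rw [h', sub_self]; exact P.zero_mem⟩
  · refine hP.mem_of_normal_mul_mem hphi (fun r => ?_) hb
    obtain ⟨r', h'⟩ := phi_normal r
    exact ⟨r', by rw [h', sub_self]; exact P.zero_mem⟩

/-- X and φ are units in the localization, so they cancel modulo the contraction of any ideal I. If
I ≠ 0 this contraction is nonzero, hence everything by `eq_top_of_cancel`; so the localization is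
simple. -/
theorem contr_loc_denXPhi [OreSet (denXPhi q)] : contr (loc k (denXPhi q)) = {⊥} := by
  have hu : ∀ s ∈ denXPhi q, IsUnit (bigHom hq s) := by
    intro s hs
    induction hs using Submonoid.closure_induction with
    | mem s hs =>
      rcases hs with rfl | rfl
      · exact (isScaled_gX hq).isUnit (big_isTwisted q)
      · exact (isScaled_phi hq).isUnit (big_isTwisted q)
    | one => rw [map_one]; exact isUnit_one
    | mul x y _ _ hx hy => rw [map_mul]; exact hx.mul hy
  obtain ⟨g, hg⟩ := exists_locLift (denXPhi q) (bigHom hq) hu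
  have hinj : Function.Injective g := by
    rw [injective_iff_map_eq_zero]
    intro x hx
    obtain ⟨s, hs, a, ha⟩ := loc_surj (k := k) (denXPhi q) x
    have h1 := congrArg g ha
    rw [map_mul, hx, mul_zero, hg] at h1
    rw [bigHom_injective hq (h1.symm.trans (map_zero _).symm), map_zero] at ha
    exact ((loc_isUnit (k := k) _ hs).mul_right_eq_zero).1 ha
  have hdom : IsDomain (OreLocalization (denXPhi q) (Alg q)) := hinj.isDomain g
  have hsimple : IsSimpleRing (OreLocalization (denXPhi q) (Alg q)) := by
    refine ⟨⟨fun I => ?_⟩⟩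
    by_cases hI : I = ⊥
    · exact Or.inl hI
    · right
      have hcancel : ∀ s ∈ denXPhi q, ∀ b, s * b ∈ TwoSidedIdeal.comap (loc k (denXPhi q)) I →
          b ∈ TwoSidedIdeal.comap (loc k (denXPhi q)) I := by
        intro s hs b hb
        rw [TwoSidedIdeal.mem_comap, map_mul] at hb
        obtain ⟨u, hu⟩ := loc_isUnit (k := k) _ hs
        have := I.mul_mem_left (↑u⁻¹) _ hb
        rw [TwoSidedIdeal.mem_comap]
        rwa [← hu, Units.inv_mul_cancel_left] at this
      have htop := eq_top_of_cancel hq (TwoSidedIdeal.comap (loc k (denXPhi q)) I)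
        (hcancel _ (Submonoid.subset_closure (Or.inl rfl)))
        (hcancel _ (Submonoid.subset_closure (Or.inr rfl))) (by
          intro hbot
          refine hI (eq_bot_iff.2 fun x hx => ?_)
          obtain ⟨s, hs, a, ha⟩ := loc_surj (k := k) (denXPhi q) x
          have h1 : a ∈ TwoSidedIdeal.comap (loc k (denXPhi q)) I := by
            rw [TwoSidedIdeal.mem_comap, ← ha]
            exact I.mul_mem_left _ _ hx
          rw [hbot, TwoSidedIdeal.mem_bot] at h1
          rw [h1, map_zero] at ha
          rw [TwoSidedIdeal.mem_bot]
          exact ((loc_isUnit (k := k) _ hs).mul_right_eq_zero).1 ha)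
      have h1 : (1 : Alg q) ∈ TwoSidedIdeal.comap (loc k (denXPhi q)) I := htop ▸ trivial
      rw [TwoSidedIdeal.mem_comap, map_one] at h1
      exact eq_top_of_one_mem h1
  refine contr_eq_singleton _ _ fun a => ?_
  rw [TwoSidedIdeal.mem_bot, ← map_eq_zero_iff g hinj, hg,
    map_eq_zero_iff _ (bigHom_injective hq)]

end Simplicity

end

end QAge

namespace QAge

noncomputable section

open scoped TensorProduct

/-! Primes that survive in an overring -/

section Contraction

variable {k R B : Type*} [Field k] [Ring R] [Algebra k R] [Ring B] [Algebra k B]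

/-- Extend P by powers of h on both sides. Cancellation makes the extension J contract back to P,
and J is prime because an ideal of B whose contraction lies in P lies in J. -/
theorem mem_contr_of_cancel (g : R →ₐ[k] B) (h : R)
    (hl : ∀ t, ∃ n : ℕ, ∃ a, g h ^ n * t = g a) (hr : ∀ t, ∃ n : ℕ, ∃ a, t * g h ^ n = g a)
    (hu : IsUnit (g h)) {P : TwoSidedIdeal R} (hP : IsPrimeIdeal P)
    (hker : ∀ a, g a = 0 → a ∈ P) (hcl : ∀ b, h * b ∈ P → b ∈ P)
    (hcr : ∀ b, b * h ∈ P → b ∈ P) : P ∈ contr g := by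
  obtain ⟨J, hJ⟩ := exists_extension g h hl hr hu P
  have hpl : ∀ (n : ℕ) b, h ^ n * b ∈ P → b ∈ P := by
    intro n
    induction n with
    | zero => intro b hb; simpa using hb
    | succ n ih => intro b hb; exact hcl _ (ih _ (by rwa [← mul_assoc, ← pow_succ]))
  have hpr : ∀ (n : ℕ) b, b * h ^ n ∈ P → b ∈ P := by
    intro n
    induction n with
    | zero => intro b hb; simpa using hb
    | succ n ih => intro b hb; exact hcr _ (ih _ (by rwa [mul_assoc, ← pow_succ']))
  have hcomap : TwoSidedIdeal.comap g J = P := by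
    ext b
    rw [TwoSidedIdeal.mem_comap, hJ]
    constructor
    · rintro ⟨n, m, a, ha, h1⟩
      have h2 : h ^ n * b * h ^ m - a ∈ P := hker _ (by simp [h1])
      exact hpl n _ (hpr m _ (by simpa using P.add_mem h2 ha))
    · exact fun hb => ⟨0, 0, b, hb, by simp⟩
  refine ⟨J, ⟨?_, fun I₁ I₂ h12 => ?_⟩, hcomap⟩
  · rintro rfl
    exact hP.1 (hcomap.symm.trans (eq_top_of_one_mem (by
      rw [TwoSidedIdeal.mem_comap]; trivial)))
  · have key : ∀ I : TwoSidedIdeal B, TwoSidedIdeal.comap g I ≤ P → I ≤ J := by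
      intro I hI x hx
      obtain ⟨n, a, ha⟩ := hl x
      refine (hJ x).2 ⟨n, 0, a, hI ?_, by simp [ha]⟩
      rw [TwoSidedIdeal.mem_comap, ← ha]
      exact I.mul_mem_left _ _ hx
    refine (hP.2 (TwoSidedIdeal.comap g I₁) (TwoSidedIdeal.comap g I₂) ?_).imp (key I₁) (key I₂)
    intro a ha b hb
    rw [TwoSidedIdeal.mem_comap] at ha hb
    rw [← hcomap, TwoSidedIdeal.mem_comap, map_mul]
    exact h12 _ ha _ hb

/-- The kernel of an epimorphism onto a simple ring is a maximal ideal. -/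
theorem isCoatom_of_surjective [IsSimpleRing B] {I : TwoSidedIdeal R} (f : R →ₐ[k] B)
    (hf : Function.Surjective f) (h : ∀ a, f a = 0 ↔ a ∈ I) : IsCoatom I := by
  refine ⟨fun h1 => ?_, fun J hIJ => ?_⟩
  · have h2 : (1 : R) ∈ I := h1 ▸ trivial
    rw [← h, map_one] at h2
    exact one_ne_zero h2
  · obtain ⟨hle, x, hx, hxI⟩ := SetLike.lt_iff_le_and_exists.1 hIJ
    -- With denominator 1, `exists_extension` gives the image of J under the surjection f.
    obtain ⟨K, hK⟩ := exists_extension f (1 : R) (fun t => ⟨0, by simpa [eq_comm] using hf t⟩)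
      (fun t => ⟨0, by simpa [eq_comm] using hf t⟩) (by simp) J
    have hKx : f x ∈ K := (hK _).2 ⟨0, 0, x, hx, by simp⟩
    have hKtop : K = ⊤ := (eq_bot_or_eq_top K).resolve_left fun hb => by
      rw [hb, TwoSidedIdeal.mem_bot, h] at hKx
      exact hxI hKx
    have h1 : (1 : B) ∈ K := hKtop ▸ trivial
    obtain ⟨n, m, a, ha, h2⟩ := (hK 1).1 h1
    have h3 : (1 : R) - a ∈ I := by
      rw [← h, map_sub, ← h2]
      simp
    exact eq_top_of_one_mem (by simpa using J.add_mem (hle h3) ha)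

end Contraction

/-! The two families of epimorphisms -/

section Chart

variable {k : Type*} [Field k] (q : kˣ)

/-- The normal elements `X` and `φ`. -/
def nrm : Bool → Alg q
  | true => gX q
  | false => phi q

/-- The elements `Z` and `C`, central modulo `X` and `φ` respectively. -/
def cen : Bool → Alg q
  | true => elZ q
  | false => elC q

/-- The exponents of `K` in the images of `E`. -/
def eps : Bool → ℤ
  | true => 1
  | false => -1

/-- The ideals `(X, 𝔪)` and `(φ, 𝔪)`. -/
def idlNm (i : Bool) (m : Ideal (Polynomial k)) : TwoSidedIdeal (Alg q) :=
  idl q ({nrm q i} ∪ Polynomial.aeval (cen q i) '' (m : Set (Polynomial k)))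

variable {q} (hq : ∀ n : ℕ, 0 < n → q ^ n ≠ 1)

section Comm

variable {W : Type*} [CommRing W] [Algebra k W] (i : Bool) (t : W)

/-- The homomorphism from `𝒜` to `W ⊗ 𝕐` with `X ↦ 0`, `Z ↦ t` or `φ ↦ 0`, `C ↦ t`. -/
def chart : Bool → (Alg q →ₐ[k] W ⊗[k] YY q)
  | true => torusHom hq (C := 0) (Z := t) (by simp)
  | false => torusHom hq (C := t) (Z := 0) (by simp)

theorem chart_nrm : chart hq t i (nrm q i) = 0 := by
  cases i <;> simp [chart, nrm, torusHom_gX, torusHom_phi, tm_zero]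

theorem chart_cen : chart hq t i (cen q i) = t ⊗ₜ 1 := by
  cases i <;> simp [chart, cen, torusHom_elZ, torusHom_elC]

theorem chart_gY : chart hq t i (gY q) = tm q 1 1 0 := by
  cases i <;> exact torusHom_gY hq (by simp)

theorem chart_gK : chart hq t i (gK q) = tm q 1 0 1 := by
  cases i <;> exact torusHom_gK hq (by simp)

theorem chart_Kz (n : ℤ) : chart hq t i (Kz q n) = tm q 1 0 n := by
  cases i <;> exact torusHom_Kz hq (by simp) n

theorem chart_gE : ∃ s : k, s ≠ 0 ∧ chart hq t i (gE q) = s • tm q t (-2) (eps i) := by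
  have hl := inv_sub_self_ne_zero hq
  cases i
  · refine ⟨((q : k)⁻¹ - q)⁻¹ * -(q : k)⁻¹, by simp [hl], ?_⟩
    simp [chart, torusHom_gE, tm_zero, eps, smul_smul]
  · refine ⟨((q : k)⁻¹ - q)⁻¹ * (q : k), by simp [hl], ?_⟩
    simp [chart, torusHom_gE, tm_zero, eps, smul_smul]

theorem chart_nrm_not : ∃ s : k, s ≠ 0 ∧ chart hq t i (nrm q !i) = s • tm q t (-1) (eps i) := by
  cases i
  · exact ⟨(q : k)⁻¹, by simp, torusHom_gX hq (by simp)⟩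
  · exact ⟨(q : k), by simp, torusHom_phi hq (by simp)⟩

theorem chart_aeval_cen (p : Polynomial k) :
    chart hq t i (Polynomial.aeval (cen q i) p) = Polynomial.aeval t p ⊗ₜ 1 := by
  rw [← Polynomial.aeval_algHom_apply, chart_cen]
  exact Polynomial.aeval_algHom_apply
    (Algebra.TensorProduct.includeLeft : W →ₐ[k] W ⊗[k] YY q) t p

theorem chart_monoYE (b c : ℕ) (n : ℤ) : ∃ s : k, s ≠ 0 ∧
    chart hq t i (monoYE q ((b, c), n)) = s • tm q (t ^ c) (b - 2 * c) (eps i * c + n) := by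
  obtain ⟨s, hs, h⟩ := chart_gE hq i t
  obtain ⟨s₁, hs₁, h₁⟩ := tm_pow q (1 : W) 1 0 b
  obtain ⟨s₂, hs₂, h₂⟩ := tm_pow q t (-2) (eps i) c
  refine ⟨s ^ c * (s₁ * s₂), by simp [hs, hs₁, hs₂], ?_⟩
  rw [monoYE, map_mul, map_mul, map_pow, map_pow, h, chart_gY, chart_Kz, h₁, smul_pow, h₂,
    smul_mul_assoc, smul_mul_assoc, smul_mul_assoc, tm_mul_tm, mul_smul_comm, mul_smul_comm,
    mul_smul_comm, tm_mul_tm, smul_smul, smul_smul, smul_smul, smul_smul]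
  congr 1
  · simp
    ring
  · congr 1
    · simp
    · ring
    · ring

/-- Naturality in W: reducing k[T, T⁻¹] modulo 𝔪 turns `lau` into `fieldChart`, so questions about
the latter reduce to coefficients of the former. -/
theorem chart_map {W' : Type*} [CommRing W'] [Algebra k W'] (θ : W →ₐ[k] W') (a : Alg q) :
    Algebra.TensorProduct.map θ (AlgHom.id k (YY q)) (chart hq t i a) = chart hq (θ t) i a := by
  have h : (Algebra.TensorProduct.map θ (AlgHom.id k (YY q))).comp (chart hq t i) =
      chart hq (θ t) i := by
    refine algHom_ext_gen fun x => ?_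
    have htm : ∀ w b c, Algebra.TensorProduct.map θ (AlgHom.id k (YY q)) (tm q w b c) =
        tm q (θ w) b c := fun w b c => rfl
    cases i <;> cases x <;>
      simp [chart, torusHom_gen, torusGen, htm, tm_zero, -map_smul, AlgHom.map_smul_of_tower]
  exact DFunLike.congr_fun h a

end Comm

/-- Modulo `X` or `φ`, the generator `X` is a multiple of `Y E`. -/
theorem quo_gX (i : Bool) {I : TwoSidedIdeal (Alg q)} (hI : nrm q i ∈ I) :
    ∃ s : k, quo k I (gX q) = s • (quo k I (gY q) * quo k I (gE q)) := by
  cases i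
  · refine ⟨-((q : k)⁻¹ - q), ?_⟩
    have h : quo k I (phi q) = 0 := (quo_eq_zero_iff I).2 hI
    rw [phi_eq, map_add, map_smul, map_mul] at h
    rw [neg_smul]
    exact eq_neg_of_add_eq_zero_left h
  · exact ⟨0, by rw [zero_smul]; exact (quo_eq_zero_iff I).2 hI⟩

end Chart

end

end QAge

namespace QAge

noncomputable section

open scoped TensorProduct LaurentPolynomial

theorem tmul_one_commute {k S W : Type*} [Field k] [Ring S] [Algebra k S] [Ring W] [Algebra k W]
    {t a : W} (h : t * a = a * t) (b : S) : Commute (t ⊗ₜ[k] (1 : S)) (a ⊗ₜ b) := by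
  rw [Commute, SemiconjBy, Algebra.TensorProduct.tmul_mul_tmul,
    Algebra.TensorProduct.tmul_mul_tmul, h, one_mul, mul_one]

/-! ### Surjectivity of the charts for invertible parameter -/

section Comm

variable {k : Type*} [Field k] {q : kˣ} (hq : ∀ n : ℕ, 0 < n → q ^ n ≠ 1)
  {W : Type*} [CommRing W] [Algebra k W] (i : Bool) (t : W)

theorem commute_chart_cen (x : W ⊗[k] YY q) : Commute (chart hq t i (cen q i)) x := by
  rw [chart_cen]
  induction x using TensorProduct.induction_on with
  | zero => exact Commute.zero_right _
  | tmul a b =>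
    exact tmul_one_commute (mul_comm t a) b
  | add x y hx hy => exact hx.add_right hy

/-- The only obstacle is Y⁻¹. It comes from E, whose image is a multiple of tY⁻²K^ε; the resulting
power of t is removed by the polynomial inverse of t. -/
theorem chart_surjective {t : W} (ht : ∃ p : Polynomial k, Polynomial.aeval t p * t = 1)
    (hW : ∀ w : W, ∃ p : Polynomial k, Polynomial.aeval t p = w) :
    Function.Surjective (chart hq t i) := by
  have h : ∀ w b c, tm q w b c ∈ LinearMap.range (chart hq t i).toLinearMap := by
    intro w b c
    obtain ⟨p, rfl⟩ := hW w
    obtain ⟨r, hr⟩ := ht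
    -- A possibly negative exponent b of Y is realized by YᴺEⁿ. The factor rⁿ below cancels the
    -- power tⁿ brought in by Eⁿ.
    obtain ⟨n, N, hN⟩ : ∃ n N : ℕ, b = N - 2 * n :=
      ⟨b.natAbs, (b + 2 * b.natAbs).toNat, by omega⟩
    obtain ⟨s, hs, h⟩ := chart_monoYE hq i t N n (c - eps i * n)
    refine ⟨s⁻¹ • (Polynomial.aeval (cen q i) (p * r ^ n) * monoYE q ((N, n), c - eps i * n)), ?_⟩
    have h1 : ∀ w : W, w ⊗ₜ[k] (1 : YY q) = tm q w 0 0 := fun w => by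
      rw [tm, ← Prod.zero_eq_mk, (yy_isTwisted q).one]
    rw [AlgHom.toLinearMap_apply, map_smul, map_mul, h, chart_aeval_cen,
      mul_smul_comm, smul_smul, inv_mul_cancel₀ hs, one_smul, ← hN, h1, tm_mul_tm]
    simp only [zero_mul, neg_zero, zpow_zero, one_smul, zero_add]
    congr 1
    · rw [map_mul, map_pow, mul_assoc, ← mul_pow, hr, one_pow, mul_one]
    · ring
  intro x
  have hx : x ∈ LinearMap.range (chart hq t i).toLinearMap := by
    induction x using TensorProduct.induction_on with
    | zero => exact zero_mem _
    | add x y hx hy => exact add_mem hx hy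
    | tmul w y =>
      have hy : y ∈ Submodule.span k (Set.range (yyBasis q)) :=
        (yyBasis q).span_eq ▸ Submodule.mem_top
      induction hy using Submodule.span_induction with
      | zero => rw [TensorProduct.tmul_zero]; exact zero_mem _
      | add x y _ _ hx hy => rw [TensorProduct.tmul_add]; exact add_mem hx hy
      | smul c x _ hx => rw [TensorProduct.tmul_smul]; exact Submodule.smul_mem _ _ hx
      | mem x hx => obtain ⟨j, rfl⟩ := hx; exact h w j.1 j.2
  exact hx

end Comm

/-! ### The charts over k[T, T⁻¹]: kernels, denominators and contracted primes -/

section LaurentChart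

variable {k : Type*} [Field k] (q : kˣ)

/-- The basis `Tᵃ Yᵇ Kᶜ` of `k[T, T⁻¹] ⊗ 𝕐`. -/
def lauBasis : Module.Basis (ℤ × (ℤ × ℤ)) k (LaurentPolynomial k ⊗[k] YY q) :=
  (AddMonoidAlgebra.basis ℤ k).tensorProduct (yyBasis q)

theorem lauBasis_apply (a b c : ℤ) :
    lauBasis q (a, (b, c)) = tm q (LaurentPolynomial.T a : LaurentPolynomial k) b c := by
  rw [lauBasis, Module.Basis.tensorProduct_apply]
  rfl

theorem laurent_isTwisted :
    IsTwisted (AddMonoidAlgebra.basis ℤ k : Module.Basis ℤ k (LaurentPolynomial k))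
      (fun _ _ => (1 : k)) where
  ne_zero _ _ := one_ne_zero
  one := LaurentPolynomial.T_zero
  mul i j := by
    rw [one_smul]
    exact (LaurentPolynomial.T_add i j).symm

theorem lau_isTwisted : IsTwisted (lauBasis q) (fun i j => 1 * yyTwist q i.2 j.2) :=
  laurent_isTwisted.tensorProduct (yy_isTwisted q)

instance isDomain_lau : IsDomain (LaurentPolynomial k ⊗[k] YY q) :=
  isDomain_tensor q (LaurentPolynomial k)

variable {q} (hq : ∀ n : ℕ, 0 < n → q ^ n ≠ 1) (i : Bool)

/-- The homomorphism from `𝒜` to `k[T, T⁻¹] ⊗ 𝕐` with kernel `(X)` or `(φ)`. -/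
def lau : Alg q →ₐ[k] LaurentPolynomial k ⊗[k] YY q :=
  chart hq (LaurentPolynomial.T 1 : LaurentPolynomial k) i

theorem isScaled_lau_monoYE (b c : ℕ) (n : ℤ) :
    IsScaled (lauBasis q) (lau hq i (monoYE q ((b, c), n))) (c, (b - 2 * c, eps i * c + n)) := by
  obtain ⟨s, hs, h⟩ := chart_monoYE hq i (LaurentPolynomial.T 1 : LaurentPolynomial k) b c n
  refine ⟨s, hs, h.trans ?_⟩
  rw [lauBasis_apply, LaurentPolynomial.T_pow, mul_one]

/-- TᵃYᵇKᶜ is hit up to a scalar by Yᵇ⁺²ᵃEᵃ times a power of K, hence the two inequalities. -/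
theorem exists_isScaled_lau (j : ℤ × (ℤ × ℤ)) (hj : 0 ≤ j.1 ∧ 0 ≤ j.2.1 + 2 * j.1) :
    ∃ a, IsScaled (lauBasis q) (lau hq i a) j := by
  obtain ⟨a, b, c⟩ := j
  obtain ⟨h1, h2⟩ := hj
  simp only at h1 h2
  lift a to ℕ using h1
  obtain ⟨n, hn⟩ := Int.eq_ofNat_of_zero_le h2
  have h := isScaled_lau_monoYE hq i n a (c - eps i * a)
  have h3 : ((a : ℤ), ((n : ℤ) - 2 * a, eps i * a + (c - eps i * a))) = ((a : ℤ), (b, c)) := by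
    rw [← hn]
    congr 2 <;> ring
  exact ⟨_, h3 ▸ h⟩

theorem isScaled_lau_cen : IsScaled (lauBasis q) (lau hq i (cen q i)) (1, 0) := by
  refine ⟨1, one_ne_zero, ?_⟩
  rw [lau, chart_cen, one_smul]
  refine Eq.trans ?_ (lauBasis_apply q 1 0 0).symm
  rw [tm, ← Prod.zero_eq_mk, (yy_isTwisted q).one]

theorem isScaled_lau_nrm : IsScaled (lauBasis q) (lau hq i (nrm q !i)) (1, (-1, eps i)) := by
  obtain ⟨s, hs, h⟩ := chart_nrm_not hq i (LaurentPolynomial.T 1 : LaurentPolynomial k)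
  exact ⟨s, hs, h.trans (by rw [lauBasis_apply])⟩

theorem isScaled_lau_gY : IsScaled (lauBasis q) (lau hq i (gY q)) (0, (1, 0)) := by
  refine ⟨1, one_ne_zero, ?_⟩
  rw [lau, chart_gY, one_smul, lauBasis_apply, LaurentPolynomial.T_zero]

/-- Modulo X or φ the monomials YᵇEᶜKⁿ span, and their images are nonzero multiples of distinct
basis monomials TᶜYᵇ⁻²ᶜKᵉᶜ⁺ⁿ, where e = ±1. -/
theorem lau_eq_zero_iff (a : Alg q) : lau hq i a = 0 ↔ a ∈ idl q {nrm q i} := by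
  have h0 : ∀ a ∈ idl q {nrm q i}, lau hq i a = 0 := fun a =>
    map_eq_zero_of_mem_span _ (by rintro _ rfl; exact chart_nrm hq i _)
  refine ⟨fun h => ?_, h0 a⟩
  obtain ⟨s, hs⟩ := quo_gX (I := idl q {nrm q i}) i (TwoSidedIdeal.subset_span rfl)
  have hinj := linearMap_injective_of_span (quoLift _ (lau hq i) h0).toLinearMap
    (fun j => quo k _ (monoYE q j)) (span_monoYE _ (quo_surjective _) s hs) (lauBasis q)
    (fun j => (j.1.2, (j.1.1 - 2 * j.1.2, eps i * j.1.2 + j.2))) (by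
      rintro ⟨⟨b, c⟩, n⟩ ⟨⟨b', c'⟩, n'⟩ h
      simp only [Prod.mk.injEq, Nat.cast_inj] at h
      obtain ⟨rfl, h2, h3⟩ := h
      simp only [Prod.mk.injEq, and_true]
      omega) (fun j => isScaled_lau_monoYE hq i j.1.1 j.1.2 j.2)
  rw [← quo_eq_zero_iff (k := k)]
  exact hinj (h.trans (map_zero _).symm)

theorem lau_pow_cen_mul (t : LaurentPolynomial k ⊗[k] YY q) :
    ∃ n : ℕ, ∃ a, lau hq i (cen q i) ^ n * t = lau hq i a := by
  refine exists_pow_mul_eq (lau hq i) _ (lau_isTwisted q) (isScaled_lau_cen hq i)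
    (exists_isScaled_lau hq i) (fun j => ⟨j.1.natAbs + j.2.1.natAbs, ?_⟩) t
  simp [-Nat.cast_natAbs]
  omega

theorem commute_lau_cen (t : LaurentPolynomial k ⊗[k] YY q) :
    Commute (lau hq i (cen q i)) t := commute_chart_cen hq i _ t

include hq in
-- Centrality of Z modulo X, and of C modulo φ, needs no computation with generators: the image T ⊗
-- 1 is central and the kernel is known.
theorem cen_mul_sub_mem (r : Alg q) : cen q i * r - r * cen q i ∈ idl q {nrm q i} := by
  rw [← lau_eq_zero_iff hq, map_sub, map_mul, map_mul, (commute_lau_cen hq i _).eq, sub_self]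

theorem clears_lau_cen : Clears (lau hq i) (Submonoid.powers (cen q i)) := by
  constructor
  · rintro _ ⟨n, rfl⟩
    rw [map_pow]
    exact ((isScaled_lau_cen hq i).isUnit (lau_isTwisted q)).pow n
  · intro t
    obtain ⟨n, a, h⟩ := lau_pow_cen_mul hq i t
    exact ⟨_, ⟨n, rfl⟩, a, by rw [map_pow, h]⟩

theorem clears_lau_nrm : Clears (lau hq i) (Submonoid.powers (nrm q !i)) := by
  constructor
  · rintro _ ⟨n, rfl⟩
    rw [map_pow]
    exact ((isScaled_lau_nrm hq i).isUnit (lau_isTwisted q)).pow n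
  · intro t
    -- The other normal element has exponents (1, (-1, ±1)), so it raises both a and b + 2a by only
    -- one; hence 2|a| + |b| factors.
    obtain ⟨n, a, h⟩ := exists_pow_mul_eq (lau hq i) _ (lau_isTwisted q) (isScaled_lau_nrm hq i)
      (exists_isScaled_lau hq i) (fun j => ⟨2 * j.1.natAbs + j.2.1.natAbs, by
        simp [-Nat.cast_natAbs]
        omega⟩) t
    exact ⟨_, ⟨n, rfl⟩, a, by rw [map_pow, h]⟩

theorem isUnit_closure {R B : Type*} [Ring R] [Ring B] [Algebra k R] [Algebra k B] (f : R →ₐ[k] B) {s : Set R}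
    (h : ∀ x ∈ s, IsUnit (f x)) : ∀ x ∈ Submonoid.closure s, IsUnit (f x) := by
  intro x hx
  induction hx using Submonoid.closure_induction with
  | mem x hx => exact h x hx
  | one => rw [map_one]; exact isUnit_one
  | mul x y _ _ hx hy => rw [map_mul]; exact hx.mul hy

theorem clears_lau_nrm_gY :
    Clears (lau hq i) (Submonoid.closure {nrm q !i, gY q}) := by
  refine (clears_lau_nrm hq i).mono ?_ (isUnit_closure (lau hq i) ?_)
  · rw [Submonoid.powers_le]
    exact Submonoid.subset_closure (by simp)
  · rintro _ (rfl | rfl)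
    · exact (isScaled_lau_nrm hq i).isUnit (lau_isTwisted q)
    · exact (isScaled_lau_gY hq i).isUnit (lau_isTwisted q)

include hq in
theorem isPrimeIdeal_nrm : IsPrimeIdeal (idl q {nrm q i}) :=
  isPrimeIdeal_of_ker (lau hq i).toRingHom fun a => lau_eq_zero_iff hq i a

/-- A prime ideal containing `X` but not `Z`, or `φ` but not `C`, is a contraction. -/
theorem mem_contr_lau {P : TwoSidedIdeal (Alg q)} (hP : IsPrimeIdeal P) (hn : nrm q i ∈ P)
    (hc : cen q i ∉ P) : P ∈ contr (lau hq i) := by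
  have hle : idl q {nrm q i} ≤ P := TwoSidedIdeal.span_le.2 (by rintro _ rfl; exact hn)
  have hcl : ∀ b, cen q i * b ∈ P → b ∈ P := fun b hb =>
    hP.mem_of_normal_mul_mem hc (fun r => ⟨r, hle (cen_mul_sub_mem hq i r)⟩) hb
  refine mem_contr_of_cancel (lau hq i) (cen q i) (lau_pow_cen_mul hq i) (fun t => ?_)
    ((isScaled_lau_cen hq i).isUnit (lau_isTwisted q)) hP
    (fun a ha => hle ((lau_eq_zero_iff hq i a).1 ha)) hcl (fun b hb => hcl b ?_)
  · obtain ⟨n, a, h⟩ := lau_pow_cen_mul hq i t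
    exact ⟨n, a, by rw [← h, ((commute_lau_cen hq i t).pow_left n).eq]⟩
  · simpa using P.add_mem (hle (cen_mul_sub_mem hq i b)) hb

end LaurentChart

/-! The epimorphisms onto simple rings -/

section FieldChart

variable {k : Type*} [Field k] {q : kˣ} (hq : ∀ n : ℕ, 0 < n → q ^ n ≠ 1) (i : Bool)

theorem MaxNZ.isField (m : MaxNZ k) : IsField (Polynomial k ⧸ m.1.asIdeal) := by
  have := m.1.isMaximal
  exact (Ideal.Quotient.maximal_ideal_iff_isField_quotient _).1 this

theorem MaxNZ.ne_bot (m : MaxNZ k) : m.1.asIdeal ≠ ⊥ := by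
  have h : ¬ IsField (Polynomial k) := Polynomial.not_isField k
  exact Ring.ne_bot_of_isMaximal_of_not_isField m.1.isMaximal h

theorem MaxNZ.finite (m : MaxNZ k) : Module.Finite k (Polynomial k ⧸ m.1.asIdeal) := by
  obtain ⟨p, hp⟩ := IsPrincipalIdealRing.principal m.1.asIdeal
  have h0 : p ≠ 0 := by
    rintro rfl
    exact m.ne_bot (by simpa using hp)
  have h1 : m.1.asIdeal = Ideal.span {p} := hp
  rw [h1]
  exact (AdjoinRoot.powerBasis h0).finite

theorem MaxNZ.X_notMem (m : MaxNZ k) : Polynomial.X ∉ m.1.asIdeal := by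
  intro h
  have h1 : Ideal.span {(Polynomial.X : Polynomial k)} ≤ m.1.asIdeal :=
    (Ideal.span_singleton_le_iff_mem _).2 h
  have h2 : (Ideal.span {(Polynomial.X : Polynomial k)}).IsMaximal :=
    PrincipalIdealRing.isMaximal_of_irreducible Polynomial.irreducible_X
  exact m.2 (h2.eq_of_le m.1.isMaximal.ne_top h1).symm

theorem MaxNZ.exists_inv (m : MaxNZ k) :
    ∃ r : Polynomial k, r * Polynomial.X - 1 ∈ m.1.asIdeal := by
  obtain ⟨y, hy⟩ := m.isField.mul_inv_cancel
    (a := Ideal.Quotient.mk m.1.asIdeal Polynomial.X)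
    (fun h => m.X_notMem (Ideal.Quotient.eq_zero_iff_mem.1 h))
  obtain ⟨r, rfl⟩ := Ideal.Quotient.mk_surjective y
  refine ⟨r, Ideal.Quotient.eq_zero_iff_mem.1 ?_⟩
  rw [map_sub, map_mul, mul_comm, hy, map_one, sub_self]

/-- The homomorphism from `𝒜` to `k[T]/𝔪 ⊗ 𝕐`. -/
def fieldChart (m : MaxNZ k) : Alg q →ₐ[k] (Polynomial k ⧸ m.1.asIdeal) ⊗[k] YY q :=
  chart hq (Ideal.Quotient.mk m.1.asIdeal Polynomial.X) i

theorem aeval_mk (I : Ideal (Polynomial k)) (p : Polynomial k) :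
    Polynomial.aeval (Ideal.Quotient.mk I Polynomial.X) p = Ideal.Quotient.mk I p := by
  rw [← Ideal.Quotient.mkₐ_eq_mk k, Polynomial.aeval_algHom_apply, Polynomial.aeval_X_left_apply]

theorem fieldChart_surjective (m : MaxNZ k) : Function.Surjective (fieldChart hq i m) := by
  refine chart_surjective hq i ?_ fun w => ?_
  · obtain ⟨r, hr⟩ := m.exists_inv
    refine ⟨r, ?_⟩
    rw [aeval_mk, ← map_mul, ← sub_eq_zero, ← map_one (Ideal.Quotient.mk m.1.asIdeal), ← map_sub]
    exact Ideal.Quotient.eq_zero_iff_mem.2 hr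
  · obtain ⟨p, rfl⟩ := Ideal.Quotient.mk_surjective w
    exact ⟨p, aeval_mk _ p⟩

end FieldChart

end

end QAge

namespace QAge

noncomputable section

open scoped TensorProduct

theorem ring_tmul_one_mul_tmul {k S W : Type*} [Field k] [Ring S] [Algebra k S] [Ring W]
    [Algebra k W] (v w : W) (y : S) : (v ⊗ₜ[k] (1 : S)) * (w ⊗ₜ y) = (v * w) ⊗ₜ y := by
  rw [Algebra.TensorProduct.tmul_mul_tmul, one_mul]

theorem tmul_one_mul_tmul {k W : Type*} [Field k] {q : kˣ} [CommRing W] [Algebra k W]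
    (v w : W) (y : YY q) : (v ⊗ₜ[k] (1 : YY q)) * (w ⊗ₜ y) = (v * w) ⊗ₜ y :=
  ring_tmul_one_mul_tmul v w y

theorem one_tmul_one {k S W : Type*} [Field k] [Ring S] [Algebra k S] [Ring W] [Algebra k W] :
    (1 : W) ⊗ₜ[k] (1 : S) = 1 := rfl

/-! ### Coefficients in scalar extensions of 𝕐 -/

section Coefficients

variable {k : Type*} [Field k] (q : kˣ) {A A' : Type*} [CommRing A] [Algebra k A] [CommRing A']
  [Algebra k A']

/-- The coefficients of an element of `A ⊗ 𝕐` in the monomial basis. -/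
def coeffs (x : A ⊗[k] YY q) : (ℤ × ℤ) →₀ A := ((yyBasis q).baseChange A).repr x

theorem sum_coeffs (x : A ⊗[k] YY q) :
    ∑ j ∈ (coeffs q x).support, coeffs q x j ⊗ₜ[k] yyBasis q j = x := by
  refine Eq.trans ?_ (((yyBasis q).baseChange A).linearCombination_repr x)
  refine Finset.sum_congr rfl fun j _ => ?_
  change _ = coeffs q x j • ((yyBasis q).baseChange A) j
  rw [Module.Basis.baseChange_apply, TensorProduct.smul_tmul', smul_eq_mul, mul_one]

theorem coeffs_map (θ : A →ₐ[k] A') (x : A ⊗[k] YY q) (j : ℤ × ℤ) :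
    coeffs q (Algebra.TensorProduct.map θ (AlgHom.id k (YY q)) x) j = θ (coeffs q x j) := by
  induction x using TensorProduct.induction_on with
  | zero => simp [coeffs]
  | tmul a y => simp [coeffs, Module.Basis.baseChange_repr_tmul]
  | add x y hx hy =>
    have h : ∀ {B : Type _} [CommRing B] [Algebra k B] (u v : B ⊗[k] YY q),
        coeffs q (u + v) j = coeffs q u j + coeffs q v j := fun u v => by simp [coeffs]
    have h' : coeffs q (x + y) j = coeffs q x j + coeffs q y j := by simp [coeffs]
    rw [map_add, h, hx, hy, h', map_add]

variable {q} in
theorem coeffs_tmul_one_mem (hq : ∀ n : ℕ, 0 < n → q ^ n ≠ 1) {I : TwoSidedIdeal (A ⊗[k] YY q)}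
    {x : A ⊗[k] YY q} (hx : x ∈ I) (j : ℤ × ℤ) : coeffs q x j ⊗ₜ[k] (1 : YY q) ∈ I :=
  (tensor_isTwisted q A).coeff_mem (yy_sep hq) I hx j

theorem coeffs_eq_zero {x : A ⊗[k] YY q} (h : ∀ j, coeffs q x j = 0) : x = 0 :=
  ((yyBasis q).baseChange A).repr.map_eq_zero_iff.1 (Finsupp.ext h)

end Coefficients

/-! ### Kernels over residue fields and the primes of k[T, T⁻¹] ⊗ 𝕐 -/

section FieldKernel

variable {k : Type*} [Field k]

/-- Evaluation of Laurent polynomials at a unit. -/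
def laurentEval {W : Type*} [CommRing W] [Algebra k W] (u : Wˣ) : LaurentPolynomial k →ₐ[k] W :=
  AddMonoidAlgebra.lift k W ℤ ((Units.coeHom W).comp (zpowersHom Wˣ u))

theorem laurentEval_T {W : Type*} [CommRing W] [Algebra k W] (u : Wˣ) :
    laurentEval u (LaurentPolynomial.T 1 : LaurentPolynomial k) = (u : W) := by
  rw [laurentEval, LaurentPolynomial.T, AddMonoidAlgebra.lift_single, one_smul]
  simp [zpowersHom_apply]

theorem toLaurent_eq_aeval (p : Polynomial k) :
    Polynomial.toLaurent p = Polynomial.aeval (LaurentPolynomial.T 1 : LaurentPolynomial k) p := by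
  have h : Polynomial.toLaurentAlg = Polynomial.aeval (LaurentPolynomial.T 1 : LaurentPolynomial k) := by
    ext
    simp
  rw [← h]
  rfl

theorem MaxNZ.isUnit_mk_X (m : MaxNZ k) : IsUnit (Ideal.Quotient.mk m.1.asIdeal Polynomial.X) := by
  obtain ⟨r, hr⟩ := m.exists_inv
  refine IsUnit.of_mul_eq_one_right (Ideal.Quotient.mk m.1.asIdeal r) ?_
  rw [← map_mul, ← sub_eq_zero, ← map_one (Ideal.Quotient.mk m.1.asIdeal), ← map_sub]
  exact Ideal.Quotient.eq_zero_iff_mem.2 hr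

/-- The reduction `k[T, T⁻¹] → k[T]/𝔪`. -/
def MaxNZ.red (m : MaxNZ k) : LaurentPolynomial k →ₐ[k] Polynomial k ⧸ m.1.asIdeal :=
  laurentEval m.isUnit_mk_X.unit

theorem MaxNZ.red_T (m : MaxNZ k) :
    m.red (LaurentPolynomial.T 1) = Ideal.Quotient.mk m.1.asIdeal Polynomial.X :=
  laurentEval_T _

theorem MaxNZ.red_toLaurent (m : MaxNZ k) (p : Polynomial k) :
    m.red (Polynomial.toLaurent p) = Ideal.Quotient.mk m.1.asIdeal p := by
  rw [toLaurent_eq_aeval, ← Polynomial.aeval_algHom_apply, m.red_T, aeval_mk]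

variable {q : kˣ} (hq : ∀ n : ℕ, 0 < n → q ^ n ≠ 1) (i : Bool) (m : MaxNZ k)

theorem lau_aeval_cen (p : Polynomial k) :
    lau hq i (Polynomial.aeval (cen q i) p) = Polynomial.toLaurent p ⊗ₜ 1 := by
  rw [lau, chart_aeval_cen, toLaurent_eq_aeval]

theorem lau_map_red (a : Alg q) :
    Algebra.TensorProduct.map m.red (AlgHom.id k (YY q)) (lau hq i a) = fieldChart hq i m a := by
  rw [fieldChart, ← m.red_T]
  exact chart_map hq i _ m.red a

theorem nrm_mem_idlNm (m : Ideal (Polynomial k)) : nrm q i ∈ idlNm q i m :=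
  TwoSidedIdeal.subset_span (Or.inl rfl)

theorem aeval_mem_idlNm {m : Ideal (Polynomial k)} {p : Polynomial k} (hp : p ∈ m) :
    Polynomial.aeval (cen q i) p ∈ idlNm q i m :=
  TwoSidedIdeal.subset_span (Or.inr ⟨p, hp, rfl⟩)

/-- Since T ∉ 𝔪, some r satisfies rT - 1 ∈ 𝔪, so Z (respectively C) is invertible modulo (X, 𝔪)
(respectively (φ, 𝔪)) and cancels. -/
theorem mem_of_cen_pow_mul_mem {I : TwoSidedIdeal (Alg q)} (hI : idlNm q i m.1.asIdeal ≤ I)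
    {a : Alg q} (n : ℕ) (h : cen q i ^ n * a ∈ I) : a ∈ I := by
  obtain ⟨r, hr⟩ := m.exists_inv
  have h1 := hI (aeval_mem_idlNm i hr)
  rw [map_sub, map_mul, map_one, Polynomial.aeval_X] at h1
  induction n with
  | zero => simpa using h
  | succ n ih =>
    refine ih ?_
    rw [pow_succ', mul_assoc] at h
    have h2 := I.sub_mem (I.mul_mem_left (Polynomial.aeval (cen q i) r) _ h)
      (I.mul_mem_right _ (cen q i ^ n * a) h1)
    convert h2 using 1
    noncomm_ring

/-- If a dies over k[T]/𝔪, the coefficients of its image over k[T, T⁻¹] vanish modulo 𝔪. After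
multiplication by a power of the central element each term is the image of an element of the ideal.
The kernel of `lau` then gives the same for a, and the central element cancels. -/
theorem fieldChart_eq_zero_iff (a : Alg q) :
    fieldChart hq i m a = 0 ↔ a ∈ idlNm q i m.1.asIdeal := by
  constructor
  · intro h
    rw [← lau_map_red] at h
    have hc : ∀ j, m.red (coeffs q (lau hq i a) j) = 0 := fun j => by
      rw [← coeffs_map, h]
      simp [coeffs]
    have key : ∃ n : ℕ, ∃ b ∈ idlNm q i m.1.asIdeal,
        lau hq i (cen q i) ^ n * lau hq i a = lau hq i b := by
      rw [← sum_coeffs q (lau hq i a)]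
      refine Finset.sum_induction _ (fun x => ∃ n : ℕ, ∃ b ∈ idlNm q i m.1.asIdeal,
        lau hq i (cen q i) ^ n * x = lau hq i b) ?_ ?_ ?_
      · rintro x y ⟨n, b, hb, h1⟩ ⟨n', b', hb', h2⟩
        refine ⟨n + n', cen q i ^ n' * b + cen q i ^ n * b', add_mem
          (TwoSidedIdeal.mul_mem_left _ _ _ hb) (TwoSidedIdeal.mul_mem_left _ _ _ hb'), ?_⟩
        rw [map_add, map_mul, map_mul, map_pow, map_pow, ← h1, ← h2, mul_add, ← mul_assoc,
          ← mul_assoc, ← pow_add, ← pow_add, add_comm n']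
      · exact ⟨0, 0, zero_mem _, by simp⟩
      · intro j _
        -- Two denominators are cleared: Tⁿ makes the coefficient a polynomial p, necessarily in 𝔪,
        -- and a further power of the central element lifts the monomial to 𝒜.
        obtain ⟨n, p, hp⟩ := LaurentPolynomial.exists_T_pow (coeffs q (lau hq i a) j)
        obtain ⟨n', b, hb⟩ := lau_pow_cen_mul hq i (1 ⊗ₜ yyBasis q j)
        have hpm : p ∈ m.1.asIdeal := by
          rw [← Ideal.Quotient.eq_zero_iff_mem, ← m.red_toLaurent, hp, map_mul, hc, zero_mul]
        refine ⟨n + n', Polynomial.aeval (cen q i) p * b,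
          TwoSidedIdeal.mul_mem_right _ _ _ (aeval_mem_idlNm i hpm), ?_⟩
        have h1 : lau hq i (cen q i) ^ n = LaurentPolynomial.T n ⊗ₜ 1 := by
          have := lau_aeval_cen hq i (Polynomial.X ^ n)
          rwa [map_pow, Polynomial.aeval_X, map_pow, Polynomial.toLaurent_X_pow] at this
        have h2 : coeffs q (lau hq i a) j ⊗ₜ[k] yyBasis q j =
            (coeffs q (lau hq i a) j ⊗ₜ[k] 1) * (1 ⊗ₜ[k] yyBasis q j) := by
          rw [tmul_one_mul_tmul, mul_one]
        have h3 : (LaurentPolynomial.T n ⊗ₜ[k] (1 : YY q)) * (coeffs q (lau hq i a) j ⊗ₜ[k] 1) =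
            lau hq i (Polynomial.aeval (cen q i) p) := by
          rw [tmul_one_mul_tmul, lau_aeval_cen, hp, mul_comm]
        rw [map_mul, ← hb, ← h3, ← h1, h2, add_comm n n', pow_add]
        simp only [mul_assoc]
        rw [← mul_assoc (lau hq i (cen q i) ^ n'), ((commute_lau_cen hq i _).pow_left n').eq]
        simp only [mul_assoc]
        rw [← mul_assoc (lau hq i (cen q i) ^ n'), ((commute_lau_cen hq i _).pow_left n').eq]
        simp only [mul_assoc]
    obtain ⟨n, b, hb, h1⟩ := key
    -- Equal images under `lau` mean equality modulo X or φ, which already lies in the ideal.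
    have h2 : cen q i ^ n * a - b ∈ idl q {nrm q i} := by
      rw [← lau_eq_zero_iff hq, map_sub, map_mul, map_pow, h1, sub_self]
    have hle : idl q {nrm q i} ≤ idlNm q i m.1.asIdeal :=
      TwoSidedIdeal.span_mono (by simp)
    exact mem_of_cen_pow_mul_mem i m le_rfl n (by simpa using add_mem (hle h2) hb)
  · refine map_eq_zero_of_mem_span _ ?_
    rintro _ (rfl | ⟨p, hp, rfl⟩)
    · exact chart_nrm hq i _
    · rw [fieldChart, chart_aeval_cen, aeval_mk, Ideal.Quotient.eq_zero_iff_mem.2 hp,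
        TensorProduct.zero_tmul]

include hq in
theorem isSimpleRing_field : IsSimpleRing ((Polynomial k ⧸ m.1.asIdeal) ⊗[k] YY q) :=
  isSimpleRing_tensor _ hq m.isField

variable (q) in
theorem isDomain_field : IsDomain ((Polynomial k ⧸ m.1.asIdeal) ⊗[k] YY q) := by
  have := m.1.isMaximal.isPrime
  exact isDomain_tensor q (Polynomial k ⧸ m.1.asIdeal)

include hq in
theorem isCoatom_idlNm : IsCoatom (idlNm q i m.1.asIdeal) := by
  have := isSimpleRing_field hq m
  exact isCoatom_of_surjective (fieldChart hq i m) (fieldChart_surjective hq i m)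
    (fieldChart_eq_zero_iff hq i m)

include hq in
theorem isPrimeIdeal_idlNm : IsPrimeIdeal (idlNm q i m.1.asIdeal) := by
  have := isDomain_field q m
  exact isPrimeIdeal_of_ker (fieldChart hq i m).toRingHom (fieldChart_eq_zero_iff hq i m)

/-- A nonzero prime Q contains the coefficients of its elements, so it meets k[T] in a nonzero
prime, hence maximal, and different from (T) because T is a unit. The contraction of Q to 𝒜 then
contains the maximal ideal attached to it and equals it. -/
theorem contr_lau : contr (lau hq i) =
    {idl q {nrm q i}} ∪ {P | ∃ m : MaxNZ k, P = idlNm q i m.1.asIdeal} := by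
  apply Set.Subset.antisymm
  · rintro _ ⟨Q, hQ, rfl⟩
    by_cases hbot : Q = ⊥
    · left
      rw [hbot]
      ext a
      rw [TwoSidedIdeal.mem_comap, TwoSidedIdeal.mem_bot, lau_eq_zero_iff]
    · right
      -- The intersection of Q with k[T], taken through 𝒜 by evaluating polynomials at Z or C.
      let p₀ : Ideal (Polynomial k) :=
        (TwoSidedIdeal.comap ((lau hq i).comp (Polynomial.aeval (cen q i))) Q).asIdeal
      have hp₀ : ∀ p, p ∈ p₀ ↔ Polynomial.toLaurent p ⊗ₜ[k] (1 : YY q) ∈ Q := fun p => by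
        rw [TwoSidedIdeal.mem_asIdeal, TwoSidedIdeal.mem_comap, ← lau_aeval_cen hq i]
        rfl
      have hprime : p₀.IsPrime := by
        refine ⟨fun h1 => hQ.one_notMem ?_, fun {a b} hab => ?_⟩
        · have h2 := (hp₀ 1).1 (h1 ▸ Submodule.mem_top)
          rwa [map_one, one_tmul_one] at h2
        · rw [hp₀] at hab ⊢
          rw [hp₀]
          refine hQ.mem_or_mem fun r => ?_
          have h1 : (Polynomial.toLaurent a ⊗ₜ[k] (1 : YY q)) * r =
              r * (Polynomial.toLaurent a ⊗ₜ[k] (1 : YY q)) := by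
            induction r using TensorProduct.induction_on with
            | zero => simp
            | tmul x y => exact tmul_one_commute (mul_comm _ x) y
            | add x y hx hy => rw [mul_add, add_mul, hx, hy]
          rw [h1, mul_assoc]
          refine Q.mul_mem_left _ _ ?_
          rwa [tmul_one_mul_tmul, ← map_mul]
      -- If the intersection were 0, then every coefficient of every element of Q, after
      -- multiplication by a power of T, would be 0.
      have hne : p₀ ≠ ⊥ := by
        intro h1
        refine hbot (eq_bot_iff.2 fun x hx => ?_)
        rw [TwoSidedIdeal.mem_bot]
        refine coeffs_eq_zero q fun j => ?_
        obtain ⟨n, p, hp⟩ := LaurentPolynomial.exists_T_pow (coeffs q x j)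
        have h2 : p ∈ p₀ := by
          rw [hp₀, hp]
          have h3 := Q.mul_mem_right _ (LaurentPolynomial.T n ⊗ₜ[k] (1 : YY q))
            (coeffs_tmul_one_mem hq hx j)
          rwa [tmul_one_mul_tmul] at h3
        rw [h1, Ideal.mem_bot] at h2
        rw [h2, map_zero] at hp
        exact ((LaurentPolynomial.isUnit_T (n : ℤ)).mul_left_eq_zero).1 hp.symm
      have hX : p₀ ≠ Ideal.span {Polynomial.X} := by
        intro h1
        have h2 : Polynomial.X ∈ p₀ := h1 ▸ Ideal.mem_span_singleton_self _
        have h3 := (hp₀ _).1 h2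
        rw [← lau_aeval_cen hq i, Polynomial.aeval_X] at h3
        obtain ⟨u, hu⟩ := (isScaled_lau_cen hq i).isUnit (lau_isTwisted q)
        have h4 := Q.mul_mem_left (↑u⁻¹) _ h3
        rw [← hu, Units.inv_mul] at h4
        exact hQ.one_notMem h4
      let m : MaxNZ k := ⟨⟨p₀, hprime.isMaximal hne⟩, hX⟩
      -- By maximality it is enough that the generators of the ideal lie in the contraction and that
      -- this contraction is proper.
      refine ⟨m, ((isCoatom_idlNm hq i m).le_iff_eq ?_).1 (TwoSidedIdeal.span_le.2 ?_)⟩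
      · intro h1
        refine hQ.one_notMem ?_
        have h2 : (1 : Alg q) ∈ TwoSidedIdeal.comap (lau hq i) Q := h1 ▸ trivial
        rwa [TwoSidedIdeal.mem_comap, map_one] at h2
      · rintro _ (rfl | ⟨p, hp, rfl⟩)
        · rw [SetLike.mem_coe, TwoSidedIdeal.mem_comap,
            (lau_eq_zero_iff hq i _).2 (TwoSidedIdeal.subset_span rfl)]
          exact Q.zero_mem
        · rw [SetLike.mem_coe, TwoSidedIdeal.mem_comap, lau_aeval_cen]
          exact (hp₀ p).1 hp
  · rintro P (rfl | ⟨m, rfl⟩)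
    · refine ⟨⊥, isPrimeIdeal_of_ker (RingHom.id _) fun a => by simp [TwoSidedIdeal.mem_bot], ?_⟩
      ext a
      rw [TwoSidedIdeal.mem_comap, TwoSidedIdeal.mem_bot, lau_eq_zero_iff]
    · have := isDomain_field q m
      refine ⟨TwoSidedIdeal.ker (Algebra.TensorProduct.map m.red (AlgHom.id k (YY q))),
        isPrimeIdeal_of_ker (Algebra.TensorProduct.map m.red (AlgHom.id k (YY q))).toRingHom
          fun a => (TwoSidedIdeal.mem_ker _).symm, ?_⟩
      ext a
      rw [TwoSidedIdeal.mem_comap, TwoSidedIdeal.mem_ker, lau_map_red, fieldChart_eq_zero_iff]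

end FieldKernel

end

end QAge

namespace QAge

noncomputable section

open scoped TensorProduct
open OreLocalization (OreSet)

/-! ### The localizations and factor algebras on the branches of X and φ -/

section Sides

variable {k : Type*} [Field k] {q : kˣ} (hq : ∀ n : ℕ, 0 < n → q ^ n ≠ 1) (i : Bool)
  (m : MaxNZ k)

theorem one_tmul_yyY {W : Type*} [Ring W] [Algebra k W] : tm q (1 : W) 1 0 = 1 ⊗ₜ yyY q := by
  rw [tm, yyY_eq]

theorem one_tmul_yyK {W : Type*} [Ring W] [Algebra k W] : tm q (1 : W) 0 1 = 1 ⊗ₜ yyK q := by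
  rw [tm, yyK_eq]

include hq

theorem exists_quo_idlNm_equiv :
    ∃ e : Quo (idlNm q i m.1.asIdeal) ≃ₐ[k] (Polynomial k ⧸ m.1.asIdeal) ⊗[k] YY q,
      e (quo k _ (cen q i)) = Ideal.Quotient.mk m.1.asIdeal Polynomial.X ⊗ₜ[k] (1 : YY q) ∧
      e (quo k _ (gY q)) = 1 ⊗ₜ[k] yyY q ∧ e (quo k _ (gK q)) = 1 ⊗ₜ[k] yyK q := by
  obtain ⟨e, he⟩ := exists_quo_equiv (idlNm q i m.1.asIdeal) (fieldChart hq i m)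
    (fieldChart_surjective hq i m) (fieldChart_eq_zero_iff hq i m)
  refine ⟨e, ?_, ?_, ?_⟩
  · rw [he, fieldChart, chart_cen]
  · rw [he, fieldChart, chart_gY, one_tmul_yyY]
  · rw [he, fieldChart, chart_gK, one_tmul_yyK]

theorem isDomain_quo_idlNm : IsDomain (Quo (idlNm q i m.1.asIdeal)) := by
  have := isDomain_field q m
  exact isDomain_quo _ (fieldChart hq i m) (fieldChart_eq_zero_iff hq i m)

theorem isSimpleRing_quo_idlNm : IsSimpleRing (Quo (idlNm q i m.1.asIdeal)) := by
  obtain ⟨e, -⟩ := exists_quo_idlNm_equiv hq i m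
  have := isSimpleRing_field hq m
  exact IsSimpleRing.of_ringEquiv e.symm.toRingEquiv inferInstance

/-- The factor algebra is already a quantum torus in which Y and the other normal element are units.
Localizing therefore changes nothing, and both sides are identified with this torus. -/
theorem exists_quo_idlNm_equiv_ext (S : Submonoid (Alg q)) [OreSet S]
    (hS : S = Submonoid.closure {nrm q !i, gY q}) :
    ∃ e : Quo (idlNm q i m.1.asIdeal) ≃ₐ[k] Quo (ext q S (idlNm q i m.1.asIdeal)),
      ∀ a : Alg q, e (quo k _ a) = toLocQuo q S (idlNm q i m.1.asIdeal) a := by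
  obtain ⟨e, he⟩ := exists_quo_equiv (idlNm q i m.1.asIdeal) (fieldChart hq i m)
    (fieldChart_surjective hq i m) (fieldChart_eq_zero_iff hq i m)
  have hu : ∀ s ∈ S, IsUnit (fieldChart hq i m s) := by
    rw [hS]
    refine isUnit_closure _ ?_
    rintro _ (rfl | rfl)
    · obtain ⟨s, hs, h⟩ := chart_nrm_not hq i (Ideal.Quotient.mk m.1.asIdeal Polynomial.X)
      have h1 : fieldChart hq i m (nrm q !i) = _ := h
      rw [h1, ← smul_tm]
      refine isUnit_tm q ?_ _ _
      rw [Algebra.smul_def]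
      exact ((IsUnit.mk0 s hs).map (algebraMap k _)).mul m.isUnit_mk_X
    · rw [fieldChart, chart_gY]
      exact isUnit_tm q isUnit_one _ _
  obtain ⟨e', he'⟩ := exists_quo_loc_equiv S
    (clears_of_surjective (fieldChart_surjective hq i m) S hu) (idlNm q i m.1.asIdeal)
    (fieldChart_eq_zero_iff hq i m)
  refine ⟨e.trans e'.symm, fun a => ?_⟩
  rw [AlgEquiv.trans_apply, he, AlgEquiv.symm_apply_eq]
  exact (he' a).symm

theorem isDomain_quo_nrm : IsDomain (Quo (idl q {nrm q i})) :=
  isDomain_quo _ (lau hq i) (lau_eq_zero_iff hq i)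

theorem oreSet_denZ : Nonempty (OreSet (denZ q)) := by
  have : IsDomain (AX q) := isDomain_quo_nrm hq true
  refine nonempty_oreSet_of_normal _ ?_
  rintro _ ⟨n, rfl⟩ r
  refine ⟨r, ?_⟩
  have h : Commute (quo k (idl q {gX q}) (elZ q)) r := by
    obtain ⟨a, rfl⟩ := quo_surjective (k := k) (idl q {gX q}) r
    rw [Commute, SemiconjBy, ← sub_eq_zero, ← map_mul, ← map_mul, ← map_sub, quo_eq_zero_iff]
    exact cen_mul_sub_mem hq true a
  exact (h.pow_left n).eq

theorem exists_AXloc_equiv [OreSet (denZ q)] :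
    ∃ e : OreLocalization (denZ q) (AX q) ≃ₐ[k] LaurentPolynomial k ⊗[k] YY q,
      ∀ a, e (toAXloc q a) = lau hq true a := by
  obtain ⟨e, he⟩ := exists_loc_equiv (denZ q)
    ((clears_lau_cen hq true).quoLift (I := idl q {gX q}) (T := denZ q)
      (fun a => (lau_eq_zero_iff hq true a).2) (Submonoid.map_powers _ _).symm)
    (fun a ha => ⟨1, one_mem _, by
      rw [one_mul]
      exact (injective_iff_map_eq_zero _).1
        (quoLift_injective _ (lau hq true) (lau_eq_zero_iff hq true)) a ha⟩)
  exact ⟨e, fun a => he _⟩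

theorem contr_toAXloc [OreSet (denZ q)] : contr (toAXloc q) =
    {idl q {gX q}} ∪ {P | ∃ m : MaxNZ k, P = idlXm q m.1.asIdeal} := by
  obtain ⟨e, he⟩ := exists_AXloc_equiv hq
  rw [contr_eq_of_equiv e he]
  exact contr_lau hq true

theorem injective_comap_toAXloc [OreSet (denZ q)] :
    Function.Injective (TwoSidedIdeal.comap (toAXloc q)) := by
  obtain ⟨e, he⟩ := exists_AXloc_equiv hq
  exact ((clears_lau_cen hq true).of_equiv e he).injective_comap

theorem exists_locQuo_denX_equiv [OreSet (denX q)] :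
    ∃ e : Quo (ext q (denX q) (idl q {phi q})) ≃ₐ[k] LaurentPolynomial k ⊗[k] YY q,
      ∀ a, e (toLocQuo q (denX q) (idl q {phi q}) a) = lau hq false a :=
  exists_quo_loc_equiv (denX q) (clears_lau_nrm hq false) (idl q {phi q}) (lau_eq_zero_iff hq false)

theorem exists_locQuo_denXY_equiv [OreSet (denXY q)] :
    ∃ e : Quo (ext q (denXY q) (idl q {phi q})) ≃ₐ[k] LaurentPolynomial k ⊗[k] YY q,
      ∀ a, e (toLocQuo q (denXY q) (idl q {phi q}) a) = lau hq false a :=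
  exists_quo_loc_equiv (denXY q) (clears_lau_nrm_gY hq false) (idl q {phi q})
    (lau_eq_zero_iff hq false)

theorem contr_toLocQuo [OreSet (denX q)] : contr (toLocQuo q (denX q) (idl q {phi q})) =
    {idl q {phi q}} ∪ {P | ∃ m : MaxNZ k, P = idlPhir q m.1.asIdeal} := by
  obtain ⟨e, he⟩ := exists_locQuo_denX_equiv hq
  rw [contr_eq_of_equiv e he]
  exact contr_lau hq false

theorem injective_comap_toLocQuo [OreSet (denX q)] :
    Function.Injective (TwoSidedIdeal.comap (toLocQuo q (denX q) (idl q {phi q}))) := by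
  obtain ⟨e, he⟩ := exists_locQuo_denX_equiv hq
  exact ((clears_lau_nrm hq false).of_equiv e he).injective_comap

theorem exists_locQuo_equiv [OreSet (denX q)] [OreSet (denXY q)] :
    ∃ e : Quo (ext q (denX q) (idl q {phi q})) ≃ₐ[k] Quo (ext q (denXY q) (idl q {phi q})),
      ∀ a : Alg q, e (toLocQuo q (denX q) (idl q {phi q}) a) =
        toLocQuo q (denXY q) (idl q {phi q}) a := by
  obtain ⟨e, he⟩ := exists_locQuo_denX_equiv hq
  obtain ⟨e', he'⟩ := exists_locQuo_denXY_equiv hq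
  refine ⟨e.trans e'.symm, fun a => ?_⟩
  rw [AlgEquiv.trans_apply, he, AlgEquiv.symm_apply_eq, he']

theorem exists_locQuo_denXY_equiv_gen [OreSet (denXY q)] :
    ∃ e : Quo (ext q (denXY q) (idl q {phi q})) ≃ₐ[k] LaurentPolynomial k ⊗[k] YY q,
      e (toLocQuo q (denXY q) (idl q {phi q}) (elC q)) = LaurentPolynomial.T 1 ⊗ₜ[k] (1 : YY q) ∧
      e (toLocQuo q (denXY q) (idl q {phi q}) (gY q)) = 1 ⊗ₜ[k] yyY q ∧
      e (toLocQuo q (denXY q) (idl q {phi q}) (gK q)) = 1 ⊗ₜ[k] yyK q := by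
  obtain ⟨e, he⟩ := exists_locQuo_denXY_equiv hq
  refine ⟨e, ?_, ?_, ?_⟩
  · rw [he]
    exact chart_cen hq false _
  · rw [he, lau, chart_gY, one_tmul_yyY]
  · rw [he, lau, chart_gK, one_tmul_yyK]

end Sides

end

end QAge

namespace QAge

noncomputable section

open scoped TensorProduct
open OreLocalization (OreSet)

/-! The factor algebras by `(Y)` and by `(E)` -/

section Axes

variable {k : Type*} [Field k] (q : kˣ)

/-- The generators `E` and `Y`. -/
def axGen : Bool → Alg q
  | true => gE q
  | false => gY q

/-- The scalar `c` with `K g = c g K` for `g = E` or `g = Y`. -/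
def axScale : Bool → kˣ
  | true => q ^ 2
  | false => q⁻¹

variable {q} {B : Type*} [Ring B] [Algebra k B] (j : Bool)

theorem exists_axHom {y : B} {κ : Bˣ} (h : (κ : B) * y = (axScale q j : k) • (y * κ)) :
    ∃ f : Alg q →ₐ[k] B, f (axGen q j) = y ∧ f (axGen q !j) = 0 ∧ f (gX q) = 0 ∧
      ∀ n : ℤ, f (Kz q n) = ((κ ^ n : Bˣ) : B) := by
  have key : ∀ f : Alg q →ₐ[k] B, f (gK q) = κ → f (gKinv q) = ((κ⁻¹ : Bˣ) : B) →
      ∀ n : ℤ, f (Kz q n) = ((κ ^ n : Bˣ) : B) := by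
    intro f h1 h2 n
    induction n with
    | zero => simp [Kz_zero]
    | succ n ih => rw [← gK_mul_Kz, map_mul, ih, h1, add_comm, zpow_one_add, Units.val_mul]
    | pred n ih =>
      rw [← gKinv_mul_Kz, map_mul, ih, h2, sub_eq_neg_add, zpow_add, zpow_neg_one, Units.val_mul]
  have h' : y * κ = ((axScale q j : k))⁻¹ • ((κ : B) * y) := mul_eq_inv_smul (Units.ne_zero _) h
  cases j
  · obtain ⟨f, hf⟩ := exists_lift q (B := B) (g := fun
        | .E => 0 | .K => κ | .Kinv => ((κ⁻¹ : Bˣ) : B) | .X => 0 | .Y => y)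
      (by constructor <;> simp_all [axScale])
    exact ⟨f, hf _, hf _, hf _, key f (hf _) (hf _)⟩
  · obtain ⟨f, hf⟩ := exists_lift q (B := B) (g := fun
        | .E => y | .K => κ | .Kinv => ((κ⁻¹ : Bˣ) : B) | .X => 0 | .Y => 0)
      (by constructor <;> simp_all [axScale])
    exact ⟨f, hf _, hf _, hf _, key f (hf _) (hf _)⟩

/-- X = EY - q⁻¹YE, and both terms contain E and Y. -/
theorem gX_mem_of_axGen_mem {P : TwoSidedIdeal (Alg q)} (h : axGen q j ∈ P) : gX q ∈ P := by
  have h1 : gX q = gE q * gY q - (q : k)⁻¹ • (gY q * gE q) := by rw [gE_mul_gY]; abel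
  rw [h1, Algebra.smul_def]
  cases j
  · exact P.sub_mem (P.mul_mem_left _ _ h) (P.mul_mem_left _ _ (P.mul_mem_right _ _ h))
  · exact P.sub_mem (P.mul_mem_right _ _ h) (P.mul_mem_left _ _ (P.mul_mem_left _ _ h))

theorem phi_mem_of_axGen_mem {P : TwoSidedIdeal (Alg q)} (h : axGen q j ∈ P) : phi q ∈ P := by
  have h1 := gX_mem_of_axGen_mem j h
  rw [phi_eq, Algebra.smul_def]
  refine P.add_mem h1 (P.mul_mem_left _ _ ?_)
  cases j
  · exact P.mul_mem_right _ _ h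
  · exact P.mul_mem_left _ _ h

/-- The monomials `gⁿ Kᵐ` for `g = E` or `g = Y`. -/
def axMono (q : kˣ) (j : Bool) (x : ℕ × ℤ) : Alg q := axGen q j ^ x.1 * Kz q x.2

/-- X vanishes together with the killed generator, so the monomials YᵇEᶜKⁿ span, and those involving
the killed generator are 0. -/
theorem span_axMono {I : TwoSidedIdeal (Alg q)} (hI : axGen q (!j) ∈ I) :
    Submodule.span k (Set.range fun x => quo k I (axMono q j x)) = ⊤ := by
  rw [eq_top_iff, ← span_monoYE (quo k I) (quo_surjective I) 0
    (by rw [zero_smul]; exact (quo_eq_zero_iff I).2 (gX_mem_of_axGen_mem _ hI)), Submodule.span_le]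
  rintro _ ⟨⟨⟨b, c⟩, n⟩, rfl⟩
  have hm : ∀ b n, quo k I (axMono q j (b, n)) ∈
      Submodule.span k (Set.range fun x => quo k I (axMono q j x)) := fun b n =>
    Submodule.subset_span ⟨_, rfl⟩
  have h0 : ∀ b, quo k I (axGen q (!j)) ^ (b + 1) = 0 := fun b => by
    rw [(quo_eq_zero_iff I).2 hI, zero_pow b.succ_ne_zero]
  change quo k I (monoYE q ((b, c), n)) ∈ _
  rw [monoYE, map_mul, map_mul, map_pow, map_pow]
  cases j
  · cases c with
    | zero =>
      have := hm b n
      rw [axMono, map_mul, map_pow] at this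
      simpa [axGen] using this
    | succ c =>
      have := h0 c
      change quo k I (gE q) ^ (c + 1) = 0 at this
      rw [this, zero_mul, mul_zero]
      exact zero_mem _
  · cases b with
    | zero =>
      have := hm c n
      rw [axMono, map_mul, map_pow] at this
      simpa [axGen] using this
    | succ b =>
      have := h0 b
      change quo k I (gY q) ^ (b + 1) = 0 at this
      rw [this, zero_mul]
      exact zero_mem _

theorem ax_eq_zero_iff {f : Alg q →ₐ[k] B} (h0 : f (axGen q !j) = 0) {ι : Type*}
    (b : Module.Basis ι k B) (σ : ℕ × ℤ → ι) (hσ : Function.Injective σ)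
    (h : ∀ x, f (axMono q j x) = b (σ x)) (a : Alg q) : f a = 0 ↔ a ∈ idl q {axGen q !j} := by
  have h0 : ∀ a ∈ idl q {axGen q !j}, f a = 0 := fun a =>
    map_eq_zero_of_mem_span _ (by rintro _ rfl; exact h0)
  refine ⟨fun ha => ?_, h0 a⟩
  have hinj := linearMap_injective_of_span (quoLift _ f h0).toLinearMap
    (fun x => quo k _ (axMono q j x)) (span_axMono j (TwoSidedIdeal.subset_span rfl)) b σ hσ
    (fun x => ⟨1, one_ne_zero, by rw [one_smul]; exact h x⟩)
  rw [← quo_eq_zero_iff (k := k)]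
  exact hinj (ha.trans (map_zero _).symm)

/-! The skew Laurent polynomial models -/

theorem exists_quo_equiv_skewLaurent : ∃ e : Quo (idl q {axGen q !j}) ≃ₐ[k]
    SkewLaurent (polyScale (axScale q j)),
      e (quo k _ (axGen q j)) = SkewLaurent.coef _ Polynomial.X ∧
      e (quo k _ (gK q)) = SkewLaurent.t _ := by
  set σ := polyScale (axScale q j) with hσ
  let κ : (SkewLaurent σ)ˣ := ⟨SkewLaurent.tz σ 1, SkewLaurent.tz σ (-1),
    by rw [SkewLaurent.tz_mul_tz]; rfl, by rw [SkewLaurent.tz_mul_tz]; rfl⟩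
  have hκ : ∀ n : ℤ, ((κ ^ n : (SkewLaurent σ)ˣ) : SkewLaurent σ) = SkewLaurent.tz σ n := by
    intro n
    induction n with
    | zero => rfl
    | succ n ih => rw [zpow_add_one, Units.val_mul, ih]; exact SkewLaurent.tz_mul_tz σ _ _
    | pred n ih => rw [zpow_sub_one, Units.val_mul, ih]; exact SkewLaurent.tz_mul_tz σ _ _
  have hy : (κ : SkewLaurent σ) * SkewLaurent.coef σ Polynomial.X =
      (axScale q j : k) • (SkewLaurent.coef σ Polynomial.X * (κ : SkewLaurent σ)) := by
    have h := SkewLaurent.tz_mul_coef σ Polynomial.X 1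
    have h1 : σ Polynomial.X = (axScale q j : k) • (Polynomial.X : Polynomial k) := by
      rw [hσ]
      exact Polynomial.aeval_X _
    rw [zpow_one, h1, map_smul, smul_mul_assoc] at h
    exact h
  obtain ⟨f, h1, h2, -, h4⟩ := exists_axHom j hy
  have hb : ∀ x : ℕ × ℤ, f (axMono q j x) =
      SkewLaurent.basis σ (Polynomial.basisMonomials k) x := by
    intro x
    rw [axMono, map_mul, map_pow, h1, h4, hκ, SkewLaurent.basis_apply,
      Polynomial.coe_basisMonomials]
    dsimp only
    rw [Polynomial.monomial_one_right_eq_X_pow, map_pow]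
  have hsurj : Function.Surjective f := by
    intro x
    have hx : x ∈ LinearMap.range f.toLinearMap := by
      have : Submodule.span k (Set.range (SkewLaurent.basis σ (Polynomial.basisMonomials k))) ≤
          LinearMap.range f.toLinearMap := by
        rw [Submodule.span_le]
        rintro _ ⟨x, rfl⟩
        exact ⟨_, hb x⟩
      rw [Module.Basis.span_eq] at this
      exact this Submodule.mem_top
    exact hx
  obtain ⟨e, he⟩ := exists_quo_equiv _ f hsurj
    (ax_eq_zero_iff j h2 (SkewLaurent.basis σ (Polynomial.basisMonomials k)) id
      Function.injective_id hb)
  refine ⟨e, by rw [he, h1], ?_⟩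
  have h5 := h4 1
  rw [← zero_add (1 : ℤ), ← gK_mul_Kz, Kz_zero, mul_one, zero_add, hκ] at h5
  rw [he, h5]
  rfl

/-! The quantum torus models -/

theorem exists_axTorus (p : kˣ) (hp : p⁻¹ = axScale q j) : ∃ f : Alg q →ₐ[k] YY p,
    (∀ x : ℕ × ℤ, f (axMono q j x) = yyBasis p (x.1, x.2)) ∧
    f (axGen q !j) = 0 := by
  have hm := (yy_isTwisted p).mul
  let κ : (YY p)ˣ := ⟨yyBasis p (0, 1), yyBasis p (0, -1),
    by rw [hm]; simp [yyTwist, qpow_zero, ← (yy_isTwisted p).one, Prod.zero_eq_mk],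
    by rw [hm]; simp [yyTwist, qpow_zero, ← (yy_isTwisted p).one, Prod.zero_eq_mk]⟩
  have hκ : ∀ n : ℤ, ((κ ^ n : (YY p)ˣ) : YY p) = yyBasis p (0, n) := by
    intro n
    induction n with
    | zero => exact (yy_isTwisted p).one.symm
    | succ n ih =>
      rw [zpow_add_one, Units.val_mul, ih]
      refine (hm _ _).trans ?_
      simp [yyTwist, qpow_zero]
    | pred n ih =>
      rw [zpow_sub_one, Units.val_mul, ih]
      refine (hm _ _).trans ?_
      simp [yyTwist, qpow_zero, sub_eq_add_neg]
  have hy : (κ : YY p) * yyBasis p (1, 0) = (axScale q j : k) • (yyBasis p (1, 0) * κ) := by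
    refine (hm _ _).trans ?_
    change _ = _ • (yyBasis p (1, 0) * yyBasis p (0, 1))
    rw [hm, ← hp]
    simp [yyTwist, qpow]
  obtain ⟨f, h1, h2, -, h4⟩ := exists_axHom j hy
  refine ⟨f, fun x => ?_, h2⟩
  have h5 : ∀ n : ℕ, yyBasis p (1, 0) ^ n = yyBasis p (n, 0) := by
    intro n
    induction n with
    | zero => exact (yy_isTwisted p).one.symm
    | succ n ih => rw [pow_succ, ih, hm]; simp [yyTwist, qpow_zero]
  rw [axMono, map_mul, map_pow, h1, h4, hκ, h5, hm]
  simp [yyTwist, qpow_zero]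

end Axes

end

end QAge

namespace QAge

noncomputable section

open scoped TensorProduct
open OreLocalization (OreSet)

/-! ### The primes (Y) and (E) as contractions -/

section AxesContr

variable {k : Type*} [Field k] {q : kˣ} (j : Bool)

theorem quo_axGen_mul {I : TwoSidedIdeal (Alg q)} (hI : axGen q (!j) ∈ I) (x : Gen) :
    ∃ c : k, c ≠ 0 ∧ quo k I (axGen q j) * quo k I (gen q x) =
      c • (quo k I (gen q x) * quo k I (axGen q j)) := by
  have hX := (quo_eq_zero_iff (k := k) I).2 (gX_mem_of_axGen_mem _ hI)
  have h0 := (quo_eq_zero_iff (k := k) I).2 hI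
  have hm : ∀ {x y : Alg q} {c : k}, c ≠ 0 → x * y = c • (y * x) → ∃ c : k, c ≠ 0 ∧
      quo k I x * quo k I y = c • (quo k I y * quo k I x) := fun {x y c} hc h =>
    ⟨c, hc, by rw [← map_mul, h, map_smul, map_mul]⟩
  have h1 : ∀ x y : Alg q, quo k I y = 0 → ∃ c : k, c ≠ 0 ∧
      quo k I x * quo k I y = c • (quo k I y * quo k I x) := fun x y h =>
    ⟨1, one_ne_zero, by rw [h, mul_zero, zero_mul, smul_zero]⟩
  have h2 : ∀ x : Alg q, ∃ c : k, c ≠ 0 ∧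
      quo k I x * quo k I x = c • (quo k I x * quo k I x) := fun x =>
    ⟨1, one_ne_zero, (one_smul _ _).symm⟩
  cases j <;> cases x
  · exact h1 _ _ h0
  · exact hm (by simp) (gY_mul_gK q)
  · exact hm (by simp) (mul_eq_inv_smul (by simp) (gKinv_mul_gY q))
  · exact h1 _ _ hX
  · exact h2 _
  · exact h2 _
  · exact hm (by simp) (gE_mul_gK q)
  · exact hm (by simp) (mul_eq_inv_smul (by simp) (gKinv_mul_gE q))
  · exact h1 _ _ hX
  · exact h1 _ _ h0

/-- This moves s to the left, so the scalars must be inverted, hence c ≠ 0. The companion version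
moving s to the right also allows zero scalars. -/
theorem exists_mul_eq_of_gen' {B : Type*} [Ring B] [Algebra k B] (f : Alg q →ₐ[k] B) (s : B)
    (h : ∀ x, ∃ c : k, c ≠ 0 ∧ s * f (gen q x) = c • (f (gen q x) * s)) (r : Alg q) :
    ∃ r', f r * s = s * f r' := by
  have hr : r ∈ Algebra.adjoin k (Set.range (gen q)) := adjoin_gen q ▸ Algebra.mem_top
  induction hr using Algebra.adjoin_induction with
  | mem x hx =>
    obtain ⟨x, rfl⟩ := hx
    obtain ⟨c, hc0, hc⟩ := h x
    exact ⟨c⁻¹ • gen q x, by rw [map_smul, mul_smul_comm, hc, smul_smul, inv_mul_cancel₀ hc0, one_smul]⟩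
  | algebraMap c => exact ⟨algebraMap k _ c, by rw [AlgHom.commutes, Algebra.commutes]⟩
  | add x y _ _ hx hy =>
    obtain ⟨x', hx'⟩ := hx
    obtain ⟨y', hy'⟩ := hy
    exact ⟨x' + y', by rw [map_add, map_add, mul_add, add_mul, hx', hy']⟩
  | mul x y _ _ hx hy =>
    obtain ⟨x', hx'⟩ := hx
    obtain ⟨y', hy'⟩ := hy
    exact ⟨x' * y', by rw [map_mul, map_mul, ← mul_assoc, mul_assoc, hy', ← mul_assoc, hx', mul_assoc]⟩

/-- The elements `E` modulo `Y`, and `Y` modulo `E`, are normal. -/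
theorem quo_axGen_normal {I : TwoSidedIdeal (Alg q)} (hI : axGen q (!j) ∈ I) (r : Alg q) :
    ∃ r', quo k I (axGen q j) * quo k I r = quo k I r' * quo k I (axGen q j) :=
  exists_mul_eq_of_gen _ _ (fun x => let ⟨c, _, h⟩ := quo_axGen_mul j hI x; ⟨c, h⟩) r

theorem quo_axGen_normal' {I : TwoSidedIdeal (Alg q)} (hI : axGen q (!j) ∈ I) (r : Alg q) :
    ∃ r', quo k I r * quo k I (axGen q j) = quo k I (axGen q j) * quo k I r' :=
  exists_mul_eq_of_gen' _ _ (quo_axGen_mul j hI) r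

/-- The homomorphisms to quantum tori of rank two with kernels `(Y)` and `(E)`. -/
def axTorus (q : kˣ) (j : Bool) : Alg q →ₐ[k] YY (axScale q j)⁻¹ :=
  Classical.choose (exists_axTorus j (axScale q j)⁻¹ (inv_inv _))

theorem axTorus_axMono (x : ℕ × ℤ) :
    axTorus q j (axMono q j x) = yyBasis (axScale q j)⁻¹ (x.1, x.2) :=
  (Classical.choose_spec (exists_axTorus j (axScale q j)⁻¹ (inv_inv _))).1 x

theorem axTorus_axGen_not : axTorus q j (axGen q !j) = 0 :=
  (Classical.choose_spec (exists_axTorus j (axScale q j)⁻¹ (inv_inv _))).2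

theorem axTorus_eq_zero_iff (a : Alg q) : axTorus q j a = 0 ↔ a ∈ idl q {axGen q !j} :=
  ax_eq_zero_iff j (axTorus_axGen_not j) (yyBasis (axScale q j)⁻¹) (fun x => ((x.1 : ℤ), x.2))
    (fun x y h => by
      simp only [Prod.mk.injEq, Nat.cast_inj] at h
      exact Prod.ext h.1 h.2) (axTorus_axMono j) a

theorem axTorus_axGen : axTorus q j (axGen q j) = yyBasis (axScale q j)⁻¹ (1, 0) := by
  have h := axTorus_axMono (q := q) j (1, 0)
  rw [axMono, pow_one, Kz_zero, mul_one] at h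
  exact h

theorem axTorus_gK : axTorus q j (gK q) = yyBasis (axScale q j)⁻¹ (0, 1) := by
  have h := axTorus_axMono (q := q) j (0, 1)
  rw [axMono, pow_zero, one_mul, ← zero_add (1 : ℤ), ← gK_mul_Kz, Kz_zero, mul_one] at h
  exact h

theorem isScaled_axTorus :
    IsScaled (yyBasis (axScale q j)⁻¹) (axTorus q j (axGen q j)) (1, 0) :=
  ⟨1, one_ne_zero, by rw [one_smul, axTorus_axGen]⟩

theorem exists_isScaled_axTorus (i : ℤ × ℤ) (hi : 0 ≤ i.1) :
    ∃ a, IsScaled (yyBasis (axScale q j)⁻¹) (axTorus q j a) i := by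
  obtain ⟨a, b⟩ := i
  simp only at hi
  lift a to ℕ using hi
  exact ⟨axMono q j (a, b), 1, one_ne_zero, by rw [one_smul, axTorus_axMono]⟩

theorem exists_shift_axTorus (i : ℤ × ℤ) : ∃ n : ℕ, 0 ≤ (n • ((1, 0) : ℤ × ℤ) + i).1 := by
  refine ⟨i.1.natAbs, ?_⟩
  simp [-Nat.cast_natAbs]
  omega

theorem clears_axTorus : Clears (axTorus q j) (Submonoid.powers (axGen q j)) := by
  constructor
  · rintro _ ⟨n, rfl⟩
    rw [map_pow]
    exact ((isScaled_axTorus j).isUnit (yy_isTwisted _)).pow n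
  · intro t
    obtain ⟨n, a, h⟩ := exists_pow_mul_eq (axTorus q j) _ (yy_isTwisted _) (isScaled_axTorus j)
      (exists_isScaled_axTorus j) exists_shift_axTorus t
    exact ⟨_, ⟨n, rfl⟩, a, by rw [map_pow, h]⟩

theorem isPrimeIdeal_axGen : IsPrimeIdeal (idl q {axGen q !j}) :=
  isPrimeIdeal_of_ker (axTorus q j).toRingHom (axTorus_eq_zero_iff j)

variable (hq : ∀ n : ℕ, 0 < n → q ^ n ≠ 1)
include hq

theorem axScale_inv_pow_ne_one (n : ℕ) (hn : 0 < n) : (axScale q j)⁻¹ ^ n ≠ 1 := by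
  cases j
  · rw [axScale, inv_inv]; exact hq n hn
  · rw [axScale, inv_pow, ← pow_mul, inv_ne_one]; exact hq _ (by omega)

theorem contr_axTorus : contr (axTorus q j) = {idl q {axGen q !j}} := by
  have := isSimpleRing_yy (axScale_inv_pow_ne_one j hq)
  exact contr_eq_singleton _ _ (axTorus_eq_zero_iff j)

/-- The only prime containing `Y` but not `E` is `(Y)`, and the only one containing `E` but not
`Y` is `(E)`. -/
theorem eq_of_axGen_mem {P : TwoSidedIdeal (Alg q)} (hP : IsPrimeIdeal P)
    (h0 : axGen q (!j) ∈ P) (h1 : axGen q j ∉ P) : P = idl q {axGen q !j} := by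
  rw [← Set.mem_singleton_iff, ← contr_axTorus j hq]
  have hsub : ∀ {x y : Alg q}, quo k P x = quo k P y ↔ x - y ∈ P := fun {x y} => by
    rw [← sub_eq_zero, ← map_sub, quo_eq_zero_iff]
  refine mem_contr_of_cancel (axTorus q j) (axGen q j)
    (exists_pow_mul_eq (axTorus q j) _ (yy_isTwisted _) (isScaled_axTorus j)
      (exists_isScaled_axTorus j) exists_shift_axTorus)
    (exists_mul_pow_eq (axTorus q j) _ (yy_isTwisted _) (isScaled_axTorus j)
      (exists_isScaled_axTorus j) exists_shift_axTorus)
    ((isScaled_axTorus j).isUnit (yy_isTwisted _)) hP (fun a ha => ?_) (fun b hb => ?_)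
    (fun b hb => ?_)
  · have hle : idl q {axGen q !j} ≤ P := TwoSidedIdeal.span_le.2 (by rintro _ rfl; exact h0)
    exact hle ((axTorus_eq_zero_iff j a).1 ha)
  · refine hP.mem_of_normal_mul_mem h1 (fun r => ?_) hb
    obtain ⟨r', hr'⟩ := quo_axGen_normal j h0 r
    exact ⟨r', hsub.1 (by rw [map_mul, hr', map_mul])⟩
  -- Right cancellation: writing g for the normal generator and rg ≡ gr' modulo P, the membership bg
  -- ∈ P gives brg ∈ P for all r, and g ∉ P.
  · refine (hP.mem_or_mem fun r => ?_).resolve_right h1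
    obtain ⟨r', hr'⟩ := quo_axGen_normal' j h0 r
    rw [← map_mul, ← map_mul, hsub] at hr'
    have h2 := P.add_mem (P.mul_mem_left b _ hr') (P.mul_mem_right _ r' hb)
    convert h2 using 1
    noncomm_ring

end AxesContr

/-! ### The localizations U_E and (𝒜/(X, Z))_Y -/

section Loci

variable {k : Type*} [Field k] (q : kˣ)

theorem idl_gY_eq : idl q {gY q} = idl q {gX q, gY q} := by
  refine le_antisymm (TwoSidedIdeal.span_mono (by simp)) (TwoSidedIdeal.span_le.2 ?_)
  have h : gY q ∈ idl q {gY q} := TwoSidedIdeal.subset_span rfl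
  rintro _ (rfl | rfl)
  · exact gX_mem_of_axGen_mem false h
  · exact h

theorem idl_gY_eq' : idl q {gY q} = idl q {gX q, elZ q, gY q} := by
  refine le_antisymm (TwoSidedIdeal.span_mono (by simp)) (TwoSidedIdeal.span_le.2 ?_)
  have h : gY q ∈ idl q {gY q} := TwoSidedIdeal.subset_span rfl
  rintro _ (rfl | rfl | rfl)
  · exact gX_mem_of_axGen_mem false h
  · exact TwoSidedIdeal.mul_mem_right _ _ _ (TwoSidedIdeal.mul_mem_left _ _ _ h)
  · exact h

theorem idl_gE_eq : idl q {gE q} = idl q {gE q, gX q} := by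
  refine le_antisymm (TwoSidedIdeal.span_mono (by simp)) (TwoSidedIdeal.span_le.2 ?_)
  have h : gE q ∈ idl q {gE q} := TwoSidedIdeal.subset_span rfl
  rintro _ (rfl | rfl)
  · exact h
  · exact gX_mem_of_axGen_mem true h

theorem idl_gE_eq' : idl q {gE q} = idl q {gE q, phi q} := by
  refine le_antisymm (TwoSidedIdeal.span_mono (by simp)) (TwoSidedIdeal.span_le.2 ?_)
  have h : gE q ∈ idl q {gE q} := TwoSidedIdeal.subset_span rfl
  rintro _ (rfl | rfl)
  · exact h
  · exact phi_mem_of_axGen_mem true h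

theorem axTorus_true_eq_zero_iff (a : Alg q) :
    axTorus q true a = 0 ↔ a ∈ idl q {gX q, elZ q, gY q} := by
  rw [← idl_gY_eq']
  exact axTorus_eq_zero_iff true a

theorem oreSet_denE : Nonempty (OreSet (denE q)) := by
  have : IsDomain (AXZY q) := isDomain_quo _ (axTorus q true) (axTorus_true_eq_zero_iff q)
  rw [denE, Submonoid.powers_eq_closure]
  refine nonempty_oreSet_closure _ ?_
  rintro _ rfl r
  obtain ⟨a, rfl⟩ := quo_surjective (k := k) _ r
  obtain ⟨r', hr'⟩ := quo_axGen_normal true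
    (I := idl q {gX q, elZ q, gY q}) (TwoSidedIdeal.subset_span (by simp [axGen])) a
  exact ⟨_, Submonoid.subset_closure rfl, _, hr'⟩

theorem exists_UE_equiv [OreSet (denE q)] :
    ∃ e : OreLocalization (denE q) (AXZY q) ≃ₐ[k] YY (axScale q true)⁻¹,
      ∀ a, e (toUE q a) = axTorus q true a := by
  obtain ⟨e, he⟩ := exists_loc_equiv (denE q)
    ((clears_axTorus (q := q) true).quoLift (I := idl q {gX q, elZ q, gY q}) (T := denE q)
      (fun a => (axTorus_true_eq_zero_iff q a).2) (Submonoid.map_powers _ _).symm)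
    (fun a ha => ⟨1, one_mem _, by
      rw [one_mul]
      exact (injective_iff_map_eq_zero _).1
        (quoLift_injective _ (axTorus q true) (axTorus_true_eq_zero_iff q)) a ha⟩)
  exact ⟨e, fun a => he _⟩

theorem contr_toUE (hq : ∀ n : ℕ, 0 < n → q ^ n ≠ 1) [OreSet (denE q)] :
    contr (toUE q) = {idl q {gY q}} := by
  obtain ⟨e, he⟩ := exists_UE_equiv q
  rw [contr_eq_of_equiv e he]
  exact contr_axTorus true hq

theorem injective_comap_toUE [OreSet (denE q)] :
    Function.Injective (TwoSidedIdeal.comap (toUE q)) := by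
  obtain ⟨e, he⟩ := exists_UE_equiv q
  exact ((clears_axTorus true).of_equiv e he).injective_comap

theorem axTorus_false_eq_zero {a : Alg q} (ha : a ∈ idl q {gX q, elZ q}) :
    axTorus q false a = 0 := by
  rw [axTorus_eq_zero_iff]
  have h : gE q ∈ idl q {axGen q (!false)} := TwoSidedIdeal.subset_span rfl
  have hle : idl q {gX q, elZ q} ≤ idl q {axGen q (!false)} := TwoSidedIdeal.span_le.2 (by
    rintro _ (rfl | rfl)
    · exact gX_mem_of_axGen_mem true h
    · exact TwoSidedIdeal.mul_mem_right _ _ _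
        (TwoSidedIdeal.mul_mem_right _ _ _ (phi_mem_of_axGen_mem true h)))
  exact hle ha

variable {q} (hq : ∀ n : ℕ, 0 < n → q ^ n ≠ 1)
include hq

/-- Modulo X, ZK = φY is a nonzero multiple of YEY, and EY = q⁻¹YE. -/
theorem gY_mul_gE_mul_gY_mem {I : TwoSidedIdeal (Alg q)} (hX : gX q ∈ I) (hZ : elZ q ∈ I) :
    gY q ^ 2 * gE q ∈ I := by
  have h1 : phi q * gY q ∈ I := by
    have := I.mul_mem_right _ (gK q) hZ
    rwa [elZ, mul_assoc, gKinv_mul_gK, mul_one] at this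
  have h2 : gY q ^ 2 * gE q = ((q : k) * ((q : k)⁻¹ - q)⁻¹) •
      (phi q * gY q - gX q * gY q) - (q : k) • (gY q * gX q) := by
    have hl := inv_sub_self_ne_zero hq
    have hq0 : (q : k) ≠ 0 := q.ne_zero
    rw [phi_eq, add_mul, add_sub_cancel_left, smul_mul_assoc, mul_assoc, gE_mul_gY, mul_add,
      mul_smul_comm, smul_smul, mul_assoc, inv_mul_cancel₀ hl, mul_one, smul_add, smul_smul,
      mul_inv_cancel₀ hq0, one_smul, add_sub_cancel_left, ← mul_assoc, pow_two]
  rw [h2, Algebra.smul_def, Algebra.smul_def]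
  exact I.sub_mem (I.mul_mem_left _ _ (I.sub_mem h1 (I.mul_mem_right _ _ hX)))
    (I.mul_mem_left _ _ (I.mul_mem_left _ _ hX))

omit hq in
theorem quo_gY_normal {I : TwoSidedIdeal (Alg q)} (hX : gX q ∈ I) (r : Alg q) :
    ∃ r', quo k I (gY q) * quo k I r = quo k I r' * quo k I (gY q) := by
  refine exists_mul_eq_of_gen _ _ (fun x => ?_) r
  have hm : ∀ {x y : Alg q} {c : k}, x * y = c • (y * x) → ∃ c : k,
      quo k I x * quo k I y = c • (quo k I y * quo k I x) := fun {x y c} h =>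
    ⟨c, by rw [← map_mul, h, map_smul, map_mul]⟩
  cases x with
  | E =>
    refine ⟨q, ?_⟩
    have h := congrArg (quo k I) (gE_mul_gY q)
    rw [map_add, map_smul, map_mul, map_mul, (quo_eq_zero_iff I).2 hX, zero_add] at h
    change _ = (q : k) • (quo k I (gE q) * _)
    rw [h, smul_smul, mul_inv_cancel₀ (by simp), one_smul]
  | K => exact hm (gY_mul_gK q)
  | Kinv => exact hm (mul_eq_inv_smul (by simp) (gKinv_mul_gY q))
  | X => exact hm (gY_mul_gX q)
  | Y => exact ⟨1, (one_smul _ _).symm⟩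

/-- Y²E = 0 in 𝒜/(X, Z) and Y is normal there, so Y² annihilates the whole ideal (E). Thus (E)
becomes zero when Y is inverted. -/
theorem gY_sq_mul_eq_zero {a : Alg q} (h : axTorus q false a = 0) :
    quo k (idl q {gX q, elZ q}) (gY q) ^ 2 * quo k (idl q {gX q, elZ q}) a = 0 := by
  rw [axTorus_eq_zero_iff] at h
  have hX : gX q ∈ idl q {gX q, elZ q} := TwoSidedIdeal.subset_span (by simp)
  have hZ : elZ q ∈ idl q {gX q, elZ q} := TwoSidedIdeal.subset_span (by simp)
  induction h using TwoSidedIdeal.span_induction with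
  | mem x hx =>
    obtain rfl := hx
    rw [← map_pow, ← map_mul, quo_eq_zero_iff]
    exact gY_mul_gE_mul_gY_mem hq hX hZ
  | zero => rw [map_zero, mul_zero]
  | add x y _ _ hx hy => rw [map_add, mul_add, hx, hy, add_zero]
  | neg x _ hx => rw [map_neg, mul_neg, hx, neg_zero]
  | left_absorb r x _ hx =>
    obtain ⟨r', h1⟩ := quo_gY_normal hX r
    obtain ⟨r'', h2⟩ := quo_gY_normal hX r'
    rw [map_mul, pow_two, mul_assoc, ← mul_assoc _ _ (quo k _ x), h1, mul_assoc, ← mul_assoc, h2,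
      mul_assoc, ← mul_assoc (quo k _ (gY q)), ← pow_two, hx, mul_zero]
  | right_absorb r x _ hx => rw [map_mul, ← mul_assoc, hx, zero_mul]

/-- 𝒜/(X, Z) is not a domain (Y²E = 0), so the reversibility half of the Ore condition has to be
proved too. If rYⁿ = 0, then r dies in the torus where Y is a unit, so r lies in the image of (E)
and Y²r = 0. -/
theorem oreSet_denY : Nonempty (OreSet (denY q)) := by
  have hX : gX q ∈ idl q {gX q, elZ q} := TwoSidedIdeal.subset_span (by simp)
  refine OreLocalization.nonempty_oreSet_iff.2 ⟨?_, ?_⟩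
  · rintro r₁ r₂ ⟨_, n, rfl⟩ h
    obtain ⟨a, ha⟩ := quo_surjective (k := k) _ (r₁ - r₂)
    -- The same exponent 2 works for every n, since Y² kills all of (E).
    refine ⟨⟨_, 2, rfl⟩, ?_⟩
    have h1 : quo k (idl q {gX q, elZ q}) (a * gY q ^ n) = 0 := by
      rw [map_mul, ha, map_pow, sub_mul, sub_eq_zero]
      exact h
    have h2 := axTorus_false_eq_zero q ((quo_eq_zero_iff _).1 h1)
    rw [map_mul, map_pow] at h2
    have h3 := (((isScaled_axTorus (q := q) false).isUnit (yy_isTwisted _)).pow n)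
    have h4 := gY_sq_mul_eq_zero hq ((h3.mul_left_eq_zero).1 h2)
    rw [ha, mul_sub, sub_eq_zero] at h4
    exact h4
  · rintro r ⟨_, n, rfl⟩
    have key : ∀ n : ℕ, ∃ r', quo k (idl q {gX q, elZ q}) (gY q) ^ n * r =
        r' * quo k (idl q {gX q, elZ q}) (gY q) ^ n := by
      intro n
      induction n with
      | zero => exact ⟨r, by simp⟩
      | succ n ih =>
        obtain ⟨r', h1⟩ := ih
        obtain ⟨a, rfl⟩ := quo_surjective (k := k) _ r'
        obtain ⟨r'', h2⟩ := quo_gY_normal hX a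
        exact ⟨_, by rw [pow_succ', mul_assoc, h1, ← mul_assoc, h2, mul_assoc]⟩
    obtain ⟨r', h⟩ := key n
    exact ⟨r', ⟨_, n, rfl⟩, h⟩

theorem exists_AXZloc_equiv [OreSet (denY q)] :
    ∃ e : OreLocalization (denY q) (AXZ q) ≃ₐ[k] YY (axScale q false)⁻¹,
      ∀ a, e (toAXZloc q a) = axTorus q false a := by
  obtain ⟨e, he⟩ := exists_loc_equiv (denY q)
    ((clears_axTorus (q := q) false).quoLift (I := idl q {gX q, elZ q}) (T := denY q)
      (fun a => axTorus_false_eq_zero q) (Submonoid.map_powers _ _).symm)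
    (fun x hx => by
      obtain ⟨a, rfl⟩ := quo_surjective (k := k) _ x
      exact ⟨_, ⟨2, rfl⟩, gY_sq_mul_eq_zero hq hx⟩)
  exact ⟨e, fun a => he _⟩

theorem contr_toAXZloc [OreSet (denY q)] : contr (toAXZloc q) = {idl q {gE q}} := by
  obtain ⟨e, he⟩ := exists_AXZloc_equiv hq
  rw [contr_eq_of_equiv e he]
  exact contr_axTorus false hq

theorem injective_comap_toAXZloc [OreSet (denY q)] :
    Function.Injective (TwoSidedIdeal.comap (toAXZloc q)) := by
  obtain ⟨e, he⟩ := exists_AXZloc_equiv hq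
  exact ((clears_axTorus false).of_equiv e he).injective_comap

theorem exists_AXZloc_equiv_yy [OreSet (denY q)] :
    ∃ e : OreLocalization (denY q) (AXZ q) ≃ₐ[k] YY q,
      e (toAXZloc q (gY q)) = yyY q ∧ e (toAXZloc q (gK q)) = yyK q := by
  obtain ⟨e, he⟩ := exists_AXZloc_equiv hq
  have hY := (he (gY q)).trans (axTorus_axGen false)
  have hK := (he (gK q)).trans (axTorus_gK false)
  rw [← yyY_eq] at hY
  rw [← yyK_eq] at hK
  have h : (axScale q false)⁻¹ = q := inv_inv q
  -- The parameter (q⁻¹)⁻¹ is equal to q, but the type of `e` depends on it. Hence `e` and its two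
  -- properties are generalized before rewriting.
  clear he
  revert e
  rw [h]
  exact fun e hY hK => ⟨e, hY, hK⟩

end Loci

end

end QAge

namespace QAge

noncomputable section

open scoped TensorProduct

/-! The primes containing `Y` and `E` -/

section Lower

variable {k : Type*} [Field k] (q : kˣ)

theorem toL_gen (x : Gen) : toL q (gen q x) = genL x := by
  refine (RingQuot.liftAlgHom_mkAlgHom_apply k _ _ _).trans ?_
  rw [FreeAlgebra.lift_ι_apply]

theorem toL_Kz (n : ℤ) : toL q (Kz q n) = LaurentPolynomial.T n := by
  induction n with
  | zero => simp [Kz_zero]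
  | succ n ih =>
    rw [← gK_mul_Kz, map_mul, ih, toL_gen, add_comm]
    exact (LaurentPolynomial.T_add _ _).symm
  | pred n ih =>
    rw [← gKinv_mul_Kz, map_mul, ih, toL_gen, sub_eq_neg_add]
    exact (LaurentPolynomial.T_add _ _).symm

theorem toL_laurentK (p : LaurentPolynomial k) : toL q (laurentK q p) = p := by
  have h : (toL q).comp (laurentK q) = AlgHom.id k (LaurentPolynomial k) :=
    AddMonoidAlgebra.algHom_ext (fun n => by
      change toL q (laurentK q (LaurentPolynomial.T n)) = LaurentPolynomial.T n
      rw [laurentK_T, toL_Kz]) (Subsingleton.elim _ _)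
  exact DFunLike.congr_fun h p

theorem toL_surjective : Function.Surjective (toL q) := fun p => ⟨_, toL_laurentK q p⟩

/-- Modulo Y and E the quotient map factors through `toL`, as is seen on generators. Hence
membership in any ideal containing Y and E is decided in k[K, K⁻¹]. -/
theorem sub_laurentK_toL_mem (a : Alg q) : a - laurentK q (toL q a) ∈ idl q {gY q, gE q} := by
  rw [← quo_eq_zero_iff (k := k), map_sub, sub_eq_zero]
  have hY : gY q ∈ idl q {gY q, gE q} := TwoSidedIdeal.subset_span (by simp)
  have hE : gE q ∈ idl q {gY q, gE q} := TwoSidedIdeal.subset_span (by simp)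
  have h : quo k (idl q {gY q, gE q}) = ((quo k _).comp (laurentK q)).comp (toL q) := by
    refine algHom_ext_gen fun x => ?_
    rw [AlgHom.comp_apply, toL_gen]
    cases x with
    | E => rw [genL, map_zero, (quo_eq_zero_iff _).2 hE]
    | Y => rw [genL, map_zero, (quo_eq_zero_iff _).2 hY]
    | X => rw [genL, map_zero, (quo_eq_zero_iff _).2 (gX_mem_of_axGen_mem true hE)]
    | K => rw [genL, AlgHom.comp_apply, laurentK_T, ← zero_add (1 : ℤ), ← gK_mul_Kz, Kz_zero, mul_one]
    | Kinv =>
      rw [genL, AlgHom.comp_apply, laurentK_T, ← zero_sub (1 : ℤ), ← gKinv_mul_Kz, Kz_zero, mul_one]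
  exact DFunLike.congr_fun h a

theorem idl_le_idlYEp (p : Ideal (LaurentPolynomial k)) : idl q {gY q, gE q} ≤ idlYEp q p :=
  TwoSidedIdeal.span_mono Set.subset_union_left

theorem mem_idlYEp_iff (p : Ideal (LaurentPolynomial k)) (a : Alg q) :
    a ∈ idlYEp q p ↔ toL q a ∈ p := by
  constructor
  · intro h
    rw [← Ideal.Quotient.eq_zero_iff_mem]
    refine map_eq_zero_of_mem_span ((Ideal.Quotient.mkₐ k p).comp (toL q)) ?_ h
    rintro _ ((rfl | rfl) | ⟨x, hx, rfl⟩)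
    · rw [AlgHom.comp_apply, toL_gen, genL, map_zero]
    · rw [AlgHom.comp_apply, toL_gen, genL, map_zero]
    · rw [AlgHom.comp_apply, toL_laurentK]
      exact Ideal.Quotient.eq_zero_iff_mem.2 hx
  · intro h
    have h1 : laurentK q (toL q a) ∈ idlYEp q p :=
      TwoSidedIdeal.subset_span (Or.inr ⟨_, h, rfl⟩)
    simpa using add_mem (idl_le_idlYEp q p (sub_laurentK_toL_mem q a)) h1

theorem idlYEp_bot : idlYEp q ⊥ = idl q {gY q, gE q} := by
  refine le_antisymm (TwoSidedIdeal.span_le.2 ?_) (idl_le_idlYEp q ⊥)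
  rintro _ (h | ⟨x, hx, rfl⟩)
  · exact TwoSidedIdeal.subset_span h
  · rw [SetLike.mem_coe, Ideal.mem_bot] at hx
    rw [hx, map_zero]
    exact zero_mem _

theorem isPrimeIdeal_idlYEp {p : Ideal (LaurentPolynomial k)} (hp : p.IsPrime) :
    IsPrimeIdeal (idlYEp q p) :=
  isPrimeIdeal_of_ker ((Ideal.Quotient.mkₐ k p).comp (toL q)).toRingHom fun a => by
    rw [mem_idlYEp_iff, ← Ideal.Quotient.eq_zero_iff_mem]
    rfl

theorem contr_toL : contr (toL q) =
    {P | ∃ p : Ideal (LaurentPolynomial k), p.IsPrime ∧ P = idlYEp q p} := by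
  ext P
  constructor
  · rintro ⟨Q, hQ, rfl⟩
    refine ⟨Q.asIdeal, (mem_spec_iff_of_comm Q).1 hQ, ?_⟩
    ext a
    rw [TwoSidedIdeal.mem_comap, mem_idlYEp_iff, TwoSidedIdeal.mem_asIdeal]
  · rintro ⟨p, hp, rfl⟩
    refine ⟨p.toTwoSided, (mem_spec_iff_of_comm _).2 (by simpa using hp), ?_⟩
    ext a
    rw [TwoSidedIdeal.mem_comap, mem_idlYEp_iff, Ideal.mem_toTwoSided]

theorem injective_comap_toL : Function.Injective (TwoSidedIdeal.comap (toL q)) :=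
  (clears_of_surjective (toL_surjective q) ⊥ (by
    rintro _ rfl; rw [map_one]; exact isUnit_one)).injective_comap

theorem exists_quo_idlYEp_equiv (p : Ideal (LaurentPolynomial k)) :
    ∃ e : Quo (idlYEp q p) ≃ₐ[k] (LaurentPolynomial k ⧸ p),
      e (quo k _ (gK q)) = Ideal.Quotient.mk p (LaurentPolynomial.T 1) := by
  obtain ⟨e, he⟩ := exists_quo_equiv (idlYEp q p) ((Ideal.Quotient.mkₐ k p).comp (toL q))
    ((Ideal.Quotient.mkₐ_surjective k p).comp (toL_surjective q)) fun a => by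
      rw [mem_idlYEp_iff, ← Ideal.Quotient.eq_zero_iff_mem]
      rfl
  refine ⟨e, ?_⟩
  rw [he, AlgHom.comp_apply, toL_gen]
  rfl

variable {q} in
/-- A prime containing `Y` and `E` is one of the ideals `(Y, E, 𝔭)`. -/
theorem exists_eq_idlYEp {P : TwoSidedIdeal (Alg q)} (hP : IsPrimeIdeal P) (hY : gY q ∈ P)
    (hE : gE q ∈ P) : ∃ p : Ideal (LaurentPolynomial k), p.IsPrime ∧ P = idlYEp q p := by
  have hle : idl q {gY q, gE q} ≤ P := TwoSidedIdeal.span_le.2 (by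
    rintro _ (rfl | rfl)
    · exact hY
    · exact hE)
  have hmem : ∀ a, laurentK q (toL q a) ∈ P ↔ a ∈ P := fun a => by
    have h := hle (sub_laurentK_toL_mem q a)
    exact ⟨fun h1 => by simpa using P.add_mem h h1, fun h1 => by simpa using P.sub_mem h1 h⟩
  let p := (TwoSidedIdeal.comap (laurentK q) P).asIdeal
  have hp : ∀ x, x ∈ p ↔ laurentK q x ∈ P := fun x => by
    rw [TwoSidedIdeal.mem_asIdeal, TwoSidedIdeal.mem_comap]
  refine ⟨p, ⟨fun h => hP.one_notMem ?_, fun {x y} hxy => ?_⟩, ?_⟩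
  · have := (hp 1).1 (h ▸ Submodule.mem_top)
    rwa [map_one] at this
  · rw [hp, map_mul] at hxy
    rw [hp, hp]
    refine hP.mem_or_mem fun r => ?_
    rw [← hmem]
    -- Passing to the commutative ring k[K, K⁻¹] allows r to be moved out from between the two
    -- factors.
    have h1 : toL q (laurentK q x * r * laurentK q y) = toL q r * (x * y) := by
      rw [map_mul, map_mul, toL_laurentK, toL_laurentK, mul_comm x, mul_assoc]
    rw [h1, map_mul, map_mul]
    exact P.mul_mem_left _ _ hxy
  · ext a
    rw [mem_idlYEp_iff, hp, hmem]

theorem isCoatom_idlYEp (p : MaximalSpectrum (LaurentPolynomial k)) :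
    IsCoatom (idlYEp q p.asIdeal) := by
  refine ⟨fun h => p.isMaximal.ne_top ((Ideal.eq_top_iff_one _).2 ?_), fun J hJ => ?_⟩
  · have : (1 : Alg q) ∈ idlYEp q p.asIdeal := h ▸ trivial
    rwa [mem_idlYEp_iff, map_one] at this
  · obtain ⟨hle, x, hx, hxI⟩ := SetLike.lt_iff_le_and_exists.1 hJ
    rw [mem_idlYEp_iff] at hxI
    obtain ⟨y, z, hz, h⟩ := p.isMaximal.exists_inv hxI
    have h1 : (1 : Alg q) - laurentK q y * x ∈ idlYEp q p.asIdeal := by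
      rw [mem_idlYEp_iff, map_sub, map_one, map_mul, toL_laurentK, ← h, add_sub_cancel_left]
      exact hz
    exact eq_top_of_one_mem (by simpa using J.add_mem (hle h1) (J.mul_mem_left (laurentK q y) _ hx))

end Lower

end

end QAge

namespace QAge

noncomputable section

open scoped TensorProduct

theorem linearIndependent_of_map {K V W ι κ : Type*} [Field K] [AddCommGroup V] [Module K V]
    [AddCommGroup W] [Module K W] (f : V →ₗ[K] W) (v : ι → V) (b : Module.Basis κ K W)
    (σ : ι → κ) (hσ : Function.Injective σ) (h : ∀ i, ∃ u : K, u ≠ 0 ∧ f (v i) = u • b (σ i)) :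
    LinearIndependent K v := by
  refine LinearIndependent.of_comp f ?_
  choose u hu hf using h
  have h1 := (b.linearIndependent.comp σ hσ).units_smul (fun i => Units.mk0 (u i) (hu i))
  convert h1 using 1
  ext i
  exact hf i

/-! The quantum plane -/

section Plane

variable {k : Type*} [Field k] (c : kˣ)

theorem planeE_mul_planeY : planeE c * planeY c = (c : k) • (planeY c * planeE c) := by
  have h := RingQuot.mkAlgHom_rel k (PlaneRel.EY (c := c))
  simpa [planeE, planeY] using h

theorem adjoin_plane : Algebra.adjoin k {planeE c, planeY c} = ⊤ := by
  have h := congrArg (Subalgebra.map (RingQuot.mkAlgHom k (PlaneRel c)))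
    (FreeAlgebra.adjoin_range_ι k (Fin 2))
  rw [AlgHom.map_adjoin, Algebra.map_top, ← Set.range_comp,
    (AlgHom.range_eq_top _).2 (RingQuot.mkAlgHom_surjective k (PlaneRel c))] at h
  rw [← h]
  congr 1
  ext x
  simp [planeE, planeY, Fin.exists_fin_two, eq_comm]

theorem span_plane : Submodule.span k
    (Set.range fun x : ℕ × ℕ => planeY c ^ x.1 * planeE c ^ x.2) = ⊤ := by
  refine submodule_eq_top_of_mul_mem _ (adjoin_plane c) _
    (Submodule.subset_span ⟨(0, 0), by simp⟩) ?_
  rintro _ (rfl | rfl) <;> refine mul_span_le _ _ ?_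
  · rintro ⟨a, b⟩
    dsimp only
    rw [← mul_assoc, mul_pow_of_mul_eq_smul (planeE_mul_planeY c), smul_mul_assoc, mul_assoc,
      ← pow_succ']
    exact Submodule.smul_mem _ _ (Submodule.subset_span ⟨(a, b + 1), rfl⟩)
  · rintro ⟨a, b⟩
    dsimp only
    rw [← mul_assoc, ← pow_succ']
    exact Submodule.subset_span ⟨(a + 1, b), rfl⟩

variable {B : Type*} [Ring B] [Algebra k B]

theorem exists_planeLift {e y : B} (h : e * y = (c : k) • (y * e)) :
    ∃ f : Plane c →ₐ[k] B, f (planeE c) = e ∧ f (planeY c) = y := by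
  let F : FreeAlgebra k (Fin 2) →ₐ[k] B := FreeAlgebra.lift k ![e, y]
  have hF : ∀ ⦃a b⦄, PlaneRel c a b → F a = F b := by
    rintro _ _ ⟨⟩
    simpa [F] using h
  refine ⟨RingQuot.liftAlgHom k ⟨F, hF⟩, ?_, ?_⟩
  · refine (RingQuot.liftAlgHom_mkAlgHom_apply k F hF _).trans ?_
    simp [F]
  · refine (RingQuot.liftAlgHom_mkAlgHom_apply k F hF _).trans ?_
    simp [F]

theorem plane_ext {f g : Plane c →ₐ[k] B} (hE : f (planeE c) = g (planeE c))
    (hY : f (planeY c) = g (planeY c)) : f = g := by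
  refine AlgHom.ext_of_adjoin_eq_top (adjoin_plane c) ?_
  rintro _ (rfl | rfl)
  · exact hE
  · exact hY

theorem exists_planeScale (a b : kˣ) : ∃ σ : Plane c ≃ₐ[k] Plane c,
    σ (planeE c) = (a : k) • planeE c ∧ σ (planeY c) = (b : k) • planeY c := by
  have h : ∀ a b : k, (a • planeE c) * (b • planeY c) =
      (c : k) • ((b • planeY c) * (a • planeE c)) := fun a b => by
    rw [smul_mul_smul_comm, smul_mul_smul_comm, planeE_mul_planeY, smul_comm, mul_comm a]
  obtain ⟨f, hf⟩ := exists_planeLift c (h a b)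
  obtain ⟨g, hg⟩ := exists_planeLift c (h ((a⁻¹ : kˣ) : k) ((b⁻¹ : kˣ) : k))
  refine ⟨AlgEquiv.ofAlgHom f g (plane_ext c ?_ ?_) (plane_ext c ?_ ?_), hf⟩ <;>
    simp [hf, hg, smul_smul]

end Plane

/-! The factor algebras of `𝔼` and the skew Laurent structure of `𝒜/(X)` and `𝒜/(φ)` -/

section Coefficients

variable {k : Type*} [Field k] (q : kˣ)

/-- The elements `X` and `φ` of `𝔼`. -/
def eN : Bool → EE q
  | true => eX q
  | false => ePhi q

/-- The parameters of the quantum planes `𝔼/(X)` and `𝔼/(φ)`. -/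
def planeScalar : Bool → kˣ
  | true => q⁻¹
  | false => q

theorem coe_eN (i : Bool) : (eN q i : Alg q) = nrm q i := by
  cases i <;> rfl

variable {q} (i : Bool)

/-- The factor algebras `𝔼/(X)` and `𝔼/(φ)`. -/
abbrev EN (q : kˣ) (i : Bool) : Type _ := Quo (TwoSidedIdeal.span {eN q i})

/-- The image of `E` in `𝔼/(X)` or `𝔼/(φ)`. -/
abbrev nE (q : kˣ) (i : Bool) : EN q i := quo k _ (eE q)
/-- The image of `Y` in `𝔼/(X)` or `𝔼/(φ)`. -/
abbrev nY (q : kˣ) (i : Bool) : EN q i := quo k _ (eY q)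
/-- The image of `X` in `𝔼/(X)` or `𝔼/(φ)`. -/
abbrev nX (q : kˣ) (i : Bool) : EN q i := quo k _ (eX q)

theorem nE_mul_nY : nE q i * nY q i = nX q i + (q : k)⁻¹ • (nY q i * nE q i) := by
  have h : eE q * eY q = eX q + (q : k)⁻¹ • (eY q * eE q) := Subtype.ext (gE_mul_gY q)
  rw [← map_mul, h, map_add, map_smul, map_mul]

theorem nE_mul_nX : nE q i * nX q i = (q : k) • (nX q i * nE q i) := by
  have h : eE q * eX q = (q : k) • (eX q * eE q) := Subtype.ext (gE_mul_gX q)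
  rw [← map_mul, h, map_smul, map_mul]

theorem nX_mul_nY : nX q i * nY q i = (q : k) • (nY q i * nX q i) := by
  have h : eX q * eY q = (q : k) • (eY q * eX q) := Subtype.ext (gX_mul_gY q)
  rw [← map_mul, h, map_smul, map_mul]

/-- With c the parameter of the plane, X = (c - q⁻¹)YE treats both branches at once: c = q⁻¹ means X
= 0, and c = q means φ = 0. -/
theorem nX_eq : nX q i = ((planeScalar q i : k) - (q : k)⁻¹) • (nY q i * nE q i) := by
  have h0 : quo k (TwoSidedIdeal.span {eN q i}) (eN q i) = 0 :=
    (quo_eq_zero_iff _).2 (TwoSidedIdeal.subset_span rfl)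
  cases i
  · have h : quo k (TwoSidedIdeal.span {eN q false}) (ePhi q) = 0 := h0
    rw [ePhi, map_add, map_smul, map_mul] at h
    refine (eq_neg_of_add_eq_zero_left h).trans ?_
    rw [← neg_smul, neg_sub, planeScalar, Units.val_inv_eq_inv_val]
  · have h : quo k (TwoSidedIdeal.span {eN q true}) (eX q) = 0 := h0
    rw [nX, h, planeScalar, Units.val_inv_eq_inv_val, sub_self, zero_smul]

theorem nE_mul_nY' : nE q i * nY q i = (planeScalar q i : k) • (nY q i * nE q i) := by
  rw [nE_mul_nY, nX_eq, ← add_smul, sub_add_cancel]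

theorem adjoin_EE : Algebra.adjoin k {eX q, eE q, eY q} = ⊤ := by
  have h := Algebra.adjoin_adjoin_coe_preimage (R := k) (s := {gX q, gE q, gY q})
  refine Eq.trans ?_ h
  congr 1
  ext x
  simp only [Set.mem_insert_iff, Set.mem_singleton_iff, Subtype.ext_iff]
  rfl

/-- The homomorphism from the quantum plane to `𝔼/(X)` or `𝔼/(φ)`. -/
def planeHom (q : kˣ) (i : Bool) : Plane (planeScalar q i) →ₐ[k] EN q i :=
  Classical.choose (exists_planeLift _ (nE_mul_nY' i))

theorem planeHom_planeE : planeHom q i (planeE _) = nE q i :=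
  (Classical.choose_spec (exists_planeLift _ (nE_mul_nY' i))).1

theorem planeHom_planeY : planeHom q i (planeY _) = nY q i :=
  (Classical.choose_spec (exists_planeLift _ (nE_mul_nY' i))).2

theorem planeHom_surjective : Function.Surjective (planeHom q i) := by
  rw [← AlgHom.range_eq_top, eq_top_iff]
  have h := congrArg (Subalgebra.map (quo k (TwoSidedIdeal.span {eN q i}))) (adjoin_EE (q := q))
  rw [AlgHom.map_adjoin, Algebra.map_top, (AlgHom.range_eq_top _).2 (quo_surjective _)] at h
  rw [← h, Algebra.adjoin_le_iff]
  have hE : nE q i ∈ (planeHom q i).range := ⟨_, planeHom_planeE i⟩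
  have hY : nY q i ∈ (planeHom q i).range := ⟨_, planeHom_planeY i⟩
  rintro _ ⟨x, (rfl | rfl | rfl), rfl⟩
  · change nX q i ∈ (planeHom q i).range
    rw [nX_eq]
    exact Subalgebra.smul_mem _ (Subalgebra.mul_mem _ hY hE) _
  · exact hE
  · exact hY

theorem span_EN : Submodule.span k
    (Set.range fun x : ℕ × ℕ => nY q i ^ x.1 * nE q i ^ x.2) = ⊤ := by
  have h := congrArg (Submodule.map (planeHom q i).toLinearMap) (span_plane (planeScalar q i))
  rw [Submodule.map_span, Submodule.map_top, ← Set.range_comp,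
    LinearMap.range_eq_top.2 (planeHom_surjective i)] at h
  rw [← h]
  congr 2
  ext x
  simp [planeHom_planeE, planeHom_planeY]

theorem exists_quo_nrm_equiv_of_basis {B : Type*} [Ring B] [Algebra k B] (f : Alg q →ₐ[k] B)
    (h0 : f (nrm q i) = 0) (b : Module.Basis ((ℕ × ℕ) × ℤ) k B)
    (hb : ∀ j, f (monoYE q j) = b j) :
    ∃ e : Quo (idl q {nrm q i}) ≃ₐ[k] B, ∀ a, e (quo k _ a) = f a := by
  have h0 : ∀ a ∈ idl q {nrm q i}, f a = 0 := fun a => map_eq_zero_of_mem_span _ (by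
    rintro _ rfl
    exact h0)
  obtain ⟨s, hs⟩ := quo_gX (I := idl q {nrm q i}) i (TwoSidedIdeal.subset_span rfl)
  have hinj := linearMap_injective_of_span (quoLift _ f h0).toLinearMap
    (fun j => quo k _ (monoYE q j)) (span_monoYE _ (quo_surjective _) s hs)
    b id Function.injective_id fun j => ⟨1, one_ne_zero, by rw [one_smul]; exact hb j⟩
  have h1 : Submodule.span k (Set.range b) ≤ LinearMap.range f.toLinearMap := by
    rw [Submodule.span_le]
    rintro _ ⟨x, rfl⟩
    exact ⟨_, hb x⟩
  rw [Module.Basis.span_eq] at h1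
  refine exists_quo_equiv (idl q {nrm q i}) f (fun x => h1 Submodule.mem_top) fun a => ?_
  refine ⟨fun ha => ?_, h0 a⟩
  rw [← quo_eq_zero_iff (k := k)]
  exact hinj (ha.trans (map_zero _).symm)

variable (hq : ∀ n : ℕ, 0 < n → q ^ n ≠ 1)

/-- The homomorphism from `𝔼/(X)` or `𝔼/(φ)` to `k[T, T⁻¹] ⊗ 𝕐`. -/
def lauEN : EN q i →ₐ[k] LaurentPolynomial k ⊗[k] YY q :=
  quoLift _ ((lau hq i).comp (EE q).val) fun a ha =>
    map_eq_zero_of_mem_span _ (by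
      rintro _ rfl
      rw [AlgHom.comp_apply, Subalgebra.val_apply, coe_eN]
      exact chart_nrm hq i _) ha

theorem isScaled_lauEN (x : ℕ × ℕ) :
    IsScaled (lauBasis q) (lauEN i hq (nY q i ^ x.1 * nE q i ^ x.2))
      (x.2, (x.1 - 2 * x.2, eps i * x.2 + 0)) := by
  have h := isScaled_lau_monoYE hq i x.1 x.2 0
  rw [monoYE, Kz_zero, mul_one, map_mul, map_pow, map_pow] at h
  rw [map_mul, map_pow, map_pow]
  exact h

theorem exponents_injective : Function.Injective
    fun x : ℕ × ℕ => ((x.2 : ℤ), ((x.1 : ℤ) - 2 * x.2, eps i * x.2 + 0)) := by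
  rintro ⟨a, b⟩ ⟨a', b'⟩ h
  simp only [Prod.mk.injEq] at h ⊢
  omega

include hq in
-- Independence is pulled back from the torus: the restriction of `lau` to 𝔼 factors through 𝔼/(X)
-- or 𝔼/(φ) and sends the monomials to multiples of distinct basis vectors.
theorem linearIndependent_EN :
    LinearIndependent k fun x : ℕ × ℕ => nY q i ^ x.1 * nE q i ^ x.2 := by
  exact linearIndependent_of_map (lauEN i hq).toLinearMap _ (lauBasis q) _
    (exponents_injective i) (isScaled_lauEN i hq)

/-- The monomial basis of `𝔼/(X)` or `𝔼/(φ)`. -/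
def basisEN : Module.Basis (ℕ × ℕ) k (EN q i) :=
  Module.Basis.mk (linearIndependent_EN i hq) (span_EN i).ge

theorem basisEN_apply (x : ℕ × ℕ) : basisEN i hq x = nY q i ^ x.1 * nE q i ^ x.2 := by
  rw [basisEN, Module.Basis.mk_apply]

include hq

theorem exists_EN_equiv_plane : ∃ g : EN q i ≃ₐ[k] Plane (planeScalar q i),
    g (nE q i) = planeE _ ∧ g (nY q i) = planeY _ := by
  have hinj : Function.Injective (planeHom q i) :=
    linearMap_injective_of_span (planeHom q i).toLinearMap _ (span_plane _) (basisEN i hq) id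
      Function.injective_id fun x => ⟨1, one_ne_zero, by
        simp [basisEN_apply, planeHom_planeE, planeHom_planeY]⟩
  let e := AlgEquiv.ofBijective (planeHom q i) ⟨hinj, planeHom_surjective i⟩
  refine ⟨e.symm, ?_, ?_⟩
  · rw [AlgEquiv.symm_apply_eq]
    exact (planeHom_planeE i).symm
  · rw [AlgEquiv.symm_apply_eq]
    exact (planeHom_planeY i).symm

/-- The automorphism is transported from the quantum plane, whose one relation is homogeneous in E
and in Y and therefore invariant under independent scalings. -/
theorem exists_scaling_EN : ∃ τ : EN q i ≃ₐ[k] EN q i,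
    τ (nE q i) = ((q ^ 2 : kˣ) : k) • nE q i ∧ τ (nY q i) = ((q⁻¹ : kˣ) : k) • nY q i := by
  obtain ⟨g, hE, hY⟩ := exists_EN_equiv_plane i hq
  obtain ⟨σ, hσE, hσY⟩ := exists_planeScale (planeScalar q i) (q ^ 2) q⁻¹
  refine ⟨(g.trans σ).trans g.symm, ?_, ?_⟩
  · rw [AlgEquiv.trans_apply, AlgEquiv.trans_apply, hE, hσE, map_smul, ← hE,
      AlgEquiv.symm_apply_apply]
  · rw [AlgEquiv.trans_apply, AlgEquiv.trans_apply, hY, hσY, map_smul, ← hY,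
      AlgEquiv.symm_apply_apply]

omit hq in
theorem exists_skewHom {τ : EN q i ≃ₐ[k] EN q i}
    (hE : τ (nE q i) = ((q ^ 2 : kˣ) : k) • nE q i)
    (hY : τ (nY q i) = ((q⁻¹ : kˣ) : k) • nY q i) :
    ∃ f : Alg q →ₐ[k] SkewLaurent τ, (∀ a : EE q, f a = SkewLaurent.coef τ (quo k _ a)) ∧
      f (gK q) = SkewLaurent.t τ ∧ ∀ n : ℤ, f (Kz q n) = SkewLaurent.tz τ n := by
  have hq0 : (q : k) ≠ 0 := q.ne_zero
  have hX : τ (nX q i) = (q : k) • nX q i := by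
    rw [nX_eq, map_smul, map_mul, hE, hY, smul_mul_smul_comm, smul_comm]
    congr 2
    rw [← Units.val_mul]
    congr 1
    rw [pow_two, inv_mul_cancel_left]
  have hcom : ∀ {x : EN q i} {c : k}, c ≠ 0 → τ x = c • x →
      SkewLaurent.coef τ x * SkewLaurent.t τ =
        c⁻¹ • (SkewLaurent.t τ * SkewLaurent.coef τ x) := by
    intro x c hc h
    have h1 := SkewLaurent.tz_mul_coef τ x 1
    rw [zpow_one, h, map_smul, smul_mul_assoc, SkewLaurent.tz_one] at h1
    exact mul_eq_inv_smul hc h1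
  have hEK := hcom (Units.ne_zero _) hE
  have hYK := hcom (Units.ne_zero _) hY
  rw [Units.val_pow_eq_pow_val] at hEK
  rw [Units.val_inv_eq_inv_val, inv_inv] at hYK
  have hEX : SkewLaurent.coef τ (nE q i) * SkewLaurent.coef τ (nX q i) =
      (q : k) • (SkewLaurent.coef τ (nX q i) * SkewLaurent.coef τ (nE q i)) := by
    rw [← map_mul, nE_mul_nX, map_smul, map_mul]
  have hEY : SkewLaurent.coef τ (nE q i) * SkewLaurent.coef τ (nY q i) =
      SkewLaurent.coef τ (nX q i) +
        (q : k)⁻¹ • (SkewLaurent.coef τ (nY q i) * SkewLaurent.coef τ (nE q i)) := by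
    rw [← map_mul, nE_mul_nY, map_add, map_smul, map_mul]
  have hYX : (q : k) • (SkewLaurent.coef τ (nY q i) * SkewLaurent.coef τ (nX q i)) =
      SkewLaurent.coef τ (nX q i) * SkewLaurent.coef τ (nY q i) := by
    rw [← map_mul (SkewLaurent.coef τ) (nX q i), nX_mul_nY, map_smul, map_mul]
  obtain ⟨f, hf⟩ := exists_lift q (B := SkewLaurent τ) (g := fun
      | .E => SkewLaurent.coef τ (nE q i) | .K => SkewLaurent.t τ
      | .Kinv => SkewLaurent.tz τ (-1) | .X => SkewLaurent.coef τ (nX q i)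
      | .Y => SkewLaurent.coef τ (nY q i))
    { K_Kinv := SkewLaurent.tz_mul_tz τ 1 (-1)
      Kinv_K := SkewLaurent.tz_mul_tz τ (-1) 1
      EK := hEK
      XK := hcom hq0 hX
      YK := hYK
      EX := hEX
      EY := hEY
      YX := hYX }
  have hfE : f (gE q) = SkewLaurent.coef τ (nE q i) := hf .E
  have hfX : f (gX q) = SkewLaurent.coef τ (nX q i) := hf .X
  have hfY : f (gY q) = SkewLaurent.coef τ (nY q i) := hf .Y
  have hfK : f (gK q) = SkewLaurent.t τ := hf .K
  have hEE : ∀ a : EE q, f a = SkewLaurent.coef τ (quo k _ a) := by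
    have : f.comp (EE q).val = (SkewLaurent.coef τ).comp (quo k _) := by
      refine AlgHom.ext_of_adjoin_eq_top adjoin_EE ?_
      rintro _ (rfl | rfl | rfl)
      · exact hfX
      · exact hfE
      · exact hfY
    exact fun a => DFunLike.congr_fun this a
  have hKz : ∀ n : ℤ, f (Kz q n) = SkewLaurent.tz τ n := by
    intro n
    induction n with
    | zero => rw [Kz_zero, map_one]; rfl
    | succ n ih => rw [← gK_mul_Kz, map_mul, ih, hfK, add_comm]; exact SkewLaurent.tz_mul_tz τ 1 _
    | pred n ih =>
      rw [← gKinv_mul_Kz, map_mul, ih, sub_eq_neg_add, hf .Kinv]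
      exact SkewLaurent.tz_mul_tz τ (-1) _
  exact ⟨f, hEE, hfK, hKz⟩

/-- The map out of 𝒜 given by the universal property sends the spanning monomials YᵇEᶜKⁿ exactly to
the basis of the skew Laurent algebra, so it induces an isomorphism on the quotient. -/
theorem exists_quo_nrm_equiv_skewLaurent {τ : EN q i ≃ₐ[k] EN q i}
    (hE : τ (nE q i) = ((q ^ 2 : kˣ) : k) • nE q i)
    (hY : τ (nY q i) = ((q⁻¹ : kˣ) : k) • nY q i) :
    ∃ e : Quo (idl q {nrm q i}) ≃ₐ[k] SkewLaurent τ,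
      (∀ a : EE q, e (quo k _ (a : Alg q)) = SkewLaurent.coef τ (quo k _ a)) ∧
      e (quo k _ (gK q)) = SkewLaurent.t τ := by
  obtain ⟨f, hEE, hfK, hKz⟩ := exists_skewHom i hE hY
  have hfE : f (gE q) = SkewLaurent.coef τ (nE q i) := hEE (eE q)
  have hfY : f (gY q) = SkewLaurent.coef τ (nY q i) := hEE (eY q)
  have hb : ∀ j, f (monoYE q j) = SkewLaurent.basis τ (basisEN i hq) j := by
    intro j
    rw [SkewLaurent.basis_apply, basisEN_apply, monoYE, map_mul, map_mul, map_pow, map_pow, hfY,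
      hfE, hKz, map_mul, map_pow, map_pow, mul_assoc]
  have h0 : f (nrm q i) = 0 := by
    have hN : quo k (TwoSidedIdeal.span {eN q i}) (eN q i) = 0 :=
      (quo_eq_zero_iff _).2 (TwoSidedIdeal.subset_span rfl)
    rw [← coe_eN, hEE, hN, map_zero]
  obtain ⟨e, he⟩ := exists_quo_nrm_equiv_of_basis i f h0 _ hb
  exact ⟨e, fun a => (he a).trans (hEE a), (he _).trans hfK⟩

end Coefficients

end

end QAge

namespace QAge

noncomputable section

open scoped TensorProduct

/-! The classification of the prime ideals -/

section Classification

variable {k : Type*} [Field k] {q : kˣ} (hq : ∀ n : ℕ, 0 < n → q ^ n ≠ 1)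

/-- K is a unit, so φY ∈ P. As φ is normal, φ ∈ P or Y ∈ P, and Y ∈ P forces φ ∈ P anyway. -/
theorem IsPrimeIdeal.phi_mem_of_elZ_mem {P : TwoSidedIdeal (Alg q)} (hP : IsPrimeIdeal P)
    (h : elZ q ∈ P) : phi q ∈ P := by
  have h1 : phi q * gY q ∈ P := by
    have := P.mul_mem_right _ (gK q) h
    rwa [elZ, mul_assoc, gKinv_mul_gK, mul_one] at this
  by_contra hphi
  refine hphi (phi_mem_of_axGen_mem false (hP.mem_of_normal_mul_mem hphi (fun r => ?_) h1))
  obtain ⟨r', hr'⟩ := phi_normal r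
  exact ⟨r', by rw [hr', sub_self]; exact P.zero_mem⟩

theorem IsPrimeIdeal.gX_mem_of_elC_mem {P : TwoSidedIdeal (Alg q)} (hP : IsPrimeIdeal P)
    (h : elC q ∈ P) : gX q ∈ P := by
  have h1 : gX q * gY q ∈ P := by
    have := P.mul_mem_right _ (gKinv q) h
    rwa [elC, mul_assoc, gK_mul_gKinv, mul_one] at this
  by_contra hX
  refine hX (gX_mem_of_axGen_mem false (hP.mem_of_normal_mul_mem hX (fun r => ?_) h1))
  obtain ⟨r', hr'⟩ := gX_normal r
  exact ⟨r', by rw [hr', sub_self]; exact P.zero_mem⟩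

include hq in
-- YE is a multiple of φ - X, and Y is normal modulo X although not presented as normal in 𝒜 itself.
theorem gY_mem_or_gE_mem {P : TwoSidedIdeal (Alg q)} (hP : IsPrimeIdeal P) (hX : gX q ∈ P)
    (hphi : phi q ∈ P) : gY q ∈ P ∨ gE q ∈ P := by
  have h1 : gY q * gE q ∈ P := by
    have h2 : gY q * gE q = ((q : k)⁻¹ - q)⁻¹ • (phi q - gX q) := by
      rw [phi_eq, add_sub_cancel_left, smul_smul, inv_mul_cancel₀ (inv_sub_self_ne_zero hq),
        one_smul]
    rw [h2, Algebra.smul_def]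
    exact P.mul_mem_left _ _ (P.sub_mem hphi hX)
  by_contra! hn
  refine hn.2 (hP.mem_of_normal_mul_mem hn.1 (fun r => ?_) h1)
  obtain ⟨r', hr'⟩ := quo_gY_normal hX r
  rw [← map_mul, ← map_mul, ← sub_eq_zero, ← map_sub, quo_eq_zero_iff] at hr'
  exact ⟨r', hr'⟩

include hq in
-- The case tree is: X, then Z, then Y and E if X ∈ P; φ if X ∉ P. On the branch X ∉ P, φ ∈ P the
-- element C cannot lie in P, since C ∈ P would force X ∈ P.
theorem IsPrimeIdeal.cases {P : TwoSidedIdeal (Alg q)} (hP : IsPrimeIdeal P) :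
    P = ⊥ ∨ (P = idl q {gX q} ∨ ∃ m : MaxNZ k, P = idlXm q m.1.asIdeal) ∨
      (P = idl q {phi q} ∨ ∃ m : MaxNZ k, P = idlPhir q m.1.asIdeal) ∨ P = idl q {gY q} ∨
      P = idl q {gE q} ∨ ∃ p : Ideal (LaurentPolynomial k), p.IsPrime ∧ P = idlYEp q p := by
  by_cases hX : gX q ∈ P
  · by_cases hZ : elZ q ∈ P
    · have hphi := hP.phi_mem_of_elZ_mem hZ
      right; right; right
      by_cases hY : gY q ∈ P
      · by_cases hE : gE q ∈ P
        · exact Or.inr (Or.inr (exists_eq_idlYEp hP hY hE))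
        · exact Or.inl (eq_of_axGen_mem true hq hP hY hE)
      · exact Or.inr (Or.inl (eq_of_axGen_mem false hq hP
          ((gY_mem_or_gE_mem hq hP hX hphi).resolve_left hY) hY))
    · have h := mem_contr_lau hq true hP hX hZ
      rw [contr_lau] at h
      exact Or.inr (Or.inl h)
  · by_cases hphi : phi q ∈ P
    · have h := mem_contr_lau hq false hP hphi fun hC => hX (hP.gX_mem_of_elC_mem hC)
      rw [contr_lau] at h
      exact Or.inr (Or.inr (Or.inl h))
    · exact Or.inl (hP.eq_bot hq hX hphi)

/-- Contract to the principal ideal domain k[T], where nonzero primes are maximal. Elements of k[T,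
T⁻¹] become polynomials up to units Tⁿ, so maximality passes back. -/
theorem isMaximal_of_isPrime_laurent {p : Ideal (LaurentPolynomial k)} (hp : p.IsPrime)
    (h0 : p ≠ ⊥) : p.IsMaximal := by
  have hp₀ : (p.comap (Polynomial.toLaurent (R := k))).IsPrime := hp.comap _
  have hne : p.comap (Polynomial.toLaurent (R := k)) ≠ ⊥ := by
    obtain ⟨x, hx, hx0⟩ := Submodule.exists_mem_ne_zero_of_ne_bot h0
    obtain ⟨n, f, hf⟩ := LaurentPolynomial.exists_T_pow x
    intro h
    have h1 : f ∈ p.comap (Polynomial.toLaurent (R := k)) := by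
      rw [Ideal.mem_comap, hf]
      exact p.mul_mem_right _ hx
    rw [h, Ideal.mem_bot] at h1
    rw [h1, map_zero] at hf
    exact hx0 (((LaurentPolynomial.isUnit_T (n : ℤ)).mul_left_eq_zero).1 hf.symm)
  have hmax := hp₀.isMaximal hne
  refine Ideal.isMaximal_iff.2 ⟨fun h => hp.ne_top ((Ideal.eq_top_iff_one _).2 h), ?_⟩
  intro J x hJ hx hxJ
  obtain ⟨n, f, hf⟩ := LaurentPolynomial.exists_T_pow x
  have hfp : f ∉ p.comap (Polynomial.toLaurent (R := k)) := by
    rw [Ideal.mem_comap, hf]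
    intro h
    rcases hp.mem_or_mem h with h | h
    · exact hx h
    · exact hp.ne_top (Ideal.eq_top_of_isUnit_mem _ h (LaurentPolynomial.isUnit_T _))
  obtain ⟨y, z, hz, h⟩ := hmax.exists_inv hfp
  have h1 := congrArg Polynomial.toLaurent h
  rw [map_add, map_mul, map_one, hf] at h1
  rw [← h1]
  exact J.add_mem (J.mul_mem_left _ (J.mul_mem_right _ hxJ)) (hJ hz)

end Classification

/-! Memberships of the normal elements -/

section Membership

variable {k : Type*} [Field k] {q : kˣ}

theorem notMem_of_isUnit {R B : Type*} [Ring R] [Algebra k R] [Ring B] [Algebra k B]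
    [Nontrivial B] {I : TwoSidedIdeal R} (f : R →ₐ[k] B) (h : ∀ a, f a = 0 ↔ a ∈ I) {a : R}
    (ha : IsUnit (f a)) : a ∉ I := fun h1 => ha.ne_zero ((h a).2 h1)

variable (hq : ∀ n : ℕ, 0 < n → q ^ n ≠ 1) (i : Bool)
include hq

theorem nrm_not_notMem : nrm q (!i) ∉ idl q {nrm q i} :=
  notMem_of_isUnit (lau hq i) (lau_eq_zero_iff hq i)
    ((isScaled_lau_nrm hq i).isUnit (lau_isTwisted q))

theorem nrm_not_notMem_idlNm (m : MaxNZ k) : nrm q (!i) ∉ idlNm q i m.1.asIdeal := by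
  intro h
  have h1 := (fieldChart_eq_zero_iff hq i m _).2 h
  have := isDomain_field q m
  obtain ⟨s, hs, h2⟩ := chart_nrm_not hq i (Ideal.Quotient.mk m.1.asIdeal Polynomial.X)
  have h3 : fieldChart hq i m (nrm q !i) = _ := h2
  have hu : IsUnit (tm q (Ideal.Quotient.mk m.1.asIdeal Polynomial.X) (-1) (eps i)) :=
    isUnit_tm q m.isUnit_mk_X _ _
  rw [h3] at h1
  have h4 := congrArg (s⁻¹ • ·) h1
  simp only [smul_smul, inv_mul_cancel₀ hs, one_smul, smul_zero] at h4
  exact hu.ne_zero h4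

omit hq in
theorem axGen_notMem : axGen q i ∉ idl q {axGen q (!i)} :=
  notMem_of_isUnit (axTorus q i) (axTorus_eq_zero_iff i)
    ((isScaled_axTorus i).isUnit (yy_isTwisted _))

theorem gX_ne_zero : gX q ≠ 0 := fun h => by
  have h1 := (isScaled_gX hq).isUnit (big_isTwisted q)
  rw [h, map_zero] at h1
  exact not_isUnit_zero h1

theorem phi_ne_zero : phi q ≠ 0 := fun h => by
  have h1 := (isScaled_phi hq).isUnit (big_isTwisted q)
  rw [h, map_zero] at h1
  exact not_isUnit_zero h1

end Membership

end

end QAge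

namespace QAge

noncomputable section

/-! The poset of primes -/

section Poset

variable {k : Type*} [Field k] {q : kˣ}

theorem gY_mem_YE : gY q ∈ idl q {gY q, gE q} := TwoSidedIdeal.subset_span (by simp)

theorem gE_mem_YE : gE q ∈ idl q {gY q, gE q} := TwoSidedIdeal.subset_span (by simp)

theorem gY_mem_idlYEp (p : Ideal (LaurentPolynomial k)) : gY q ∈ idlYEp q p :=
  idl_le_idlYEp q p gY_mem_YE

theorem gE_mem_idlYEp (p : Ideal (LaurentPolynomial k)) : gE q ∈ idlYEp q p :=
  idl_le_idlYEp q p gE_mem_YE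

theorem gX_mem_of_gY_mem {P : TwoSidedIdeal (Alg q)} (h : gY q ∈ P) : gX q ∈ P :=
  gX_mem_of_axGen_mem false h

theorem gX_mem_of_gE_mem {P : TwoSidedIdeal (Alg q)} (h : gE q ∈ P) : gX q ∈ P :=
  gX_mem_of_axGen_mem true h

theorem phi_mem_of_gY_mem {P : TwoSidedIdeal (Alg q)} (h : gY q ∈ P) : phi q ∈ P :=
  phi_mem_of_axGen_mem false h

theorem phi_mem_of_gE_mem {P : TwoSidedIdeal (Alg q)} (h : gE q ∈ P) : phi q ∈ P :=
  phi_mem_of_axGen_mem true h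

theorem gY_notMem_E : gY q ∉ idl q {gE q} := axGen_notMem false

theorem gE_notMem_Y : gE q ∉ idl q {gY q} := axGen_notMem true

theorem mem_idl_singleton (a : Alg q) : a ∈ idl q {a} := TwoSidedIdeal.subset_span rfl

theorem idl_singleton_le {a : Alg q} {P : TwoSidedIdeal (Alg q)} (h : a ∈ P) : idl q {a} ≤ P :=
  TwoSidedIdeal.span_le.2 (by rintro _ rfl; exact h)

theorem idlYEp_injective : Function.Injective (idlYEp q (k := k)) := fun p p' h => by
  ext x
  rw [← toL_laurentK q x, ← mem_idlYEp_iff, ← mem_idlYEp_iff, h]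

theorem primeAt_le_of_line {a b : Vertex k} (h : Line a b) : primeAt q a ≤ primeAt q b := by
  cases h with
  | zero_X => exact bot_le
  | zero_phi => exact bot_le
  | X_Y => exact idl_singleton_le (gX_mem_of_gY_mem (mem_idl_singleton _))
  | X_E => exact idl_singleton_le (gX_mem_of_gE_mem (mem_idl_singleton _))
  | phi_Y => exact idl_singleton_le (phi_mem_of_gY_mem (mem_idl_singleton _))
  | phi_E => exact idl_singleton_le (phi_mem_of_gE_mem (mem_idl_singleton _))
  | Y_YE => exact idl_singleton_le gY_mem_YE
  | E_YE => exact idl_singleton_le gE_mem_YE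
  | YE_YEp p => exact idl_le_idlYEp q _
  | X_Xm m => exact idl_singleton_le (nrm_mem_idlNm true _)
  | phi_phir m => exact idl_singleton_le (nrm_mem_idlNm false _)

theorem primeAt_le_of_reflTransGen {a b : Vertex k} (h : Relation.ReflTransGen Line a b) :
    primeAt q a ≤ primeAt q b := by
  induction h with
  | refl => exact le_rfl
  | tail _ h ih => exact ih.trans (primeAt_le_of_line h)

variable (hq : ∀ n : ℕ, 0 < n → q ^ n ≠ 1)
include hq

theorem phi_notMem_X : phi q ∉ idl q {gX q} := nrm_not_notMem hq true

theorem gX_notMem_phi : gX q ∉ idl q {phi q} := nrm_not_notMem hq false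

theorem phi_notMem_Xm (m : MaxNZ k) : phi q ∉ idlXm q m.1.asIdeal :=
  nrm_not_notMem_idlNm hq true m

theorem gX_notMem_phir (m : MaxNZ k) : gX q ∉ idlPhir q m.1.asIdeal :=
  nrm_not_notMem_idlNm hq false m

/-- If p ∈ 𝔪 is not in 𝔪', then yp + z = 1 with z ∈ 𝔪'. Evaluating at Z or C puts 1 into the ideal
attached to 𝔪', which is proper. -/
theorem idlNm_injective (i : Bool) :
    Function.Injective fun m : MaxNZ k => idlNm q i m.1.asIdeal := fun m m' h => by
  refine Subtype.ext (MaximalSpectrum.ext (m.1.isMaximal.eq_of_le m'.1.isMaximal.ne_top ?_))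
  intro p hp
  by_contra hp'
  obtain ⟨y, z, hz, h1⟩ := m'.1.isMaximal.exists_inv hp'
  have h2 : Polynomial.aeval (cen q i) p ∈ idlNm q i m'.1.asIdeal := by
    have := aeval_mem_idlNm (q := q) i hp
    rwa [show idlNm q i m.1.asIdeal = idlNm q i m'.1.asIdeal from h] at this
  have h3 := (idlNm q i m'.1.asIdeal).add_mem
    ((idlNm q i m'.1.asIdeal).mul_mem_left (Polynomial.aeval (cen q i) y) _ h2)
    (aeval_mem_idlNm (q := q) i hz)
  rw [← map_mul, ← map_add, h1, map_one] at h3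
  exact (isPrimeIdeal_idlNm hq i m').one_notMem h3

theorem isPrimeIdeal_bot : IsPrimeIdeal (⊥ : TwoSidedIdeal (Alg q)) :=
  have := isDomain_alg hq
  isPrimeIdeal_of_ker (RingHom.id (Alg q)) fun _ => (TwoSidedIdeal.mem_bot _).symm

theorem isPrimeIdeal_primeAt (v : Vertex k) : IsPrimeIdeal (primeAt q v) := by
  cases v with
  | zero => exact isPrimeIdeal_bot hq
  | X => exact isPrimeIdeal_nrm hq true
  | phi => exact isPrimeIdeal_nrm hq false
  | Y => exact isPrimeIdeal_axGen true
  | E => exact isPrimeIdeal_axGen false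
  | YE =>
    have := isPrimeIdeal_idlYEp q (p := ⊥) Ideal.isPrime_bot
    rwa [idlYEp_bot] at this
  | YEp p => exact isPrimeIdeal_idlYEp q p.isMaximal.isPrime
  | Xm m => exact isPrimeIdeal_idlNm hq true m
  | phir m => exact isPrimeIdeal_idlNm hq false m

theorem range_primeAt : Set.range (primeAt q) = Spec (Alg q) := by
  refine Set.Subset.antisymm (Set.range_subset_iff.2 (isPrimeIdeal_primeAt hq)) fun P hP => ?_
  rcases IsPrimeIdeal.cases hq hP with
    rfl | (rfl | ⟨m, rfl⟩) | (rfl | ⟨m, rfl⟩) | rfl | rfl | ⟨p, hp, rfl⟩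
  · exact ⟨.zero, rfl⟩
  · exact ⟨.X, rfl⟩
  · exact ⟨.Xm m, rfl⟩
  · exact ⟨.phi, rfl⟩
  · exact ⟨.phir m, rfl⟩
  · exact ⟨.Y, rfl⟩
  · exact ⟨.E, rfl⟩
  · by_cases h0 : p = ⊥
    · exact ⟨.YE, by rw [h0, idlYEp_bot]; rfl⟩
    · exact ⟨.YEp ⟨p, isMaximal_of_isPrime_laurent hp h0⟩, rfl⟩

open Relation

theorem reflTransGen_X {v : Vertex k} (h : gX q ∈ primeAt q v) : ReflTransGen Line .X v := by
  have hY : ReflTransGen Line (.X : Vertex k) .Y := .single .X_Y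
  cases v with
  | zero => exact absurd h (gX_ne_zero hq)
  | X => exact .refl
  | phi => exact absurd h (gX_notMem_phi hq)
  | Y => exact hY
  | E => exact .single .X_E
  | YE => exact hY.tail .Y_YE
  | YEp p => exact (hY.tail .Y_YE).tail (.YE_YEp p)
  | Xm m => exact .single (.X_Xm m)
  | phir m => exact absurd h (gX_notMem_phir hq m)

theorem reflTransGen_phi {v : Vertex k} (h : phi q ∈ primeAt q v) : ReflTransGen Line .phi v := by
  have hY : ReflTransGen Line (.phi : Vertex k) .Y := .single .phi_Y
  cases v with
  | zero => exact absurd h (phi_ne_zero hq)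
  | X => exact absurd h (phi_notMem_X hq)
  | phi => exact .refl
  | Y => exact hY
  | E => exact .single .phi_E
  | YE => exact hY.tail .Y_YE
  | YEp p => exact (hY.tail .Y_YE).tail (.YE_YEp p)
  | Xm m => exact absurd h (phi_notMem_Xm hq m)
  | phir m => exact .single (.phi_phir m)

theorem eq_of_mem_of_mem {v : Vertex k} (hX : gX q ∈ primeAt q v) (hphi : phi q ∈ primeAt q v) :
    v = .Y ∨ v = .E ∨ v = .YE ∨ ∃ p, v = .YEp p := by
  cases v with
  | zero => exact absurd hX (gX_ne_zero hq)
  | X => exact absurd hphi (phi_notMem_X hq)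
  | phi => exact absurd hX (gX_notMem_phi hq)
  | Y => exact .inl rfl
  | E => exact .inr (.inl rfl)
  | YE => exact .inr (.inr (.inl rfl))
  | YEp p => exact .inr (.inr (.inr ⟨p, rfl⟩))
  | Xm m => exact absurd hphi (phi_notMem_Xm hq m)
  | phir m => exact absurd hX (gX_notMem_phir hq m)

theorem reflTransGen_Y {v : Vertex k} (h : gY q ∈ primeAt q v) : ReflTransGen Line .Y v := by
  rcases eq_of_mem_of_mem hq (gX_mem_of_gY_mem h) (phi_mem_of_gY_mem h) with
    rfl | rfl | rfl | ⟨p, rfl⟩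
  · exact .refl
  · exact absurd h gY_notMem_E
  · exact .single .Y_YE
  · exact (ReflTransGen.single .Y_YE).tail (.YE_YEp p)

theorem reflTransGen_E {v : Vertex k} (h : gE q ∈ primeAt q v) : ReflTransGen Line .E v := by
  rcases eq_of_mem_of_mem hq (gX_mem_of_gE_mem h) (phi_mem_of_gE_mem h) with
    rfl | rfl | rfl | ⟨p, rfl⟩
  · exact absurd h gE_notMem_Y
  · exact .refl
  · exact .single .E_YE
  · exact (ReflTransGen.single .E_YE).tail (.YE_YEp p)

theorem reflTransGen_YE {v : Vertex k} (hY : gY q ∈ primeAt q v) (hE : gE q ∈ primeAt q v) :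
    ReflTransGen Line .YE v := by
  rcases eq_of_mem_of_mem hq (gX_mem_of_gE_mem hE) (phi_mem_of_gE_mem hE) with
    rfl | rfl | rfl | ⟨p, rfl⟩
  · exact absurd hE gE_notMem_Y
  · exact absurd hY gY_notMem_E
  · exact .refl
  · exact .single (.YE_YEp p)

omit hq in
theorem reflTransGen_zero (v : Vertex k) : ReflTransGen Line .zero v := by
  have hX : ReflTransGen Line (.zero : Vertex k) .X := .single .zero_X
  cases v with
  | zero => exact .refl
  | phi => exact .single .zero_phi
  | phir m => exact (ReflTransGen.single .zero_phi).tail (.phi_phir m)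
  | X => exact hX
  | Xm m => exact hX.tail (.X_Xm m)
  | Y => exact hX.tail .X_Y
  | E => exact hX.tail .X_E
  | YE => exact (hX.tail .X_Y).tail .Y_YE
  | YEp p => exact ((hX.tail .X_Y).tail .Y_YE).tail (.YE_YEp p)

omit hq in
/-- The vertices of the three infinite families. -/
def Vertex.IsTop : Vertex k → Prop
  | .YEp _ | .Xm _ | .phir _ => True
  | _ => False

omit hq in
/-- The length of the chains from the zero ideal to a vertex. -/
def Vertex.rank : Vertex k → ℕ
  | .zero => 0
  | .X | .phi => 1
  | .Y | .E | .Xm _ | .phir _ => 2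
  | .YE => 3
  | .YEp _ => 4

omit hq in
theorem Vertex.rank_lt_of_line {a b : Vertex k} (h : Line a b) : a.rank < b.rank := by
  cases h <;> simp [Vertex.rank]

omit hq in
theorem Vertex.eq_or_rank_lt {a b : Vertex k} (h : ReflTransGen Line a b) :
    a = b ∨ a.rank < b.rank := by
  induction h with
  | refl => exact .inl rfl
  | tail _ h ih =>
    rcases ih with rfl | h1
    · exact .inr (Vertex.rank_lt_of_line h)
    · exact .inr (h1.trans (Vertex.rank_lt_of_line h))

/-- Outside the three families each ideal is generated by at most two of X, φ, Y, E, so an inclusion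
is detected by these elements, and the diagram can be checked vertex by vertex. -/
theorem reflTransGen_of_le {a b : Vertex k} (ha : ¬ a.IsTop) (h : primeAt q a ≤ primeAt q b) :
    ReflTransGen Line a b := by
  cases a with
  | zero => exact reflTransGen_zero b
  | X => exact reflTransGen_X hq (h (mem_idl_singleton _))
  | phi => exact reflTransGen_phi hq (h (mem_idl_singleton _))
  | Y => exact reflTransGen_Y hq (h (mem_idl_singleton _))
  | E => exact reflTransGen_E hq (h (mem_idl_singleton _))
  | YE => exact reflTransGen_YE hq (h gY_mem_YE) (h gE_mem_YE)
  | YEp _ => exact absurd trivial ha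
  | Xm _ => exact absurd trivial ha
  | phir _ => exact absurd trivial ha

theorem isCoatom_primeAt {v : Vertex k} (hv : v.IsTop) : IsCoatom (primeAt q v) := by
  cases v with
  | YEp p => exact isCoatom_idlYEp q p
  | Xm m => exact isCoatom_idlNm hq true m
  | phir m => exact isCoatom_idlNm hq false m
  | _ => exact hv.elim

theorem not_isCoatom_of_line {a b : Vertex k} (h : Line a b) {x : Alg q} (hx : x ∈ primeAt q b)
    (hxa : x ∉ primeAt q a) : ¬ IsCoatom (primeAt q a) := fun hc => by
  rcases hc.le_iff.1 (primeAt_le_of_line (q := q) h) with h1 | h1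
  · exact (isPrimeIdeal_primeAt hq b).1 h1
  · exact hxa (h1 ▸ hx)

omit hq in
theorem isMaximal_ker_laurentEval (u : kˣ) : (RingHom.ker (laurentEval u : LaurentPolynomial k →ₐ[k] k)).IsMaximal :=
  RingHom.ker_isMaximal_of_surjective _ fun c => ⟨algebraMap k _ c, AlgHom.commutes _ c⟩

omit hq in
theorem sub_mem_ker_laurentEval_iff (u v : kˣ) :
    (LaurentPolynomial.T 1 - algebraMap k (LaurentPolynomial k) (v : k)) ∈
      RingHom.ker (laurentEval u : LaurentPolynomial k →ₐ[k] k) ↔ u = v := by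
  rw [RingHom.mem_ker, map_sub, laurentEval_T, AlgHom.commutes, sub_eq_zero]
  exact Units.ext_iff.symm

/-- For each such vertex one line of the diagram is strict, as witnessed by one of X, φ, Y, E; for
(Y, E) the witness is K - 1. -/
theorem not_isCoatom_primeAt {v : Vertex k} (hv : ¬ v.IsTop) : ¬ IsCoatom (primeAt q v) := by
  cases v with
  | zero =>
    exact not_isCoatom_of_line hq .zero_X (mem_idl_singleton _) fun h => gX_ne_zero hq h
  | X =>
    exact not_isCoatom_of_line hq .X_Y (phi_mem_of_gY_mem (mem_idl_singleton _)) (phi_notMem_X hq)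
  | phi =>
    exact not_isCoatom_of_line hq .phi_Y (gX_mem_of_gY_mem (mem_idl_singleton _)) (gX_notMem_phi hq)
  | Y => exact not_isCoatom_of_line hq .Y_YE gE_mem_YE gE_notMem_Y
  | E => exact not_isCoatom_of_line hq .E_YE gY_mem_YE gY_notMem_E
  | YE =>
    have h := (sub_mem_ker_laurentEval_iff (1 : kˣ) 1).2 rfl
    refine not_isCoatom_of_line hq (.YE_YEp ⟨_, isMaximal_ker_laurentEval 1⟩)
      (x := laurentK q (LaurentPolynomial.T 1 - algebraMap k (LaurentPolynomial k) ((1 : kˣ) : k)))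
      ?_ ?_
    · exact (mem_idlYEp_iff q _ _).2 (by rwa [toL_laurentK])
    · change _ ∉ idl q {gY q, gE q}
      rw [← idlYEp_bot, mem_idlYEp_iff, toL_laurentK, Ideal.mem_bot]
      intro h0
      -- T - 1 is nonzero because its value at q is q - 1, and q ≠ 1.
      have h1 := congrArg (laurentEval q : LaurentPolynomial k →ₐ[k] k) h0
      rw [map_zero, ← RingHom.mem_ker, sub_mem_ker_laurentEval_iff] at h1
      exact hq 1 one_pos (by rw [h1, one_pow])
  | YEp _ => exact absurd trivial hv
  | Xm _ => exact absurd trivial hv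
  | phir _ => exact absurd trivial hv

theorem eq_of_primeAt_eq_of_isTop {a b : Vertex k} (ha : a.IsTop) (hb : b.IsTop)
    (h : primeAt q a = primeAt q b) : a = b := by
  have hX : ∀ {a b : Vertex k}, primeAt q a = primeAt q b → gX q ∈ primeAt q a →
    gX q ∈ primeAt q b := fun h h1 => h ▸ h1
  have hphi : ∀ {a b : Vertex k}, primeAt q a = primeAt q b → phi q ∈ primeAt q a →
    phi q ∈ primeAt q b := fun h h1 => h ▸ h1
  cases a with
  | YEp p =>
    cases b with
    | YEp p' => rw [MaximalSpectrum.ext (idlYEp_injective h)]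
    | Xm m => exact absurd (hphi h (phi_mem_of_gY_mem (gY_mem_idlYEp _))) (phi_notMem_Xm hq m)
    | phir m => exact absurd (hX h (gX_mem_of_gY_mem (gY_mem_idlYEp _))) (gX_notMem_phir hq m)
    | _ => exact hb.elim
  | Xm m =>
    cases b with
    | YEp p' =>
      exact absurd (hphi h.symm (phi_mem_of_gY_mem (gY_mem_idlYEp _))) (phi_notMem_Xm hq m)
    | Xm m' => rw [idlNm_injective hq true h]
    | phir m' => exact absurd (hX h (nrm_mem_idlNm true _)) (gX_notMem_phir hq m')
    | _ => exact hb.elim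
  | phir m =>
    cases b with
    | YEp p' =>
      exact absurd (hX h.symm (gX_mem_of_gY_mem (gY_mem_idlYEp _))) (gX_notMem_phir hq m)
    | Xm m' => exact absurd (hphi h (nrm_mem_idlNm false _)) (phi_notMem_Xm hq m')
    | phir m' => rw [idlNm_injective hq false h]
    | _ => exact hb.elim
  | _ => exact ha.elim

/-- Maximality separates the three families from the other vertices. Among those others, equal
ideals give paths in both directions, which the strict growth of `Vertex.rank` excludes unless the
vertices agree. -/
theorem primeAt_injective : Function.Injective (primeAt q) := fun a b h => by
  by_cases ha : a.IsTop
  · by_cases hb : b.IsTop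
    · exact eq_of_primeAt_eq_of_isTop hq ha hb h
    · exact absurd (h ▸ isCoatom_primeAt hq ha) (not_isCoatom_primeAt hq hb)
  · by_cases hb : b.IsTop
    · exact absurd (h ▸ isCoatom_primeAt hq hb) (not_isCoatom_primeAt hq ha)
    · have h1 := Vertex.eq_or_rank_lt (reflTransGen_of_le hq ha h.le)
      have h2 := Vertex.eq_or_rank_lt (reflTransGen_of_le hq hb h.ge)
      rcases h1 with h1 | h1
      · exact h1
      · rcases h2 with h2 | h2
        · exact h2.symm
        · exact absurd h1 h2.asymm

theorem primeAt_le_iff (a b : Vertex k) :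
    primeAt q a ≤ primeAt q b ↔ ReflTransGen Line a b := by
  refine ⟨fun h => ?_, primeAt_le_of_reflTransGen⟩
  by_cases ha : a.IsTop
  · have h1 := ((isCoatom_primeAt hq ha).le_iff.1 h).resolve_left (isPrimeIdeal_primeAt hq b).1
    rw [primeAt_injective hq h1]
  · exact reflTransGen_of_le hq ha h

/-- The powers of q are infinitely many distinct points of k*, each giving a maximal ideal by
evaluation. -/
theorem infinite_maximalSpectrum_laurent : Infinite (MaximalSpectrum (LaurentPolynomial k)) :=
  Infinite.of_injective
    (fun n : ℤ => (⟨_, isMaximal_ker_laurentEval (q ^ n)⟩ : MaximalSpectrum _)) fun m n h => by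
      have h1 := (sub_mem_ker_laurentEval_iff (q ^ n) (q ^ n)).2 rfl
      rw [← show _ = RingHom.ker (laurentEval (q ^ n) : LaurentPolynomial k →ₐ[k] k) from
        congrArg MaximalSpectrum.asIdeal h, sub_mem_ker_laurentEval_iff] at h1
      exact qpow_injective hq (congrArg Units.val h1)

theorem infinite_maxNZ : Infinite (MaxNZ k) := by
  let f (n : ℤ) : Polynomial k →ₐ[k] k := Polynomial.aeval ((q ^ n : kˣ) : k)
  have hf : ∀ n, (RingHom.ker (f n)).IsMaximal := fun n =>
    RingHom.ker_isMaximal_of_surjective _ fun c => ⟨algebraMap k _ c, AlgHom.commutes _ c⟩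
  have hmem : ∀ n (u : k), (Polynomial.X - algebraMap k (Polynomial k) u) ∈ RingHom.ker (f n) ↔
      ((q ^ n : kˣ) : k) = u := fun n u => by
    rw [RingHom.mem_ker, map_sub, AlgHom.commutes, sub_eq_zero, Polynomial.aeval_X]
    rfl
  refine Infinite.of_injective (fun n : ℤ => (⟨⟨RingHom.ker (f n), hf n⟩, fun h => ?_⟩ : MaxNZ k))
    fun m n h => ?_
  · have h1 : Polynomial.X ∈ RingHom.ker (f n) := by
      rw [show RingHom.ker (f n) = _ from h]
      exact Ideal.subset_span rfl
    rw [RingHom.mem_ker, Polynomial.aeval_X] at h1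
    exact (q ^ n).ne_zero h1
  · have h1 := (hmem n _).2 rfl
    rw [← show RingHom.ker (f m) = RingHom.ker (f n) from
      congrArg (fun x : MaxNZ k => x.1.asIdeal) h, hmem] at h1
    exact qpow_injective hq h1

end Poset

end

end QAge

namespace QAge

noncomputable section

open OreLocalization (OreSet)

/-! The spectrum as a disjoint union -/

section Decomposition

variable {k : Type*} [Field k] {q : kˣ} (hq : ∀ n : ℕ, 0 < n → q ^ n ≠ 1)
  [OreSet (denX q)] [OreSet (denXPhi q)] [OreSet (denZ q)] [OreSet (denY q)] [OreSet (denE q)]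
include hq

theorem spec_eq_union : Spec (Alg q) =
    contr (toL q) ∪ contr (toUE q) ∪ contr (toAXZloc q) ∪ contr (toAXloc q) ∪
      contr (toLocQuo q (denX q) (idl q {phi q})) ∪ contr (loc k (denXPhi q)) := by
  rw [contr_toL, contr_toUE q hq, contr_toAXZloc hq, contr_toAXloc hq, contr_toLocQuo hq,
    contr_loc_denXPhi hq]
  ext P
  simp only [Set.mem_union, Set.mem_singleton_iff, Set.mem_ofPred_eq]
  constructor
  · intro hP
    rcases IsPrimeIdeal.cases hq hP with h | (h | h) | (h | h) | h | h | h
    · exact .inr h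
    · exact .inl (.inl (.inr (.inl h)))
    · exact .inl (.inl (.inr (.inr h)))
    · exact .inl (.inr (.inl h))
    · exact .inl (.inr (.inr h))
    · exact .inl (.inl (.inl (.inl (.inr h))))
    · exact .inl (.inl (.inl (.inr h)))
    · exact .inl (.inl (.inl (.inl (.inl h))))
  · rintro (((((⟨p, hp, rfl⟩ | rfl) | rfl) | (rfl | ⟨m, rfl⟩)) | (rfl | ⟨m, rfl⟩)) | rfl)
    · exact isPrimeIdeal_idlYEp q hp
    · exact isPrimeIdeal_primeAt hq .Y
    · exact isPrimeIdeal_primeAt hq .E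
    · exact isPrimeIdeal_primeAt hq .X
    · exact isPrimeIdeal_primeAt hq (.Xm m)
    · exact isPrimeIdeal_primeAt hq .phi
    · exact isPrimeIdeal_primeAt hq (.phir m)
    · exact isPrimeIdeal_primeAt hq .zero

/-- The six pieces are told apart by which of X, φ, Y, E they contain; a prime containing Y or E
contains both X and φ. -/
theorem pairwise_disjoint_contr :
    [contr (toL q), contr (toUE q), contr (toAXZloc q), contr (toAXloc q),
      contr (toLocQuo q (denX q) (idl q {phi q})), contr (loc k (denXPhi q))].Pairwise
        Disjoint := by
  have h1 : ∀ P ∈ contr (toL q), gY q ∈ P ∧ gE q ∈ P := by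
    rw [contr_toL]
    rintro _ ⟨p, -, rfl⟩
    exact ⟨gY_mem_idlYEp p, gE_mem_idlYEp p⟩
  have h2 : ∀ P ∈ contr (toUE q), gY q ∈ P ∧ gE q ∉ P := by
    rw [contr_toUE q hq]
    rintro _ rfl
    exact ⟨mem_idl_singleton _, gE_notMem_Y⟩
  have h3 : ∀ P ∈ contr (toAXZloc q), gY q ∉ P ∧ gE q ∈ P := by
    rw [contr_toAXZloc hq]
    rintro _ rfl
    exact ⟨gY_notMem_E, mem_idl_singleton _⟩
  have h4 : ∀ P ∈ contr (toAXloc q), gX q ∈ P ∧ phi q ∉ P := by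
    rw [contr_toAXloc hq]
    rintro _ (rfl | ⟨m, rfl⟩)
    · exact ⟨mem_idl_singleton _, phi_notMem_X hq⟩
    · exact ⟨nrm_mem_idlNm true _, phi_notMem_Xm hq m⟩
  have h5 : ∀ P ∈ contr (toLocQuo q (denX q) (idl q {phi q})), gX q ∉ P ∧ phi q ∈ P := by
    rw [contr_toLocQuo hq]
    rintro _ (rfl | ⟨m, rfl⟩)
    · exact ⟨gX_notMem_phi hq, mem_idl_singleton _⟩
    · exact ⟨gX_notMem_phir hq m, nrm_mem_idlNm false _⟩
  have h6 : ∀ P ∈ contr (loc k (denXPhi q)), gX q ∉ P ∧ phi q ∉ P := by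
    rw [contr_loc_denXPhi hq]
    rintro _ rfl
    exact ⟨fun h => gX_ne_zero hq ((TwoSidedIdeal.mem_bot _).1 h),
      fun h => phi_ne_zero hq ((TwoSidedIdeal.mem_bot _).1 h)⟩
  have hY : ∀ P : TwoSidedIdeal (Alg q), gY q ∈ P → gX q ∈ P ∧ phi q ∈ P := fun P h =>
    ⟨gX_mem_of_gY_mem h, phi_mem_of_gY_mem h⟩
  have hE : ∀ P : TwoSidedIdeal (Alg q), gE q ∈ P → gX q ∈ P ∧ phi q ∈ P := fun P h =>
    ⟨gX_mem_of_gE_mem h, phi_mem_of_gE_mem h⟩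
  simp only [List.pairwise_cons, List.mem_cons, List.not_mem_nil, or_false, forall_eq_or_imp,
    forall_eq, IsEmpty.forall_iff, implies_true, List.Pairwise.nil, and_true, Set.disjoint_left]
  exact ⟨⟨fun P ha hb => (h2 P hb).2 (h1 P ha).2, fun P ha hb => (h3 P hb).1 (h1 P ha).1,
      fun P ha hb => (h4 P hb).2 (hY P (h1 P ha).1).2,
      fun P ha hb => (h5 P hb).1 (hY P (h1 P ha).1).1,
      fun P ha hb => (h6 P hb).1 (hY P (h1 P ha).1).1⟩,
    ⟨fun P ha hb => (h2 P ha).2 (h3 P hb).2, fun P ha hb => (h4 P hb).2 (hY P (h2 P ha).1).2,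
      fun P ha hb => (h5 P hb).1 (hY P (h2 P ha).1).1,
      fun P ha hb => (h6 P hb).1 (hY P (h2 P ha).1).1⟩,
    ⟨fun P ha hb => (h4 P hb).2 (hE P (h3 P ha).2).2,
      fun P ha hb => (h5 P hb).1 (hE P (h3 P ha).2).1,
      fun P ha hb => (h6 P hb).1 (hE P (h3 P ha).2).1⟩,
    ⟨fun P ha hb => (h5 P hb).1 (h4 P ha).1, fun P ha hb => (h6 P hb).1 (h4 P ha).1⟩,
    fun P ha hb => (h6 P hb).2 (h5 P ha).2⟩

end Decomposition

end

end QAge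

theorem theorem2 {k : Type*} [Field k] (q : kˣ) (hq : ∀ n : ℕ, 0 < n → q ^ n ≠ 1) :
    -- the poset of prime ideals
    (Function.Injective (primeAt q) ∧ Set.range (primeAt q) = Spec (Alg q) ∧
      (∀ a b : Vertex k, primeAt q a ≤ primeAt q b ↔ Relation.ReflTransGen Line a b) ∧
      (∀ p : MaximalSpectrum (LaurentPolynomial k), IsCoatom (idlYEp q p.asIdeal)) ∧
      (∀ m : MaxNZ k, IsCoatom (idlXm q m.1.asIdeal)) ∧
      (∀ r : MaxNZ k, IsCoatom (idlPhir q r.1.asIdeal)) ∧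
      Infinite (MaximalSpectrum (LaurentPolynomial k)) ∧ Infinite (MaxNZ k)) ∧
    -- the sets at which one localizes are left denominator sets
    (Nonempty (OreSet (denX q)) ∧ Nonempty (OreSet (denXPhi q)) ∧ Nonempty (OreSet (denXY q)) ∧
      Nonempty (OreSet (denPhiY q)) ∧ Nonempty (OreSet (denZ q)) ∧ Nonempty (OreSet (denY q)) ∧
      Nonempty (OreSet (denE q))) ∧
    ∀ [OreSet (denX q)] [OreSet (denXPhi q)] [OreSet (denXY q)] [OreSet (denPhiY q)]
      [OreSet (denZ q)] [OreSet (denY q)] [OreSet (denE q)],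
    -- the spectrum is the disjoint union of six spectra, embedded by contraction
    (Spec (Alg q) = contr (toL q) ∪ contr (toUE q) ∪ contr (toAXZloc q) ∪ contr (toAXloc q) ∪
        contr (toLocQuo q (denX q) (idl q {phi q})) ∪ contr (loc k (denXPhi q)) ∧
      [contr (toL q), contr (toUE q), contr (toAXZloc q), contr (toAXloc q),
        contr (toLocQuo q (denX q) (idl q {phi q})), contr (loc k (denXPhi q))].Pairwise
          Disjoint ∧
      Set.InjOn (TwoSidedIdeal.comap (toL q)) (Spec _) ∧
      Set.InjOn (TwoSidedIdeal.comap (toUE q)) (Spec _) ∧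
      Set.InjOn (TwoSidedIdeal.comap (toAXZloc q)) (Spec _) ∧
      Set.InjOn (TwoSidedIdeal.comap (toAXloc q)) (Spec _) ∧
      Set.InjOn (TwoSidedIdeal.comap (toLocQuo q (denX q) (idl q {phi q}))) (Spec _) ∧
      Set.InjOn (TwoSidedIdeal.comap (loc k (denXPhi q))) (Spec _)) ∧
    -- primes over `(Y, E)`
    (contr (toL q) = {P | ∃ p : Ideal (LaurentPolynomial k), p.IsPrime ∧ P = idlYEp q p} ∧
      ∀ p : Ideal (LaurentPolynomial k), p.IsPrime →
        ∃ e : Quo (idlYEp q p) ≃ₐ[k] (LaurentPolynomial k ⧸ p),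
          e (quo k _ (gK q)) = Ideal.Quotient.mk p (LaurentPolynomial.T 1)) ∧
    -- the prime `(Y)`
    (contr (toUE q) = {idl q {gY q}} ∧
      idl q {gY q} = idl q {gX q, gY q} ∧ idl q {gY q} = idl q {gX q, elZ q, gY q} ∧
      ∃ e : Quo (idl q {gY q}) ≃ₐ[k] SkewLaurent (polyScale (q ^ 2)),
        e (quo k _ (gE q)) = SkewLaurent.coef _ Polynomial.X ∧
        e (quo k _ (gK q)) = SkewLaurent.t _) ∧
    -- the prime `(E)`
    (contr (toAXZloc q) = {idl q {gE q}} ∧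
      (∃ e : OreLocalization (denY q) (AXZ q) ≃ₐ[k] YY q,
        e (toAXZloc q (gY q)) = yyY q ∧ e (toAXZloc q (gK q)) = yyK q) ∧
      idl q {gE q} = idl q {gE q, gX q} ∧ idl q {gE q} = idl q {gE q, phi q} ∧
      ∃ e : Quo (idl q {gE q}) ≃ₐ[k] SkewLaurent (polyScale q⁻¹),
        e (quo k _ (gY q)) = SkewLaurent.coef _ Polynomial.X ∧
        e (quo k _ (gK q)) = SkewLaurent.t _) ∧
    -- the primes `(X)` and `(X, m)`
    (contr (toAXloc q) = {idl q {gX q}} ∪ {P | ∃ m : MaxNZ k, P = idlXm q m.1.asIdeal} ∧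
      (IsDomain (Quo (idl q {gX q})) ∧
        (∃ g : Quo (TwoSidedIdeal.span {eX q}) ≃ₐ[k] Plane q⁻¹,
          g (quo k _ (eE q)) = planeE q⁻¹ ∧ g (quo k _ (eY q)) = planeY q⁻¹) ∧
        ∃ τ : Quo (TwoSidedIdeal.span {eX q}) ≃ₐ[k] Quo (TwoSidedIdeal.span {eX q}),
          τ (quo k _ (eE q)) = ((q ^ 2 : kˣ) : k) • quo k _ (eE q) ∧
          τ (quo k _ (eY q)) = ((q⁻¹ : kˣ) : k) • quo k _ (eY q) ∧
          ∃ e : Quo (idl q {gX q}) ≃ₐ[k] SkewLaurent τ,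
            (∀ a : EE q, e (quo k _ (a : Alg q)) = SkewLaurent.coef τ (quo k _ a)) ∧
            e (quo k _ (gK q)) = SkewLaurent.t τ) ∧
      ∀ m : MaxNZ k,
        Module.Finite k (Polynomial k ⧸ m.1.asIdeal) ∧ IsField (Polynomial k ⧸ m.1.asIdeal) ∧
        IsDomain (Quo (idlXm q m.1.asIdeal)) ∧ IsSimpleRing (Quo (idlXm q m.1.asIdeal)) ∧
        (∃ e : Quo (idlXm q m.1.asIdeal) ≃ₐ[k] Quo (ext q (denPhiY q) (idlXm q m.1.asIdeal)),
          ∀ a : Alg q, e (quo k _ a) = toLocQuo q (denPhiY q) (idlXm q m.1.asIdeal) a) ∧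
        ∃ e : Quo (idlXm q m.1.asIdeal) ≃ₐ[k] (Polynomial k ⧸ m.1.asIdeal) ⊗[k] YY q,
          e (quo k _ (elZ q)) = Ideal.Quotient.mk m.1.asIdeal Polynomial.X ⊗ₜ[k] (1 : YY q) ∧
          e (quo k _ (gY q)) = 1 ⊗ₜ[k] yyY q ∧ e (quo k _ (gK q)) = 1 ⊗ₜ[k] yyK q) ∧
    -- the primes `(φ)` and `(φ, r)`
    (contr (toLocQuo q (denX q) (idl q {phi q})) =
        {idl q {phi q}} ∪ {P | ∃ r : MaxNZ k, P = idlPhir q r.1.asIdeal} ∧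
      (∃ e : Quo (ext q (denX q) (idl q {phi q})) ≃ₐ[k] Quo (ext q (denXY q) (idl q {phi q})),
        ∀ a : Alg q, e (toLocQuo q (denX q) (idl q {phi q}) a) =
          toLocQuo q (denXY q) (idl q {phi q}) a) ∧
      (∃ e : Quo (ext q (denXY q) (idl q {phi q})) ≃ₐ[k] LaurentPolynomial k ⊗[k] YY q,
        e (toLocQuo q (denXY q) (idl q {phi q}) (elC q)) = LaurentPolynomial.T 1 ⊗ₜ[k] (1 : YY q) ∧
        e (toLocQuo q (denXY q) (idl q {phi q}) (gY q)) = 1 ⊗ₜ[k] yyY q ∧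
        e (toLocQuo q (denXY q) (idl q {phi q}) (gK q)) = 1 ⊗ₜ[k] yyK q) ∧
      (IsDomain (Quo (idl q {phi q})) ∧
        (∃ g : Quo (TwoSidedIdeal.span {ePhi q}) ≃ₐ[k] Plane q,
          g (quo k _ (eE q)) = planeE q ∧ g (quo k _ (eY q)) = planeY q) ∧
        ∃ τ : Quo (TwoSidedIdeal.span {ePhi q}) ≃ₐ[k] Quo (TwoSidedIdeal.span {ePhi q}),
          τ (quo k _ (eE q)) = ((q ^ 2 : kˣ) : k) • quo k _ (eE q) ∧
          τ (quo k _ (eY q)) = ((q⁻¹ : kˣ) : k) • quo k _ (eY q) ∧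
          ∃ e : Quo (idl q {phi q}) ≃ₐ[k] SkewLaurent τ,
            (∀ a : EE q, e (quo k _ (a : Alg q)) = SkewLaurent.coef τ (quo k _ a)) ∧
            e (quo k _ (gK q)) = SkewLaurent.t τ) ∧
      ∀ r : MaxNZ k,
        Module.Finite k (Polynomial k ⧸ r.1.asIdeal) ∧ IsField (Polynomial k ⧸ r.1.asIdeal) ∧
        IsDomain (Quo (idlPhir q r.1.asIdeal)) ∧ IsSimpleRing (Quo (idlPhir q r.1.asIdeal)) ∧
        (∃ e : Quo (idlPhir q r.1.asIdeal) ≃ₐ[k] Quo (ext q (denXY q) (idlPhir q r.1.asIdeal)),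
          ∀ a : Alg q, e (quo k _ a) = toLocQuo q (denXY q) (idlPhir q r.1.asIdeal) a) ∧
        ∃ e : Quo (idlPhir q r.1.asIdeal) ≃ₐ[k] (Polynomial k ⧸ r.1.asIdeal) ⊗[k] YY q,
          e (quo k _ (elC q)) = Ideal.Quotient.mk r.1.asIdeal Polynomial.X ⊗ₜ[k] (1 : YY q) ∧
          e (quo k _ (gY q)) = 1 ⊗ₜ[k] yyY q ∧ e (quo k _ (gK q)) = 1 ⊗ₜ[k] yyK q) ∧
    -- the zero prime
    contr (loc k (denXPhi q)) = {⊥} := by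
  refine ⟨⟨primeAt_injective hq, range_primeAt hq, primeAt_le_iff hq, isCoatom_idlYEp q,
      isCoatom_idlNm hq true, isCoatom_idlNm hq false, infinite_maximalSpectrum_laurent hq,
      infinite_maxNZ hq⟩,
    ⟨oreSet_denX hq, oreSet_denXPhi hq, oreSet_denXY hq, oreSet_denPhiY hq, oreSet_denZ hq,
      oreSet_denY hq, oreSet_denE q⟩, ?_⟩
  intro _ _ _ _ _ _ _
  refine ⟨⟨spec_eq_union hq, pairwise_disjoint_contr hq, (injective_comap_toL q).injOn,
      (injective_comap_toUE q).injOn, (injective_comap_toAXZloc hq).injOn,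
      (injective_comap_toAXloc hq).injOn, (injective_comap_toLocQuo hq).injOn,
      (clears_loc _).injective_comap.injOn⟩,
    ⟨contr_toL q, fun p _ => exists_quo_idlYEp_equiv q p⟩,
    ⟨contr_toUE q hq, idl_gY_eq q, idl_gY_eq' q, exists_quo_equiv_skewLaurent true⟩,
    ⟨contr_toAXZloc hq, exists_AXZloc_equiv_yy hq, idl_gE_eq q, idl_gE_eq' q,
      exists_quo_equiv_skewLaurent false⟩,
    ⟨contr_toAXloc hq, ⟨isDomain_quo_nrm hq true, exists_EN_equiv_plane true hq, ?_⟩, fun m =>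
      ⟨m.finite, m.isField, isDomain_quo_idlNm hq true m, isSimpleRing_quo_idlNm hq true m,
        exists_quo_idlNm_equiv_ext hq true m (denPhiY q) rfl, exists_quo_idlNm_equiv hq true m⟩⟩,
    ⟨contr_toLocQuo hq, exists_locQuo_equiv hq, exists_locQuo_denXY_equiv_gen hq,
      ⟨isDomain_quo_nrm hq false, exists_EN_equiv_plane false hq, ?_⟩, fun m =>
      ⟨m.finite, m.isField, isDomain_quo_idlNm hq false m, isSimpleRing_quo_idlNm hq false m,
        exists_quo_idlNm_equiv_ext hq false m (denXY q) rfl, exists_quo_idlNm_equiv hq false m⟩⟩,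
    contr_loc_denXPhi hq⟩
  · obtain ⟨τ, hE, hY⟩ := exists_scaling_EN true hq
    exact ⟨τ, hE, hY, exists_quo_nrm_equiv_skewLaurent true hq hE hY⟩
  · obtain ⟨τ, hE, hY⟩ := exists_scaling_EN false hq
    exact ⟨τ, hE, hY, exists_quo_nrm_equiv_skewLaurent false hq hE hY⟩
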